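/- **Notation.** Let $n\ge 2$; write $a\wedge b=\min(a,b)$, $1/\infty=0$, and $s_p=(n-1)\big(\tfrac1{p\wedge 1}-1\big)$. Let $\mathscr F f(\xi)=\int f(x)e^{-2\pi i x\cdot\xi}\,dx$, extended to tempered distributions. Fix a smooth $\eta:\mathbb R\to[0,1]$ with $\eta(t)=1$ for $|t|\le 1$ and $\eta(t)=0$ for $|t|\ge 2$. On $\mathbb R^n$ and on $\mathbb R^{n-1}$ put $\varphi_k(\xi)=\eta(2^{-k}|\xi|)-\eta(2\cdot 2^{-k}|\xi|)$ for $k\ge1$, $\varphi_0=1-\sum_{k\ge1}\varphi_k$, and $\Delta_k=\mathscr F^{-1}\varphi_k\mathscr F$, so that $\Delta_kf$ is a smooth function for every tempered distribution $f$. For $0<p,q\le\infty$ and $s\in\mathbb R$ let $$\|f\|_{B^s_{p,q}}=\Big(\sum_{k\ge0}2^{skq}\|\Delta_kf\|_{L^p}^q\Big)^{1/q}\quad(\text{supremum over }k\text{ if }q=\infty),$$ and, for $0<r<\infty$, $$\|f\|_{\tilde B^s_{p,r}}=\Big(\sum_{k\ge0}\max(k,1)\,2^{skr}\|\Delta_kf\|_{L^p}^r\Big)^{1/r}.$$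 *Lizorkin decomposition of $\mathbb R^n$.* Let $K_0=[-1,1]^n$ and, for $k\ge1$, $K_k=(-2^k,2^k)^n\setminus(-2^{k-1},2^{k-1})^n$. The hyperplanes $\xi_m=0$ and $\xi_m=\pm2^{k-1}$ ($1\le m\le n$) divide $K_k$ into $T=4^n-2^n$ open cubes $P_{k,t}$. The $2^n$ cubes with $|\xi_m|<2^{k-1}$ for all $m<n$ (those near the $n$-th axis) are numbered $t=1,\dots,2^n$, the others $t=2^n+1,\dots,T$. Put $P_{0,t}=K_0$ for all $t$. For $1<p<\infty$ we say that $f$ has a Lizorkin decomposition in $L^p$ if there are functions $\Delta_{k,t}f\in L^p$ (equal to one function $\Delta_{0,*}f$ for $k=0$) such that $\mathscr F\Delta_{k,t}f$ equals $\mathscr Ff$ inside $P_{k,t}$ and vanishes outside $\overline{P_{k,t}}$, and $f=\Delta_{0,*}f+\sum_{k\ge1}\sum_{t=1}^T\Delta_{k,t}f$ in the sense of tempered distributions. These functions are then unique; they are $\mathscr F^{-1}\chi_{P_{k,t}}\mathscr Ff$. For such $f$ and $0<r<\infty$ let $$\|f\|_{B^{s_1,s_2}_{p,r}}=\Big(\sum_{k\ge0}\Big[\sum_{t\le2^n}2^{s_1kr}\|\Delta_{k,t}f\|_{L^p}^r+\sum_{2^n<t\le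 T}2^{s_2kr}\|\Delta_{k,t}f\|_{L^p}^r\Big]\Big)^{1/r},$$ $$\|f\|_{\tilde B^{s_1,s_2}_{p,r}}=\Big(\sum_{k\ge0}\Big[\sum_{t\le2^n}k\,2^{s_1kr}\|\Delta_{k,t}f\|_{L^p}^r+\sum_{2^n<t\le T}2^{s_2kr}\|\Delta_{k,t}f\|_{L^p}^r\Big]\Big)^{1/r},$$ and let both be $\infty$ for all other $f$. Each space consists of the tempered distributions for which its quasi-norm is finite. *Trace.* $\mathrm{Tr}\,f=f(\cdot,0)$ is the sum of the series $\sum_{k\ge0}(\Delta_kf)(\cdot,0)$, if it converges in the space of tempered distributions on $\mathbb R^{n-1}$. We write $\mathrm{Tr}:X\to Y$ if $\mathrm{Tr}\,f$ exists for all $f\in X$ and there is a constant $C<\infty$ with $\|\mathrm{Tr}\,f\|_Y\le C\|f\|_X$ for all $f\in X$. **Theorem.** Let $n\ge2$. If $f$ is a continuous function of at most polynomial growth, then $\mathrm{Tr}\,f$ exists and is the restriction $\bar x\mapsto f(\bar x,0)$. Let $0<p,q\le\infty$. Then $$\mathrm{Tr}:\ \tilde B^{s_p+1/p}_{p,\,p\wedge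 q\wedge1}(\mathbb R^n)\to B^{s_p}_{p,q}(\mathbb R^{n-1}),$$ and for every $s<s_p$ $$\mathrm{Tr}:\ B^{s_p+1/p}_{p,\,p\wedge q\wedge1}(\mathbb R^n)\to B^{s}_{p,q}(\mathbb R^{n-1}).$$ Moreover, if $1<p<\infty$, then $$\mathrm{Tr}:\ \tilde B^{1/p,1/p}_{p,\,q\wedge1}(\mathbb R^n)\to B^{0}_{p,q}(\mathbb R^{n-1}),$$ and for every $s<0$ $$\mathrm{Tr}:\ B^{1/p,\,s+1/p}_{p,\,q\wedge1}(\mathbb R^n)\to B^{s}_{p,q}(\mathbb R^{n-1}).$$ -/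

import Mathlib

open MeasureTheory Filter Topology
open scoped ENNReal NNReal SchwartzMap FourierTransform

noncomputable section

/-- Euclidean space `ℝⁿ`. -/
abbrev Rn (n : ℕ) : Type := EuclideanSpace ℝ (Fin n)

/-! ### The smooth dyadic decomposition -/

/-- A smooth function `η : ℝ → [0,1]` with `η = 1` on `[-1,1]` and `η = 0` for `|t| ≥ 2`. -/
structure DyadicBump where
  toFun : ℝ → ℝ
  smooth : ContDiff ℝ (⊤ : ℕ∞) toFun
  mem_Icc : ∀ t, toFun t ∈ Set.Icc (0 : ℝ) 1
  eq_one : ∀ t, |t| ≤ 1 → toFun t = 1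
  eq_zero : ∀ t, 2 ≤ |t| → toFun t = 0

/-- The symbols `φ_k` on `ℝⁿ`: `φ_k(ξ) = η(2^{-k}|ξ|) - η(2·2^{-k}|ξ|)` for `k ≥ 1`, and
`φ_0(ξ) = 1 - ∑_{k ≥ 1} φ_k(ξ) = η(|ξ|)` (the sum telescopes, see `dyadicSymbol_sum`). -/
def dyadicSymbol (η : DyadicBump) {n : ℕ} (k : ℕ) (ξ : Rn n) : ℝ :=
  if k = 0 then η.toFun ‖ξ‖
  else η.toFun ((2 : ℝ)⁻¹ ^ k * ‖ξ‖) - η.toFun (2 * ((2 : ℝ)⁻¹ ^ k * ‖ξ‖))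

theorem dyadicSymbol_sum (η : DyadicBump) {n : ℕ} (N : ℕ) (ξ : Rn n) :
    ∑ k ∈ Finset.range (N + 1), dyadicSymbol η k ξ = η.toFun ((2 : ℝ)⁻¹ ^ N * ‖ξ‖) := by
  induction N with
  | zero => simp [dyadicSymbol]
  | succ N ih =>
    rw [Finset.sum_range_succ, ih]
    have h : 2 * ((2 : ℝ)⁻¹ ^ (N + 1) * ‖ξ‖) = (2 : ℝ)⁻¹ ^ N * ‖ξ‖ := by
      rw [pow_succ]; ring
    simp only [dyadicSymbol, Nat.succ_ne_zero, if_false, h]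
    ring

theorem DyadicBump.contDiff_norm (η : DyadicBump) {n : ℕ} (c : ℝ) :
    ContDiff ℝ (⊤ : ℕ∞) (fun ξ : Rn n => η.toFun (c * ‖ξ‖)) := by
  rw [contDiff_iff_contDiffAt]
  intro ξ
  by_cases hξ : ξ = 0
  · have hc : Continuous (fun ζ : Rn n => |c * ‖ζ‖|) := by fun_prop
    have hev : ∀ᶠ ζ in 𝓝 ξ, |c * ‖ζ‖| < 1 :=
      hc.continuousAt.eventually_lt continuousAt_const (by simp [hξ])
    have he : (fun ζ : Rn n => η.toFun (c * ‖ζ‖)) =ᶠ[𝓝 ξ] fun _ => (1 : ℝ) := by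
      filter_upwards [hev] with ζ hζ
      exact η.eq_one _ hζ.le
    exact contDiffAt_const.congr_of_eventuallyEq he
  · exact η.smooth.contDiffAt.comp ξ (contDiffAt_const.mul (contDiffAt_norm ℝ hξ))

theorem contDiff_dyadicSymbol (η : DyadicBump) {n : ℕ} (k : ℕ) :
    ContDiff ℝ (⊤ : ℕ∞) (dyadicSymbol η k : Rn n → ℝ) := by
  by_cases hk : k = 0
  · have h := η.contDiff_norm (n := n) 1
    simp only [one_mul] at h
    have e : (dyadicSymbol η k : Rn n → ℝ) = fun ξ => η.toFun ‖ξ‖ := by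
      funext ξ
      simp only [dyadicSymbol, hk, if_true]
    rw [e]
    exact h
  · have h1 := η.contDiff_norm (n := n) ((2 : ℝ)⁻¹ ^ k)
    have h2 := η.contDiff_norm (n := n) (2 * (2 : ℝ)⁻¹ ^ k)
    have h := h1.sub h2
    have e : (dyadicSymbol η k : Rn n → ℝ) = fun ξ =>
        η.toFun ((2 : ℝ)⁻¹ ^ k * ‖ξ‖) - η.toFun (2 * (2 : ℝ)⁻¹ ^ k * ‖ξ‖) := by
      funext ξ
      simp only [dyadicSymbol, hk, if_false, mul_assoc]
    rw [e]
    exact h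

theorem dyadicSymbol_eq_zero (η : DyadicBump) {n : ℕ} (k : ℕ) (ξ : Rn n)
    (h : 2 * 2 ^ k ≤ ‖ξ‖) : dyadicSymbol η k ξ = 0 := by
  have h0 : (2 : ℝ) ≤ (2 : ℝ)⁻¹ ^ k * ‖ξ‖ := by
    have : (2 : ℝ)⁻¹ ^ k * (2 * 2 ^ k) ≤ (2 : ℝ)⁻¹ ^ k * ‖ξ‖ := by gcongr
    refine le_trans (le_of_eq ?_) this
    rw [inv_pow]; field_simp
  have h1 : η.toFun ((2 : ℝ)⁻¹ ^ k * ‖ξ‖) = 0 := η.eq_zero _ (h0.trans (le_abs_self _))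
  have h2 : η.toFun (2 * ((2 : ℝ)⁻¹ ^ k * ‖ξ‖)) = 0 :=
    η.eq_zero _ (le_trans (by linarith) (le_abs_self _))
  by_cases hk : k = 0
  · subst hk
    simpa [dyadicSymbol] using h1
  · simp only [dyadicSymbol, hk, if_false, h1, h2, sub_zero]

/-- The test function `ξ ↦ e^{2πi⟨ξ,x⟩} φ_k(ξ)`. -/
def dyadicTest (η : DyadicBump) {n : ℕ} (k : ℕ) (x : Rn n) : 𝓢(Rn n, ℂ) :=
  HasCompactSupport.toSchwartzMap
    (f := fun ξ : Rn n =>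
      Complex.exp (2 * Real.pi * Complex.I * ((inner ℝ ξ x : ℝ) : ℂ)) * (dyadicSymbol η k ξ : ℂ))
    (HasCompactSupport.intro (isCompact_closedBall (0 : Rn n) (2 * 2 ^ k)) (by
      intro ξ hξ
      have : 2 * 2 ^ k ≤ ‖ξ‖ := by
        have := hξ
        rw [Metric.mem_closedBall, dist_zero_right, not_le] at this
        exact this.le
      simp [dyadicSymbol_eq_zero η k ξ this]))
    (by
      have h1 : ContDiff ℝ (⊤ : ℕ∞) (fun ξ : Rn n => ((inner ℝ ξ x : ℝ) : ℂ)) :=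
        Complex.ofRealCLM.contDiff.comp (contDiff_id.inner ℝ contDiff_const)
      have h2 : ContDiff ℝ (⊤ : ℕ∞) (fun ξ : Rn n => (dyadicSymbol η k ξ : ℂ)) :=
        Complex.ofRealCLM.contDiff.comp (contDiff_dyadicSymbol η k)
      exact (contDiff_const.mul h1).cexp.mul h2)

/-- `Δ_k f = 𝓕⁻¹ φ_k 𝓕 f` for a tempered distribution `f`. Since `φ_k 𝓕 f` has compact support,
`Δ_k f` is the smooth function `x ↦ ⟨𝓕 f, e^{2πi⟨·,x⟩} φ_k⟩`. -/
def dyadicBlock (η : DyadicBump) {n : ℕ} (k : ℕ) (f : 𝓢'(Rn n, ℂ)) (x : Rn n) : ℂ :=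
  (𝓕 f) (dyadicTest η k x)

/-! ### Besov spaces -/

/-- The `ℓ^q` quasi-norm, `0 < q ≤ ∞`, of a sequence in `[0,∞]`. -/
def ellNorm (q : ℝ≥0∞) (a : ℕ → ℝ≥0∞) : ℝ≥0∞ :=
  if q = ⊤ then ⨆ k, a k else (∑' k, a k ^ q.toReal) ^ (1 / q.toReal)

/-- The Besov quasi-norm of `B^s_{p,q}(ℝⁿ)`; the space consists of all tempered distributions for
which it is finite. -/
def besovNorm (η : DyadicBump) {n : ℕ} (s : ℝ) (p q : ℝ≥0∞) (f : 𝓢'(Rn n, ℂ)) : ℝ≥0∞ :=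
  ellNorm q fun k => (2 : ℝ≥0∞) ^ (s * k) * eLpNorm (dyadicBlock η k f) p volume

/-- The quasi-norm of the log-weighted Besov space `B̃^s_{p,r}(ℝⁿ)`, `0 < r < ∞`. The `k`-th
block has weight `k` if `k ≥ 1`, and the block `k = 0` has weight `1`. -/
def logBesovNorm (η : DyadicBump) {n : ℕ} (s : ℝ) (p : ℝ≥0∞) (r : ℝ) (f : 𝓢'(Rn n, ℂ)) : ℝ≥0∞ :=
  (∑' k : ℕ, ((max k 1 : ℕ) : ℝ≥0∞) *
    ((2 : ℝ≥0∞) ^ (s * k) * eLpNorm (dyadicBlock η k f) p volume) ^ r) ^ (1 / r)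

/-! ### Lizorkin's decomposition -/

/-- Labels of the `4ⁿ - 2ⁿ` Lizorkin cubes of a given level. For each coordinate there are two
bits: whether it lies in the outer half of the range, and whether it is positive. At least one
coordinate has to be outer. -/
abbrev LizorkinIndex (n : ℕ) : Type := {c : Fin n → Bool × Bool // ∃ i, (c i).1 = true}

/-- The cubes `P_{k,t}`. All `P_{0,t}` are the cube `K_0 = [-1,1]ⁿ`. -/
def lizorkinCube {n : ℕ} (k : ℕ) (t : LizorkinIndex n) : Set (Rn n) :=
  match k with
  | 0 => {ξ | ∀ i, |ξ i| ≤ 1}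
  | j + 1 => {ξ | ∀ i, (if (t.1 i).2 then ξ i else -ξ i) ∈
      (if (t.1 i).1 then Set.Ioo ((2 : ℝ) ^ j) (2 ^ (j + 1)) else Set.Ioo 0 ((2 : ℝ) ^ j))}

/-- The `2ⁿ` labels `t` of the cubes near the `n`-th axis: the first `n - 1` coordinates are
inner (hence the last one is outer). -/
def IsNearAxis {n : ℕ} (t : LizorkinIndex n) : Prop :=
  ∀ i : Fin n, (i : ℕ) < n - 1 → (t.1 i).1 = false

/-- A family of functions indexed like the cubes: one function for `K_0` and one for each `P_{k,t}`
with `k ≥ 1`. -/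
structure LizorkinFamily (n : ℕ) where
  low : Rn n → ℂ
  high : ℕ → LizorkinIndex n → Rn n → ℂ

/-- The member with label `(k,t)`. As `P_{0,t} = K_0` for all `t`, it is `low` for `k = 0`. -/
def LizorkinFamily.piece {n : ℕ} (u : LizorkinFamily n) (k : ℕ) (t : LizorkinIndex n) :
    Rn n → ℂ :=
  match k with
  | 0 => u.low
  | j + 1 => u.high j t

/-- `u` is the family of the sharp frequency cut-offs `Δ_{k,t} f = 𝓕⁻¹ χ_{k,t} 𝓕 f ∈ L^p`:
`𝓕 u_{k,t}` agrees with `𝓕 f` inside the cube `P_{k,t}` and vanishes outside its closure, and `f`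
is the sum of its pieces in the sense of tempered distributions (so that no part of `𝓕 f` sits on
the boundaries of the cubes). For `1 < p < ∞` there is at most one such family, up to null sets,
because no nonzero function in `L^p` has its spectrum in a finite union of hyperplanes. -/
structure IsLizorkinDecomposition {n : ℕ} (p : ℝ≥0∞) (f : 𝓢'(Rn n, ℂ)) (u : LizorkinFamily n) :
    Prop where
  memLp : ∀ k t, MemLp (u.piece k t) p volume
  inside : ∀ k t, ∀ ψ : 𝓢(Rn n, ℂ), tsupport ψ ⊆ interior (lizorkinCube k t) →
    (𝓕 f) ψ = ∫ x, (𝓕 ψ) x * u.piece k t x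
  outside : ∀ k t, ∀ ψ : 𝓢(Rn n, ℂ), tsupport ψ ⊆ (closure (lizorkinCube k t))ᶜ →
    ∫ x, (𝓕 ψ) x * u.piece k t x = 0
  sum : ∀ ψ : 𝓢(Rn n, ℂ),
    Tendsto (fun N : ℕ => (∫ x, ψ x * u.low x) +
      ∑ k ∈ Finset.range N, ∑ t : LizorkinIndex n, ∫ x, ψ x * u.high k t x) atTop (𝓝 (f ψ))

open Classical in
/-- The quasi-norm of the anisotropic space `B^{s₁,s₂}_{p,r}(ℝⁿ)`, `1 < p < ∞`, `0 < r < ∞`; it is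
`∞` if `f` has no decomposition into pieces `Δ_{k,t} f ∈ L^p`. -/
def anisoBesovNorm {n : ℕ} (s₁ s₂ : ℝ) (p : ℝ≥0∞) (r : ℝ) (f : 𝓢'(Rn n, ℂ)) : ℝ≥0∞ :=
  ⨅ (u : LizorkinFamily n) (_ : IsLizorkinDecomposition p f u),
    (∑' k : ℕ, ∑ t : LizorkinIndex n,
      if IsNearAxis t then ((2 : ℝ≥0∞) ^ (s₁ * k) * eLpNorm (u.piece k t) p volume) ^ r
      else ((2 : ℝ≥0∞) ^ (s₂ * k) * eLpNorm (u.piece k t) p volume) ^ r) ^ (1 / r)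

open Classical in
/-- The quasi-norm of the log-weighted anisotropic space `B̃^{s₁,s₂}_{p,r}(ℝⁿ)`, with the factor `k`
on the cubes near the `n`-th axis. -/
def logAnisoBesovNorm {n : ℕ} (s₁ s₂ : ℝ) (p : ℝ≥0∞) (r : ℝ) (f : 𝓢'(Rn n, ℂ)) : ℝ≥0∞ :=
  ⨅ (u : LizorkinFamily n) (_ : IsLizorkinDecomposition p f u),
    (∑' k : ℕ, ∑ t : LizorkinIndex n,
      if IsNearAxis t then
        (k : ℝ≥0∞) * ((2 : ℝ≥0∞) ^ (s₁ * k) * eLpNorm (u.piece k t) p volume) ^ r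
      else ((2 : ℝ≥0∞) ^ (s₂ * k) * eLpNorm (u.piece k t) p volume) ^ r) ^ (1 / r)

/-! ### The trace -/

/-- The point `(x̄, 0)` of `ℝⁿ`, for `x̄ ∈ ℝⁿ⁻¹`. -/
def hyperplanePoint {n : ℕ} (x : Rn (n - 1)) : Rn n :=
  WithLp.toLp 2 fun i : Fin n => if h : (i : ℕ) < n - 1 then x ⟨i, h⟩ else 0

/-- `g = f(·, 0)`: the series `∑_k (Δ_k f)(·, 0)` converges to `g` in the space of tempered
distributions on `ℝⁿ⁻¹`. -/
def HasTrace (η : DyadicBump) {n : ℕ} (f : 𝓢'(Rn n, ℂ)) (g : 𝓢'(Rn (n - 1), ℂ)) : Prop :=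
  ∀ ψ : 𝓢(Rn (n - 1), ℂ),
    Tendsto (fun N : ℕ => ∑ k ∈ Finset.range N,
      ∫ x : Rn (n - 1), ψ x * dyadicBlock η k f (hyperplanePoint x)) atTop (𝓝 (g ψ))

/-- The trace exists on the space with quasi-norm `X` and maps it boundedly into the space with
quasi-norm `Y`. -/
def TraceMaps (η : DyadicBump) {n : ℕ} (X : 𝓢'(Rn n, ℂ) → ℝ≥0∞)
    (Y : 𝓢'(Rn (n - 1), ℂ) → ℝ≥0∞) : Prop :=
  ∃ C : ℝ≥0, ∀ f, X f < ∞ → ∃ g, HasTrace η f g ∧ Y g ≤ C * X f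

/-- `s_p = (n-1)(1/(p ∧ 1) - 1)`. -/
def traceIndex (n : ℕ) (p : ℝ≥0∞) : ℝ := ((n : ℝ) - 1) * ((min p 1)⁻¹.toReal - 1)

end

/-! The trace is the sum of the functions `h_k = (Δ_k f)(·,0)`, and everything rests on their
spectra. Restriction to the hyperplane projects the spectrum orthogonally, so `h_k` has its spectrum
in the ball of radius `2^{k+1}` of `ℝⁿ⁻¹`. Three facts of Plancherel–Pólya–Nikol'skij type follow:
(a) `‖h_k‖_p ≤ C 2^{k/p} ‖Δ_k f‖_p` (`eLpNorm_dyadicBlock_comp_le`); (b) `Δ_i h_k = 0` for `i ≥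
k+2`, and `‖Δ_i h_k‖_p ≤ C 2^{(k-i)s_p} ‖h_k‖_p` for `i ≤ k+1` (`smoothBlock_eq_zero`,
`eLpNorm_smoothBlock_le`); (c) the norm of `h_k` in `L^{max(p,1)}` is at most `C 2^{k s_p} ‖h_k‖_p`
(`IsBandLimited.eLpNorm_max_one_le`), which makes the series converge when tested with Schwartz
functions.

With `a_k = 2^{(s_p+1/p)k} ‖Δ_k f‖_p`, (a) and (b) give `2^{si} ‖Δ_i h_k‖_p ≤ C 2^{(s-s_p)i} a_k`.
For `r = p∧q∧1` the `r`-th power of the `L^p` quasi-norm is subadditive and `ℓ^r ⊂ ℓ^q`, so the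
`r`-th powers can simply be summed over `i` and `k`. If `s < s_p`, the sum over `i ≤ k+1` is
geometric and costs a constant; if `s = s_p`, it has `k+2` equal terms, and this is the weight `k`
of the logarithmic space (`traceMaps_weighted`).

In the anisotropic case `f` is a sum of pieces with spectrum in Lizorkin cubes. The trace of a piece
near the `n`-th axis may contain all frequencies up to the size of its level and behaves as above.
Away from the axis some coordinate of `ξ̄` is large on the cube, so the trace of a piece of level
`k` meets only boundedly many dyadic blocks, all of level about `k`: no logarithm arises and
`2^{si}` is comparable to `2^{sk}` (`exists_hasTrace_lizorkinSeries`). For `s < 0` these traces may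
grow with `k`, but high frequencies tested with a Schwartz function gain any power of `2^{-k}`
(`exists_gauge_highPass`).

Blocks of a distribution are defined by duality. The interchanges with integrals are justified by
writing a cut-off distribution as a function of moderate growth (`exists_fourier_repr`); afterwards
only the class `IsBandLimited` matters. -/

/-! ### Plane waves and rescaled kernels -/

/-- The plane wave `e^{2πi⟨ξ,x⟩}`. -/
noncomputable def planeWave {n : ℕ} (ξ x : Rn n) : ℂ :=
  Complex.exp (2 * Real.pi * Complex.I * ((inner ℝ ξ x : ℝ) : ℂ))

theorem norm_planeWave {n : ℕ} (ξ x : Rn n) : ‖planeWave ξ x‖ = 1 := by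
  have : planeWave ξ x = Complex.exp (((2 * Real.pi * inner ℝ ξ x : ℝ) : ℂ) * Complex.I) := by
    rw [planeWave]; congr 1; push_cast; ring
  rw [this, Complex.norm_exp_ofReal_mul_I]

theorem Continuous.planeWave {X : Type*} [TopologicalSpace X] {n : ℕ} {f g : X → Rn n}
    (hf : Continuous f) (hg : Continuous g) : Continuous fun z => planeWave (f z) (g z) := by
  unfold _root_.planeWave; fun_prop

theorem planeWave_comm {n : ℕ} (ξ x : Rn n) : planeWave ξ x = planeWave x ξ := by
  rw [planeWave, planeWave, real_inner_comm]

theorem planeWave_add_left {n : ℕ} (ξ ζ x : Rn n) :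
    planeWave (ξ + ζ) x = planeWave ξ x * planeWave ζ x := by
  rw [planeWave, planeWave, planeWave, ← Complex.exp_add, inner_add_left]
  congr 1; push_cast; ring

theorem planeWave_zero_right {n : ℕ} (ξ : Rn n) : planeWave ξ 0 = 1 := by
  simp [planeWave]

theorem planeWave_smul {n : ℕ} (c : ℝ) (ξ x : Rn n) :
    planeWave (c • ξ) x = planeWave ξ (c • x) := by
  simp [planeWave, inner_smul_left, inner_smul_right]

theorem fourier_eq_integral_planeWave {n : ℕ} (f : Rn n → ℂ) (y : Rn n) :
    𝓕 f y = ∫ ξ, planeWave ξ (-y) * f ξ := by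
  rw [Real.fourier_eq']
  refine integral_congr_ae (Eventually.of_forall fun ξ => ?_)
  simp only [smul_eq_mul, planeWave, inner_neg_right]
  congr 2; push_cast; ring

theorem fourierInv_eq_integral_planeWave {n : ℕ} (f : Rn n → ℂ) (y : Rn n) :
    𝓕⁻ f y = ∫ ξ, planeWave ξ y * f ξ := by
  rw [Real.fourierInv_eq']
  refine integral_congr_ae (Eventually.of_forall fun ξ => ?_)
  simp only [smul_eq_mul, planeWave]
  congr 2; push_cast; ring

theorem SchwartzMap.fourier_apply_planeWave {n : ℕ} (f : 𝓢(Rn n, ℂ)) (y : Rn n) :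
    (𝓕 f) y = ∫ ξ, planeWave ξ (-y) * f ξ := by
  rw [SchwartzMap.fourier_coe, fourier_eq_integral_planeWave]

theorem SchwartzMap.fourierInv_apply_planeWave {n : ℕ} (f : 𝓢(Rn n, ℂ)) (y : Rn n) :
    (𝓕⁻ f) y = ∫ ξ, planeWave ξ y * f ξ := by
  rw [SchwartzMap.fourierInv_coe, fourierInv_eq_integral_planeWave]

/-- The rescaled and translated kernel `y ↦ 2^{kn} Ψ(2^k (y - x))`. -/
noncomputable def kernelAt {n : ℕ} (Ψ : 𝓢(Rn n, ℂ)) (k : ℕ) (x : Rn n) : 𝓢(Rn n, ℂ) :=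
  SchwartzMap.compSubConstCLM ℂ x (((2 : ℂ) ^ k) ^ n •
    SchwartzMap.compCLMOfContinuousLinearEquiv ℂ
      (ContinuousLinearEquiv.smulLeft (R₁ := ℝ) (Units.mk0 ((2 : ℝ) ^ k) (by positivity))) Ψ)

theorem kernelAt_apply {n : ℕ} (Ψ : 𝓢(Rn n, ℂ)) (k : ℕ) (x y : Rn n) :
    kernelAt Ψ k x y = ((2 : ℂ) ^ k) ^ n * Ψ ((2 : ℝ) ^ k • (y - x)) := by
  rw [kernelAt, SchwartzMap.compSubConstCLM_apply]
  rfl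

/-- The test function `ξ ↦ e^{2πi⟨ξ,x⟩} Φ(2^{-k}ξ)`, see `waveTest_apply`. -/
noncomputable def waveTest {n : ℕ} (Φ : 𝓢(Rn n, ℂ)) (k : ℕ) (x : Rn n) : 𝓢(Rn n, ℂ) :=
  𝓕⁻ (kernelAt (𝓕 Φ) k x)

theorem fourier_waveTest {n : ℕ} (Φ : 𝓢(Rn n, ℂ)) (k : ℕ) (x : Rn n) :
    𝓕 (waveTest Φ k x) = kernelAt (𝓕 Φ) k x := by
  rw [waveTest, FourierInvPair.fourier_fourierInv_eq]

theorem waveTest_apply {n : ℕ} (Φ : 𝓢(Rn n, ℂ)) (k : ℕ) (x ξ : Rn n) :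
    waveTest Φ k x ξ = planeWave ξ x * Φ (((2 : ℝ) ^ k)⁻¹ • ξ) := by
  have h2 : (2 : ℝ) ^ k ≠ 0 := by positivity
  have e1 : Φ (((2 : ℝ) ^ k)⁻¹ • ξ) = ∫ v, planeWave v (((2 : ℝ) ^ k)⁻¹ • ξ) * (𝓕 Φ) v := by
    rw [← SchwartzMap.fourierInv_apply_planeWave, FourierPair.fourierInv_fourier_eq]
  rw [waveTest, SchwartzMap.fourierInv_apply_planeWave, e1,
    ← integral_add_right_eq_self _ x]
  have e2 := Measure.integral_comp_smul volume
    (fun v : Rn n => planeWave v (((2 : ℝ) ^ k)⁻¹ • ξ) * (𝓕 Φ) v) ((2 : ℝ) ^ k)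
  have e3 : ∫ v, planeWave v (((2 : ℝ) ^ k)⁻¹ • ξ) * (𝓕 Φ) v = ((2 : ℂ) ^ k) ^ n *
      ∫ v, planeWave ((2 : ℝ) ^ k • v) (((2 : ℝ) ^ k)⁻¹ • ξ) * (𝓕 Φ) ((2 : ℝ) ^ k • v) := by
    rw [e2, finrank_euclideanSpace_fin, abs_of_pos (by positivity), Complex.real_smul]
    push_cast
    rw [← mul_assoc, mul_inv_cancel₀ (by simp), one_mul]
  rw [e3, ← integral_const_mul, ← integral_const_mul]
  refine integral_congr_ae (Eventually.of_forall fun v => ?_)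
  simp only [kernelAt_apply, add_sub_cancel_right]
  have e4 : planeWave (v + x) ξ = planeWave v ξ * planeWave ξ x := by
    rw [planeWave_add_left]; congr 1; rw [planeWave, planeWave, real_inner_comm]
  rw [e4, planeWave_smul, smul_smul, mul_inv_cancel₀ h2, one_smul]
  ring

/-! ### Dyadic symbols as dilates of two base symbols -/

theorem dyadicTest_apply (η : DyadicBump) {n : ℕ} (k : ℕ) (x ξ : Rn n) :
    dyadicTest η k x ξ = planeWave ξ x * (dyadicSymbol η k ξ : ℂ) := rfl

/-- The symbol whose dilate by `2^{k-1}` (by `1` if `k = 0`) is `φ_k`. -/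
noncomputable def baseSymbol (η : DyadicBump) (n k : ℕ) : 𝓢(Rn n, ℂ) :=
  dyadicTest η (min k 1) 0

theorem baseSymbol_apply (η : DyadicBump) {n : ℕ} (k : ℕ) (ξ : Rn n) :
    baseSymbol η n k ξ = (dyadicSymbol η (min k 1) ξ : ℂ) := by
  rw [baseSymbol, dyadicTest_apply, planeWave_zero_right, one_mul]

/-- Only two base symbols occur, one for `k = 0` and one for all `k ≥ 1`, so a bound for a fixed
Schwartz function and its dilates is uniform in `k`. The truncated difference `k - 1` is the right
dilation for `k = 0` too. -/
theorem dyadicTest_eq_waveTest (η : DyadicBump) {n : ℕ} (k : ℕ) (x : Rn n) :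
    dyadicTest η k x = waveTest (baseSymbol η n k) (k - 1) x := by
  ext ξ
  rw [dyadicTest_apply, waveTest_apply, baseSymbol_apply]
  congr 2
  cases k with
  | zero => simp [dyadicSymbol]
  | succ k =>
    have hm : min (k + 1) 1 = 1 := by omega
    have h2 : (0 : ℝ) < 2 ^ k := by positivity
    simp only [dyadicSymbol, hm, Nat.succ_ne_zero, one_ne_zero, if_false, Nat.add_sub_cancel,
      norm_smul, norm_inv, Real.norm_eq_abs, abs_of_pos h2, pow_succ, inv_pow]
    congr 2 <;> ring

theorem fourier_dyadicTest (η : DyadicBump) {n : ℕ} (k : ℕ) (x : Rn n) :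
    𝓕 (dyadicTest η k x) = kernelAt (𝓕 (baseSymbol η n k)) (k - 1) x := by
  rw [dyadicTest_eq_waveTest, fourier_waveTest]

/-- The low-pass test function `ξ ↦ e^{2πi⟨ξ,x⟩} η(2^{-k}|ξ|)`. -/
noncomputable def lowTest (η : DyadicBump) {n : ℕ} (k : ℕ) (x : Rn n) : 𝓢(Rn n, ℂ) :=
  waveTest (baseSymbol η n 0) k x

theorem lowTest_apply (η : DyadicBump) {n : ℕ} (k : ℕ) (x ξ : Rn n) :
    lowTest η k x ξ = planeWave ξ x * (η.toFun ((2 : ℝ)⁻¹ ^ k * ‖ξ‖) : ℂ) := by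
  have h2 : (0 : ℝ) < 2 ^ k := by positivity
  rw [lowTest, waveTest_apply, baseSymbol_apply]
  simp [dyadicSymbol, norm_smul]

theorem lowTest_eq_sum (η : DyadicBump) {n : ℕ} (k : ℕ) (x : Rn n) :
    lowTest η k x = ∑ i ∈ Finset.range (k + 1), dyadicTest η i x := by
  ext ξ
  rw [lowTest_apply, ← dyadicSymbol_sum, sum_apply]
  simp only [dyadicTest_apply]
  push_cast
  rw [Finset.mul_sum]

theorem lowTest_apply_of_le (η : DyadicBump) {n : ℕ} (k : ℕ) (x ξ : Rn n) (h : ‖ξ‖ ≤ 2 ^ k) :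
    lowTest η k x ξ = planeWave ξ x := by
  rw [lowTest_apply, η.eq_one, Complex.ofReal_one, mul_one]
  rw [abs_of_nonneg (by positivity), inv_pow, inv_mul_le_iff₀ (by positivity)]
  simpa using h

theorem lowTest_apply_eq_zero (η : DyadicBump) {n : ℕ} (k : ℕ) (x ξ : Rn n)
    (h : 2 * 2 ^ k ≤ ‖ξ‖) : lowTest η k x ξ = 0 := by
  rw [lowTest_apply, η.eq_zero, Complex.ofReal_zero, mul_zero]
  rw [abs_of_nonneg (by positivity), inv_pow, ← div_eq_inv_mul, le_div_iff₀ (by positivity)]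
  exact h

theorem dyadicSymbol_eq_zero_of_le (η : DyadicBump) {n : ℕ} (k : ℕ) (hk : k ≠ 0) (ξ : Rn n)
    (h : 2 * ‖ξ‖ ≤ 2 ^ k) : dyadicSymbol η k ξ = 0 := by
  have h2 : (0 : ℝ) < 2 ^ k := by positivity
  have h1 : 2 * ((2 : ℝ)⁻¹ ^ k * ‖ξ‖) ≤ 1 := by
    rw [inv_pow, ← mul_assoc, mul_comm 2, mul_assoc, inv_mul_le_iff₀ h2]; simpa using h
  have h0 : 0 ≤ (2 : ℝ)⁻¹ ^ k * ‖ξ‖ := by positivity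
  simp only [dyadicSymbol, hk, if_false]
  rw [η.eq_one, η.eq_one, sub_self]
  · rw [abs_of_nonneg (by linarith)]; exact h1
  · rw [abs_of_nonneg h0]; linarith

theorem dyadicBlock_eq (η : DyadicBump) {n : ℕ} (k : ℕ) (f : 𝓢'(Rn n, ℂ)) (x : Rn n) :
    dyadicBlock η k f x = f (kernelAt (𝓕 (baseSymbol η n k)) (k - 1) x) := by
  rw [dyadicBlock, TemperedDistribution.fourier_apply, fourier_dyadicTest]

/-! ### Integrals of rescaled kernels -/

theorem lintegral_comp_pow_smul_sub {m : ℕ} (g : Rn m → ℝ≥0∞) (hg : Measurable g) (j : ℕ)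
    (x₀ : Rn m) :
    ∫⁻ x, g ((2 : ℝ) ^ j • (x - x₀)) = (2 : ℝ≥0∞) ^ (-((j : ℝ) * m)) * ∫⁻ x, g x := by
  rw [lintegral_sub_right_eq_self (fun x => g ((2 : ℝ) ^ j • x)) x₀]
  have h2 : (2 : ℝ) ^ j ≠ 0 := by positivity
  have h := Measure.map_addHaar_smul (volume : Measure (Rn m)) h2
  rw [← lintegral_map (μ := volume) (g := fun x : Rn m => (2 : ℝ) ^ j • x) hg
    (measurable_const_smul _), h, lintegral_smul_measure, finrank_euclideanSpace_fin]
  congr 1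
  rw [abs_of_pos (by positivity), ← pow_mul, ENNReal.ofReal_inv_of_pos (by positivity),
    ENNReal.ofReal_pow (by positivity), ENNReal.ofReal_ofNat, ENNReal.rpow_neg, ← Nat.cast_mul,
    ENNReal.rpow_natCast]

/-- Take the orthogonal projection of `y`: the adjoint of `L` is a left inverse of norm at most one.
Decay of a kernel in `y - L x` thus becomes decay in `x` about a centre, uniformly in `y`. -/
theorem LinearIsometry.exists_norm_sub_le {m n : ℕ} (L : Rn m →ₗᵢ[ℝ] Rn n) (y : Rn n) :
    ∃ x₀ : Rn m, ∀ x, ‖x - x₀‖ ≤ ‖y - L x‖ := by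
  set A := ContinuousLinearMap.adjoint L.toContinuousLinearMap with hA
  have hL : ∀ x, A (L x) = x := by
    intro x
    refine ext_inner_right ℝ fun z => ?_
    rw [hA, ContinuousLinearMap.adjoint_inner_left]
    exact L.inner_map_map x z
  refine ⟨A y, fun x => ?_⟩
  have h1 : ‖A‖ ≤ 1 := by
    rw [hA, LinearIsometryEquiv.norm_map]; exact L.norm_toContinuousLinearMap_le
  calc ‖x - A y‖ = ‖A (y - L x)‖ := by rw [map_sub, hL, norm_sub_rev]
    _ ≤ 1 * ‖y - L x‖ := A.le_of_opNorm_le h1 _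
    _ = ‖y - L x‖ := one_mul _

theorem SchwartzMap.exists_decay {n : ℕ} (Ψ : 𝓢(Rn n, ℂ)) (M : ℕ) :
    ∃ C : ℝ, 0 ≤ C ∧ ∀ z, ‖Ψ z‖ ≤ C * ((1 + ‖z‖) ^ M)⁻¹ := by
  refine ⟨2 ^ M * (Finset.Iic (M, 0)).sup (fun m => SchwartzMap.seminorm ℝ m.1 m.2) Ψ,
    by positivity, fun z => ?_⟩
  have h := SchwartzMap.one_add_le_sup_seminorm_apply (𝕜 := ℝ) (m := (M, 0)) le_rfl le_rfl Ψ z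
  rw [norm_iteratedFDeriv_zero] at h
  have hz : 0 < (1 + ‖z‖) ^ M := by positivity
  rw [← div_eq_mul_inv, le_div_iff₀ hz, mul_comm]
  exact h

theorem enorm_kernelAt_le {n : ℕ} (Ψ : 𝓢(Rn n, ℂ)) :
    ∃ A : ℝ≥0, ∀ (j : ℕ) (x y : Rn n), ‖kernelAt Ψ j x y‖ₑ ≤ A * (2 : ℝ≥0∞) ^ ((j : ℝ) * n) := by
  obtain ⟨C, hC0, hC⟩ := Ψ.exists_decay 0
  refine ⟨C.toNNReal, fun j x y => ?_⟩
  rw [kernelAt_apply, enorm_mul, mul_comm]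
  refine mul_le_mul' ?_ (le_of_eq ?_)
  · have := hC ((2 : ℝ) ^ j • (y - x))
    rw [← ofReal_norm]
    exact ENNReal.ofReal_le_ofReal (by simpa using this)
  · rw [← pow_mul, ← Nat.cast_mul, ENNReal.rpow_natCast, enorm_pow]
    congr 1
    rw [← ofReal_norm]; simp

/-- The normalization of the kernel contributes `2^{jnσ}`, the change of variables on the
`m`-dimensional plane `2^{-jm}`. This dimensional mismatch is the source of the `1/p` derivatives
lost by the trace. Small `σ` is paid for by decay of order `M > m/σ`. -/
theorem lintegral_kernelAt_rpow_le {m n : ℕ} (Ψ : 𝓢(Rn n, ℂ)) (L : Rn m →ₗᵢ[ℝ] Rn n) {σ : ℝ}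
    (hσ : 0 < σ) :
    ∃ C : ℝ≥0, ∀ (j : ℕ) (y : Rn n), ∫⁻ x, ‖kernelAt Ψ j (L x) y‖ₑ ^ σ ≤
      C * (2 : ℝ≥0∞) ^ ((j : ℝ) * (n * σ - m)) := by
  obtain ⟨M, hM⟩ := exists_nat_gt ((m : ℝ) / σ)
  have hM' : (m : ℝ) < M * σ := by rwa [div_lt_iff₀ hσ] at hM
  obtain ⟨C, hC0, hC⟩ := Ψ.exists_decay M
  set g : Rn m → ℝ≥0∞ := fun x => ENNReal.ofReal ((1 + ‖x‖) ^ (-(M * σ))) with hg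
  have hgm : Measurable g := by
    refine ENNReal.measurable_ofReal.comp ?_
    exact (Measurable.pow_const (by fun_prop) _)
  have hfin : ∫⁻ x, g x < ∞ := by
    refine finite_integral_one_add_norm ?_
    rwa [finrank_euclideanSpace_fin]
  refine ⟨(ENNReal.ofReal C ^ σ * ∫⁻ x, g x).toNNReal, fun j y => ?_⟩
  obtain ⟨x₀, hx₀⟩ := L.exists_norm_sub_le y
  have key : ∀ x, ‖kernelAt Ψ j (L x) y‖ₑ ^ σ ≤
      (2 : ℝ≥0∞) ^ ((j : ℝ) * (n * σ)) * ENNReal.ofReal C ^ σ * g ((2 : ℝ) ^ j • (x - x₀)) := by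
    intro x
    have h1 : ‖Ψ ((2 : ℝ) ^ j • (y - L x))‖ₑ ≤
        ENNReal.ofReal C * ENNReal.ofReal ((1 + ‖(2 : ℝ) ^ j • (x - x₀)‖) ^ (-(M : ℝ))) := by
      rw [← ENNReal.ofReal_mul hC0, ← ofReal_norm]
      refine ENNReal.ofReal_le_ofReal ((hC _).trans ?_)
      rw [Real.rpow_neg (by positivity), Real.rpow_natCast]
      gcongr 2
      rw [norm_smul, norm_smul]
      gcongr 3
      exact hx₀ x
    rw [kernelAt_apply, enorm_mul, ENNReal.mul_rpow_of_nonneg _ _ hσ.le, mul_assoc]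
    refine mul_le_mul' (le_of_eq ?_) ?_
    · rw [← pow_mul, enorm_pow, ← mul_assoc, ENNReal.rpow_mul, ← Nat.cast_mul,
        ENNReal.rpow_natCast]
      congr 2
      rw [← ofReal_norm]; simp
    · refine (ENNReal.rpow_le_rpow h1 hσ.le).trans (le_of_eq ?_)
      rw [ENNReal.mul_rpow_of_nonneg _ _ hσ.le, hg]
      congr 1
      simp only
      rw [ENNReal.ofReal_rpow_of_nonneg (by positivity) hσ.le, ← Real.rpow_mul (by positivity)]
      congr 2; ring
  have hCfin : ENNReal.ofReal C ^ σ * ∫⁻ x, g x ≠ ∞ :=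
    ENNReal.mul_ne_top (ENNReal.rpow_ne_top_of_nonneg hσ.le ENNReal.ofReal_ne_top) hfin.ne
  rw [ENNReal.coe_toNNReal hCfin]
  refine (lintegral_mono key).trans (le_of_eq ?_)
  rw [lintegral_const_mul _ (by fun_prop), lintegral_comp_pow_smul_sub g hgm,
    mul_sub, sub_eq_add_neg, ENNReal.rpow_add _ _ (by norm_num) (by norm_num)]
  ring

attribute [irreducible] planeWave kernelAt waveTest

/-! ### Representation of frequency-localized distributions by functions -/

/-- The bound makes `A` factor through the range of `J`; Hahn–Banach extends the factor to `H` and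
Riesz represents it. -/
theorem exists_inner_repr {V H : Type*} [AddCommGroup V] [Module ℂ V] [NormedAddCommGroup H]
    [InnerProductSpace ℂ H] [CompleteSpace H] (A : V →ₗ[ℂ] ℂ) (J : V →ₗ[ℂ] H) (C : ℝ)
    (h : ∀ v, ‖A v‖ ≤ C * ‖J v‖) : ∃ m : H, ∀ v, A v = inner ℂ m (J v) := by
  have hker : LinearMap.ker J ≤ LinearMap.ker A := by
    intro v hv
    have h1 := h v
    rw [LinearMap.mem_ker] at hv ⊢
    rw [hv, norm_zero, mul_zero] at h1
    exact norm_le_zero_iff.1 h1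
  let B : LinearMap.range J →ₗ[ℂ] ℂ :=
    ((LinearMap.ker J).liftQ A hker) ∘ₗ J.quotKerEquivRange.symm.toLinearMap
  have hB : ∀ v, B ⟨J v, LinearMap.mem_range_self J v⟩ = A v := by
    intro v
    simp only [B, LinearMap.comp_apply, LinearEquiv.coe_coe]
    rw [LinearMap.quotKerEquivRange_symm_apply_image J v (LinearMap.mem_range_self J v)]
    simp
  have hbd : ∀ y : LinearMap.range J, ‖B y‖ ≤ C * ‖y‖ := by
    rintro ⟨_, v, rfl⟩
    rw [hB]
    exact h v
  obtain ⟨g, hg, -⟩ := exists_extension_norm_eq (LinearMap.range J) (B.mkContinuous C hbd)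
  refine ⟨(InnerProductSpace.toDual ℂ H).symm g, fun v => ?_⟩
  rw [InnerProductSpace.toDual_symm_apply, ← hB v]
  exact (hg ⟨J v, LinearMap.mem_range_self J v⟩).symm

/-- The rapid decay of `χ` absorbs the polynomial weights of the Schwartz seminorms, so that only
suprema of finitely many derivatives of `P` remain. -/
theorem exists_bound_smulLeft {n : ℕ} (u : 𝓢'(Rn n, ℂ)) (χ : 𝓢(Rn n, ℂ)) :
    ∃ (N : ℕ) (C : ℝ), 0 ≤ C ∧ ∀ (P : 𝓢(Rn n, ℂ)) (B : ℝ), 0 ≤ B →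
      (∀ l ≤ N, ∀ ξ, ‖iteratedFDeriv ℝ l P ξ‖ ≤ B) →
      ‖u (SchwartzMap.smulLeftCLM ℂ χ P)‖ ≤ C * B := by
  have hc : Continuous ((normSeminorm ℂ ℂ).comp (u : 𝓢(Rn n, ℂ) →ₗ[ℂ] ℂ)) :=
    continuous_norm.comp u.continuous
  obtain ⟨s, C', -, hs⟩ := Seminorm.bound_of_continuous (schwartz_withSeminorms ℂ (Rn n) ℂ) _ hc
  set D : ℝ := ∑ a ∈ s, ∑ i ∈ Finset.range (a.2 + 1),
    (a.2.choose i : ℝ) * SchwartzMap.seminorm ℂ a.1 i χ with hD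
  have hD0 : ∀ a ∈ s, 0 ≤ ∑ i ∈ Finset.range (a.2 + 1),
    (a.2.choose i : ℝ) * SchwartzMap.seminorm ℂ a.1 i χ := fun a _ => by positivity
  refine ⟨s.sup Prod.snd, C' * D, by positivity, fun P B hB hP => ?_⟩
  have h1 : ‖u (SchwartzMap.smulLeftCLM ℂ χ P)‖ ≤
      C' * (s.sup (schwartzSeminormFamily ℂ (Rn n) ℂ)) (SchwartzMap.smulLeftCLM ℂ χ P) := by
    have := hs (SchwartzMap.smulLeftCLM ℂ χ P)
    simpa [Seminorm.comp_apply, NNReal.smul_def] using this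
  refine h1.trans ?_
  rw [mul_assoc]
  refine mul_le_mul_of_nonneg_left ?_ C'.2
  refine Seminorm.finset_sup_apply_le (by positivity) fun a ha => ?_
  have h2 : (∑ i ∈ Finset.range (a.2 + 1), (a.2.choose i : ℝ) * SchwartzMap.seminorm ℂ a.1 i χ) ≤ D :=
    Finset.single_le_sum (f := fun a : ℕ × ℕ => ∑ i ∈ Finset.range (a.2 + 1),
      (a.2.choose i : ℝ) * SchwartzMap.seminorm ℂ a.1 i χ) hD0 ha
  refine le_trans ?_ (mul_le_mul_of_nonneg_right h2 hB)
  refine SchwartzMap.seminorm_le_bound ℂ _ _ _ (by positivity) fun ξ => ?_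
  have e : (⇑(SchwartzMap.smulLeftCLM ℂ χ P) : Rn n → ℂ) = fun y => χ y * P y := by
    funext y
    rw [SchwartzMap.smulLeftCLM_apply_apply χ.hasTemperateGrowth, smul_eq_mul]
  rw [e]
  have h3 := norm_iteratedFDeriv_mul_le (χ.smooth ⊤) (P.smooth ⊤) ξ (n := a.2) (by exact_mod_cast le_top)
  refine (mul_le_mul_of_nonneg_left h3 (by positivity)).trans ?_
  rw [Finset.mul_sum, Finset.sum_mul]
  refine Finset.sum_le_sum fun i hi => ?_
  have h4 : ‖iteratedFDeriv ℝ (a.2 - i) P ξ‖ ≤ B :=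
    hP _ ((Nat.sub_le _ _).trans (Finset.le_sup (f := Prod.snd) ha)) ξ
  have h5 := SchwartzMap.le_seminorm ℂ a.1 i χ ξ
  calc ‖ξ‖ ^ a.1 * ((a.2.choose i : ℝ) * ‖iteratedFDeriv ℝ i χ ξ‖ * ‖iteratedFDeriv ℝ (a.2 - i) P ξ‖)
      = (a.2.choose i : ℝ) * (‖ξ‖ ^ a.1 * ‖iteratedFDeriv ℝ i χ ξ‖) *
        ‖iteratedFDeriv ℝ (a.2 - i) P ξ‖ := by ring
    _ ≤ _ := by gcongr

/-- The weight `(1+|x|²)^K`. -/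
noncomputable def polyWeight {n : ℕ} (K : ℕ) (x : Rn n) : ℂ := (((1 + ‖x‖ ^ 2) ^ K : ℝ) : ℂ)

theorem hasTemperateGrowth_polyWeight {n : ℕ} (K : ℕ) :
    (polyWeight K : Rn n → ℂ).HasTemperateGrowth := by
  unfold polyWeight; fun_prop

theorem norm_polyWeight {n : ℕ} (K : ℕ) (x : Rn n) : ‖polyWeight K x‖ = (1 + ‖x‖ ^ 2) ^ K := by
  rw [polyWeight, Complex.norm_real, Real.norm_of_nonneg (by positivity)]

theorem memLp_inv_polyWeight (n : ℕ) :
    MemLp (fun x : Rn n => ((1 + ‖x‖ ^ 2) ^ (n + 1) : ℝ)⁻¹) 2 volume := by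
  have hc : Continuous fun x : Rn n => ((1 + ‖x‖ ^ 2) ^ (n + 1) : ℝ)⁻¹ :=
    Continuous.inv₀ (by fun_prop) fun x => by positivity
  rw [memLp_two_iff_integrable_sq hc.aestronglyMeasurable]
  have h := integrable_rpow_neg_one_add_norm_sq (E := Rn n) (μ := volume)
    (r := 4 * (n + 1)) (by rw [finrank_euclideanSpace_fin]; linarith)
  refine h.congr (Eventually.of_forall fun x => ?_)
  simp only
  rw [inv_pow, ← pow_mul, ← Real.rpow_natCast (1 + ‖x‖ ^ 2) ((n + 1) * 2),
    ← Real.rpow_neg (by positivity)]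
  congr 1; push_cast; ring

/-- Cauchy–Schwarz, at the price of `n + 1` further powers of the weight. An `L²` bound is wanted
because it allows a representation by an inner product. -/
theorem integral_weight_mul_le {n : ℕ} (N : ℕ) (Q R : 𝓢(Rn n, ℂ))
    (hR : ∀ v, R v = polyWeight (N + (n + 1)) v * Q v) :
    ∫ v, (1 + ‖v‖ ^ 2) ^ N * ‖Q v‖ ≤
      (eLpNorm (fun x : Rn n => ((1 + ‖x‖ ^ 2) ^ (n + 1) : ℝ)⁻¹) 2 volume).toReal *
      (eLpNorm R 2 volume).toReal := by
  have hc : Continuous fun x : Rn n => ((1 + ‖x‖ ^ 2) ^ (n + 1) : ℝ)⁻¹ :=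
    Continuous.inv₀ (by fun_prop) fun x => by positivity
  have h2 := memLp_inv_polyWeight n
  have hRm : MemLp R 2 volume := R.memLp 2
  have hH : eLpNorm ((fun v : Rn n => ((1 + ‖v‖ ^ 2) ^ (n + 1) : ℝ)⁻¹) • (R : Rn n → ℂ)) 1 volume ≤
      eLpNorm (fun x : Rn n => ((1 + ‖x‖ ^ 2) ^ (n + 1) : ℝ)⁻¹) 2 volume * eLpNorm R 2 volume :=
    eLpNorm_smul_le_mul_eLpNorm hRm.1 h2.1
  rw [← ENNReal.toReal_mul]
  refine le_trans (le_of_eq ?_) (ENNReal.toReal_mono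
    (ENNReal.mul_ne_top h2.2.ne hRm.2.ne) hH)
  have hcont : Continuous ((fun v : Rn n => ((1 + ‖v‖ ^ 2) ^ (n + 1) : ℝ)⁻¹) • (R : Rn n → ℂ)) :=
    hc.smul R.continuous
  rw [eLpNorm_one_eq_lintegral_enorm, ← integral_toReal hcont.enorm.aemeasurable
    (Eventually.of_forall fun v => enorm_lt_top)]
  refine integral_congr_ae (Eventually.of_forall fun v => ?_)
  have hp : (0 : ℝ) < (1 + ‖v‖ ^ 2) ^ (n + 1) := by positivity
  simp only [toReal_enorm, Pi.smul_apply']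
  rw [norm_smul, hR, norm_mul, norm_polyWeight, norm_inv, Real.norm_of_nonneg hp.le, pow_add _ N]
  field_simp

theorem norm_iteratedFDeriv_fourier_le_weight {n : ℕ} (N : ℕ) (Q : 𝓢(Rn n, ℂ)) (l : ℕ) (hl : l ≤ N)
    (ξ : Rn n) :
    ‖iteratedFDeriv ℝ l (𝓕 Q : 𝓢(Rn n, ℂ)) ξ‖ ≤
      (2 * Real.pi) ^ N * (N + 1) * ∫ v, (1 + ‖v‖ ^ 2) ^ N * ‖Q v‖ := by
  have hpi : (1 : ℝ) ≤ 2 * Real.pi := by linarith [Real.pi_gt_three]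
  have h := Real.pow_mul_norm_iteratedFDeriv_fourier_le (f := (Q : Rn n → ℂ)) (K := ⊤) (N := ⊤)
    (Q.smooth ⊤) (fun k m _ _ => Q.integrable_pow_mul_iteratedFDeriv volume k m)
    (k := l) (n := 0) le_top le_top ξ
  rw [pow_zero, one_mul, pow_zero, mul_one] at h
  rw [SchwartzMap.fourier_coe]
  refine h.trans ?_
  rw [mul_assoc]
  have hint : Integrable fun v => (1 + ‖v‖ ^ 2) ^ N * ‖Q v‖ := by
    have := (SchwartzMap.smulLeftCLM ℂ (polyWeight N) Q).integrable (μ := volume)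
    refine this.norm.congr (Eventually.of_forall fun v => ?_)
    simp only
    rw [SchwartzMap.smulLeftCLM_apply_apply (hasTemperateGrowth_polyWeight _), norm_smul,
      norm_polyWeight]
  have h0 : 0 ≤ ∫ v, (1 + ‖v‖ ^ 2) ^ N * ‖Q v‖ := integral_nonneg fun v => by positivity
  refine mul_le_mul (pow_le_pow_right₀ hpi hl) ?_ (Finset.sum_nonneg fun p _ =>
    integral_nonneg fun v => by positivity) (by positivity)
  have h3 : ∀ p ∈ Finset.range (l + 1) ×ˢ Finset.range (0 + 1),
      ∫ v, ‖v‖ ^ p.1 * ‖iteratedFDeriv ℝ p.2 Q v‖ ≤ ∫ v, (1 + ‖v‖ ^ 2) ^ N * ‖Q v‖ := by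
    rintro ⟨i, j⟩ hp
    simp only [Finset.mem_product, Finset.mem_range] at hp
    obtain rfl : j = 0 := by omega
    have hi := Q.integrable_pow_mul_iteratedFDeriv volume i 0
    refine integral_mono hi hint fun v => ?_
    simp only [norm_iteratedFDeriv_zero]
    refine mul_le_mul_of_nonneg_right ?_ (norm_nonneg _)
    have ha : ‖v‖ ≤ 1 + ‖v‖ ^ 2 := by nlinarith [sq_nonneg (‖v‖ - 1)]
    calc ‖v‖ ^ i ≤ (1 + ‖v‖ ^ 2) ^ i := pow_le_pow_left₀ (norm_nonneg _) ha _
      _ ≤ (1 + ‖v‖ ^ 2) ^ N := pow_le_pow_right₀ (by nlinarith [sq_nonneg ‖v‖]) (by omega)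
  refine (Finset.sum_le_card_nsmul _ _ _ h3).trans ?_
  rw [Finset.card_product, Finset.card_range, Finset.card_range, nsmul_eq_mul]
  refine mul_le_mul_of_nonneg_right ?_ h0
  have : (l : ℝ) ≤ N := by exact_mod_cast hl
  push_cast; linarith

/-- A cut-off of a tempered distribution is given by a function of moderate growth on the Fourier
side. -/
theorem exists_fourier_repr {n : ℕ} (u : 𝓢'(Rn n, ℂ)) (χ : 𝓢(Rn n, ℂ)) :
    ∃ (w : Rn n → ℂ) (N : ℕ), AEStronglyMeasurable w volume ∧
      Integrable (fun y => ((1 + ‖y‖) ^ N)⁻¹ * ‖w y‖) ∧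
      ∀ S : 𝓢(Rn n, ℂ), u (SchwartzMap.smulLeftCLM ℂ χ S) = ∫ y, (𝓕 S) y * w y := by
  obtain ⟨N, C, hC, hu⟩ := exists_bound_smulLeft u χ
  set K := N + (n + 1) with hK
  let A : 𝓢(Rn n, ℂ) →ₗ[ℂ] ℂ := (u : 𝓢(Rn n, ℂ) →ₗ[ℂ] ℂ) ∘ₗ
    ((SchwartzMap.smulLeftCLM ℂ χ) ∘L (SchwartzMap.fourierTransformCLM ℂ)).toLinearMap
  let J : 𝓢(Rn n, ℂ) →ₗ[ℂ] Lp ℂ 2 (volume : Measure (Rn n)) :=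
    ((SchwartzMap.toLpCLM ℂ ℂ 2 volume) ∘L
      (SchwartzMap.smulLeftCLM ℂ (polyWeight K))).toLinearMap
  have hA : ∀ Q, A Q = u (SchwartzMap.smulLeftCLM ℂ χ (𝓕 Q)) := fun Q => rfl
  have hJ : ∀ Q, J Q = (SchwartzMap.smulLeftCLM ℂ (polyWeight K) Q).toLp 2 := fun Q => rfl
  set c := (eLpNorm (fun x : Rn n => ((1 + ‖x‖ ^ 2) ^ (n + 1) : ℝ)⁻¹) 2 volume).toReal with hc
  -- The functional `Q ↦ u(χ 𝓕Q)` is bounded by derivatives of `𝓕Q`, these by moments of `Q`, and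
  -- the moments by a weighted `L²` norm.
  obtain ⟨m, hm⟩ := exists_inner_repr A J (C * ((2 * Real.pi) ^ N * (N + 1)) * c) (by
    intro Q
    rw [hA, hJ]
    refine (hu (𝓕 Q) _ ?_ (fun l hl ξ => norm_iteratedFDeriv_fourier_le_weight N Q l hl ξ)).trans ?_
    · have : 0 ≤ ∫ v, (1 + ‖v‖ ^ 2) ^ N * ‖Q v‖ := integral_nonneg fun v => by positivity
      positivity
    · have h := integral_weight_mul_le N Q (SchwartzMap.smulLeftCLM ℂ (polyWeight K) Q) fun v => by
        rw [SchwartzMap.smulLeftCLM_apply_apply (hasTemperateGrowth_polyWeight _), smul_eq_mul]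
      rw [SchwartzMap.norm_toLp, mul_assoc C, mul_assoc C, mul_assoc ((2 * Real.pi) ^ N * (N + 1))]
      refine mul_le_mul_of_nonneg_left ?_ hC
      exact mul_le_mul_of_nonneg_left h (by positivity))
  -- the representing function, reflected
  set w' : Rn n → ℂ := fun y => polyWeight K y * (starRingEnd ℂ) (m y) with hw'
  have hmm : AEStronglyMeasurable m volume := Lp.aestronglyMeasurable m
  have hw'm : AEStronglyMeasurable w' volume := by
    refine AEStronglyMeasurable.mul ?_ (Complex.continuous_conj.comp_aestronglyMeasurable hmm)
    exact (hasTemperateGrowth_polyWeight K).1.continuous.aestronglyMeasurable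
  have hrep : ∀ Q : 𝓢(Rn n, ℂ), u (SchwartzMap.smulLeftCLM ℂ χ (𝓕 Q)) = ∫ y, Q y * w' y := by
    intro Q
    rw [← hA, hm, hJ, MeasureTheory.L2.inner_def]
    refine integral_congr_ae ?_
    filter_upwards [(SchwartzMap.smulLeftCLM ℂ (polyWeight K) Q).coeFn_toLp 2] with y hy
    rw [hy, SchwartzMap.smulLeftCLM_apply_apply (hasTemperateGrowth_polyWeight _)]
    simp only [RCLike.inner_apply, smul_eq_mul, hw']
    ring
  have hmp : MeasurePreserving (fun y : Rn n => -y) volume volume := Measure.measurePreserving_neg _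
  -- The exponent `2K` compensates the weight inside `w'`; `2(n+1)` provides the square integrable
  -- factor that is paired with `m ∈ L²`.
  have hint : Integrable (fun y => ((1 + ‖y‖) ^ (2 * K + 2 * (n + 1)))⁻¹ * ‖w' y‖) := by
    have h2 := memLp_inv_polyWeight n
    have h3 : Integrable (fun y => ((1 + ‖y‖ ^ 2) ^ (n + 1) : ℝ)⁻¹ * ‖m y‖) :=
      h2.integrable_mul (Lp.memLp m).norm
    refine h3.mono' ?_ (Eventually.of_forall fun y => ?_)
    · refine AEStronglyMeasurable.mul ?_ hw'm.norm
      exact (Continuous.inv₀ (by fun_prop) fun x => by positivity).aestronglyMeasurable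
    · rw [Real.norm_of_nonneg (by positivity), hw']
      simp only [norm_mul, RCLike.norm_conj, norm_polyWeight]
      rw [← mul_assoc]
      refine mul_le_mul_of_nonneg_right ?_ (norm_nonneg _)
      have ha : (1 + ‖y‖ ^ 2) ≤ (1 + ‖y‖) ^ 2 := by nlinarith [norm_nonneg y]
      have hb : (1 + ‖y‖ ^ 2) ^ K * (1 + ‖y‖ ^ 2) ^ (n + 1) ≤ (1 + ‖y‖) ^ (2 * K + 2 * (n + 1)) := by
        rw [pow_add (1 + ‖y‖), pow_mul (1 + ‖y‖), pow_mul (1 + ‖y‖)]; gcongr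
      rw [inv_mul_le_iff₀ (by positivity), ← div_eq_mul_inv, le_div_iff₀ (by positivity)]
      exact hb
  -- The reflection enters because `S` is written as `𝓕(𝓕⁻ S)` and `𝓕⁻ S` is `𝓕 S` reflected.
  refine ⟨fun y => w' (-y), 2 * K + 2 * (n + 1), hw'm.comp_measurePreserving hmp, ?_, fun S => ?_⟩
  · have := hmp.integrable_comp_of_integrable hint
    simpa [Function.comp_def] using this
  · have h1 := hrep (𝓕⁻ S)
    rw [FourierInvPair.fourier_fourierInv_eq] at h1
    rw [h1, ← integral_neg_eq_self]
    refine integral_congr_ae (Eventually.of_forall fun y => ?_)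
    simp only
    rw [SchwartzMap.fourierInv_apply_planeWave, SchwartzMap.fourier_apply_planeWave]

/-! ### Band-limited functions -/

/-- Peetre's inequality `1+|y| ≤ (1+|x|)(1+2^j|y-x|)`. The constant depends on `j`; the bound serves
only for integrability and growth, not for the norm estimates. -/
theorem norm_kernelAt_le {n : ℕ} (Ψ : 𝓢(Rn n, ℂ)) (j N : ℕ) :
    ∃ C : ℝ, 0 ≤ C ∧ ∀ x y, ‖kernelAt Ψ j x y‖ ≤ C * (1 + ‖x‖) ^ N * ((1 + ‖y‖) ^ N)⁻¹ := by
  obtain ⟨C, hC0, hC⟩ := Ψ.exists_decay N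
  refine ⟨(2 ^ j) ^ n * C, by positivity, fun x y => ?_⟩
  rw [kernelAt_apply, norm_mul, norm_pow, norm_pow, Complex.norm_ofNat, mul_assoc, mul_assoc]
  refine mul_le_mul_of_nonneg_left ((hC _).trans ?_) (by positivity)
  refine mul_le_mul_of_nonneg_left ?_ hC0
  have h2 : (1 : ℝ) ≤ 2 ^ j := one_le_pow₀ (by norm_num)
  have h3 : ‖y - x‖ ≤ ‖(2 : ℝ) ^ j • (y - x)‖ := by
    rw [norm_smul, Real.norm_of_nonneg (by positivity)]
    exact le_mul_of_one_le_left (norm_nonneg _) h2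
  have h4 : 1 + ‖y‖ ≤ (1 + ‖x‖) * (1 + ‖(2 : ℝ) ^ j • (y - x)‖) := by
    have h5 : ‖y‖ ≤ ‖x‖ + ‖y - x‖ := norm_le_norm_add_norm_sub' y x
    nlinarith [norm_nonneg x, norm_nonneg (y - x), norm_nonneg ((2 : ℝ) ^ j • (y - x))]
  rw [inv_le_comm₀ (by positivity) (by positivity), mul_inv, inv_inv, mul_comm,
    ← div_eq_mul_inv, div_le_iff₀ (by positivity), ← mul_pow, mul_comm (1 + ‖_‖)]
  exact pow_le_pow_left₀ (by positivity) h4 N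

theorem continuous_kernelAt {n : ℕ} (Ψ : 𝓢(Rn n, ℂ)) (j : ℕ) :
    Continuous fun z : Rn n × Rn n => kernelAt Ψ j z.1 z.2 := by
  simp only [kernelAt_apply]
  have := Ψ.continuous
  fun_prop

/-- At most polynomial growth. -/
def HasPolyGrowth {n : ℕ} (h : Rn n → ℂ) : Prop :=
  ∃ (A : ℝ) (m : ℕ), ∀ x, ‖h x‖ ≤ A * (1 + ‖x‖) ^ m

theorem HasPolyGrowth.exists_nonneg {n : ℕ} {h : Rn n → ℂ} (hh : HasPolyGrowth h) :
    ∃ (A : ℝ) (m : ℕ), 0 ≤ A ∧ ∀ x, ‖h x‖ ≤ A * (1 + ‖x‖) ^ m := by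
  obtain ⟨A, m, hA⟩ := hh
  refine ⟨|A|, m, abs_nonneg A, fun x => (hA x).trans ?_⟩
  have := le_abs_self A
  gcongr

theorem SchwartzMap.integrable_one_add_norm_pow_mul {n : ℕ} (ψ : 𝓢(Rn n, ℂ)) (m : ℕ) :
    Integrable fun x => (1 + ‖x‖) ^ m * ‖ψ x‖ := by
  have h := (SchwartzMap.smulLeftCLM ℂ (polyWeight m) ψ).integrable (μ := volume)
  have h' : Integrable fun x => 2 ^ m * ‖SchwartzMap.smulLeftCLM ℂ (polyWeight m) ψ x‖ :=
    h.norm.const_mul _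
  refine h'.mono' ?_ (Eventually.of_forall fun x => ?_)
  · have := ψ.continuous
    exact Continuous.aestronglyMeasurable (by fun_prop)
  · rw [SchwartzMap.smulLeftCLM_apply_apply (hasTemperateGrowth_polyWeight _), norm_smul,
      norm_polyWeight, Real.norm_of_nonneg (by positivity), ← mul_assoc, ← mul_pow]
    gcongr
    nlinarith [sq_nonneg (‖x‖ - 1)]

theorem HasPolyGrowth.integrable_mul {n : ℕ} {h : Rn n → ℂ} (hh : HasPolyGrowth h)
    (hm : AEStronglyMeasurable h volume) (ψ : 𝓢(Rn n, ℂ)) : Integrable fun x => ψ x * h x := by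
  obtain ⟨A, m, hA0, hA⟩ := hh.exists_nonneg
  have h' : Integrable fun x => A * ((1 + ‖x‖) ^ m * ‖ψ x‖) :=
    (ψ.integrable_one_add_norm_pow_mul m).const_mul _
  refine h'.mono' (ψ.continuous.aestronglyMeasurable.mul hm) (Eventually.of_forall fun x => ?_)
  rw [norm_mul]
  calc ‖ψ x‖ * ‖h x‖ ≤ ‖ψ x‖ * (A * (1 + ‖x‖) ^ m) := by gcongr; exact hA x
    _ = _ := by ring

/-- `h` is a continuous function of at most polynomial growth whose spectrum lies in the ball of
radius `ρ`: a Schwartz function which acts on all plane waves `e^{2πi⟨ζ,·⟩}`, `|ζ| ≤ ρ`, like the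
multiple `c δ_x` of a point mass acts in the same way on `h`. -/
structure IsBandLimited {n : ℕ} (ρ : ℝ) (h : Rn n → ℂ) : Prop where
  continuous : Continuous h
  growth : HasPolyGrowth h
  eval : ∀ (ψ : 𝓢(Rn n, ℂ)) (c : ℂ) (x : Rn n),
    (∀ ζ, ‖ζ‖ ≤ ρ → ∫ y, planeWave ζ y * ψ y = c * planeWave ζ x) → ∫ y, ψ y * h y = c * h x

theorem IsBandLimited.integral_eq_zero {n : ℕ} {ρ : ℝ} {h : Rn n → ℂ} (hh : IsBandLimited ρ h)
    (ψ : 𝓢(Rn n, ℂ)) (hψ : ∀ ζ, ‖ζ‖ ≤ ρ → (𝓕⁻ ψ) ζ = 0) : ∫ y, ψ y * h y = 0 := by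
  have := hh.eval ψ 0 0 (fun ζ hζ => by
    rw [zero_mul, ← hψ ζ hζ, SchwartzMap.fourierInv_apply_planeWave]
    refine integral_congr_ae (Eventually.of_forall fun y => ?_)
    simp only [planeWave_comm])
  rwa [zero_mul] at this

theorem dyadicBlock_repr (η : DyadicBump) {n : ℕ} (k : ℕ) (f : 𝓢'(Rn n, ℂ)) :
    ∃ (w : Rn n → ℂ) (N : ℕ), AEStronglyMeasurable w volume ∧
      Integrable (fun y => ((1 + ‖y‖) ^ N)⁻¹ * ‖w y‖) ∧
      (∀ x, dyadicBlock η k f x =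
        ∫ y, kernelAt (𝓕 (baseSymbol η n k)) (k - 1) x y * w y) ∧
      ∀ S : 𝓢(Rn n, ℂ), (∀ ξ, 2 * 2 ^ k ≤ ‖ξ‖ → S ξ = 0) → (𝓕 f) S = ∫ y, (𝓕 S) y * w y := by
  -- The cut-off of level `k + 1` equals one on `|ξ| ≤ 2^{k+1}`, hence on the support of `φ_k`. One
  -- function `w` therefore serves all test functions that vanish outside this ball.
  obtain ⟨w, N, hw, hint, hrep⟩ := exists_fourier_repr (𝓕 f) (lowTest η (k + 1) 0)
  have key : ∀ S : 𝓢(Rn n, ℂ), (∀ ξ, 2 * 2 ^ k ≤ ‖ξ‖ → S ξ = 0) →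
      (𝓕 f) S = ∫ y, (𝓕 S) y * w y := by
    intro S hS
    rw [← hrep S]
    congr 1
    ext ξ
    rw [SchwartzMap.smulLeftCLM_apply_apply (SchwartzMap.hasTemperateGrowth _), smul_eq_mul]
    rcases le_total ‖ξ‖ (2 * 2 ^ k) with h | h
    · rw [lowTest_apply_of_le η (k + 1) 0 ξ (by rw [pow_succ]; linarith), planeWave_zero_right,
        one_mul]
    · rw [hS ξ h, mul_zero]
  refine ⟨w, N, hw, hint, fun x => ?_, key⟩
  rw [dyadicBlock, key _ fun ξ hξ => ?_, fourier_dyadicTest]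
  rw [dyadicTest_apply, dyadicSymbol_eq_zero η k ξ hξ, Complex.ofReal_zero, mul_zero]

theorem integrable_kernelAt_mul {n : ℕ} (Ψ : 𝓢(Rn n, ℂ)) (j : ℕ) {w : Rn n → ℂ} {N : ℕ}
    (hw : AEStronglyMeasurable w volume)
    (hint : Integrable (fun y => ((1 + ‖y‖) ^ N)⁻¹ * ‖w y‖)) {m : ℕ} (L : Rn m →ₗᵢ[ℝ] Rn n)
    (ψ : 𝓢(Rn m, ℂ)) :
    Integrable (fun z : Rn m × Rn n => ψ z.1 * (kernelAt Ψ j (L z.1) z.2 * w z.2))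
      (volume.prod volume) := by
  obtain ⟨C, hC0, hC⟩ := norm_kernelAt_le Ψ j N
  have h1 := ((ψ.integrable_one_add_norm_pow_mul N).mul_prod hint).const_mul C
  refine h1.mono' ?_ (Eventually.of_forall fun z => ?_)
  · have c1 : Continuous fun z : Rn m × Rn n => ψ z.1 := ψ.continuous.comp continuous_fst
    have c2 : Continuous fun z : Rn m × Rn n => kernelAt Ψ j (L z.1) z.2 :=
      (continuous_kernelAt Ψ j).comp ((L.continuous.comp continuous_fst).prodMk continuous_snd)
    exact c1.aestronglyMeasurable.mul (c2.aestronglyMeasurable.mul hw.comp_snd)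
  · rw [norm_mul, norm_mul]
    have := hC (L z.1) z.2
    rw [L.norm_map] at this
    calc ‖ψ z.1‖ * (‖kernelAt Ψ j (L z.1) z.2‖ * ‖w z.2‖)
        ≤ ‖ψ z.1‖ * ((C * (1 + ‖z.1‖) ^ N * ((1 + ‖z.2‖) ^ N)⁻¹) * ‖w z.2‖) := by gcongr
      _ = _ := by ring

/-- The interchange of a frequency-localized distribution with an integral over plane waves. -/
theorem integral_mul_dyadicBlock (η : DyadicBump) {m n : ℕ} (k : ℕ) (f : 𝓢'(Rn n, ℂ))
    (L : Rn m →ₗᵢ[ℝ] Rn n) (ψ : 𝓢(Rn m, ℂ)) (S : 𝓢(Rn n, ℂ))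
    (hS : ∀ ξ, S ξ = (dyadicSymbol η k ξ : ℂ) * ∫ y, planeWave ξ (L y) * ψ y) :
    ∫ y, ψ y * dyadicBlock η k f (L y) = (𝓕 f) S := by
  obtain ⟨w, N, hw, hint, hblock, hrep⟩ := dyadicBlock_repr η k f
  have hS0 : ∀ ξ, 2 * 2 ^ k ≤ ‖ξ‖ → S ξ = 0 := fun ξ hξ => by
    rw [hS, dyadicSymbol_eq_zero η k ξ hξ, Complex.ofReal_zero, zero_mul]
  rw [hrep S hS0]
  simp only [hblock, ← integral_const_mul]
  have hI := integrable_kernelAt_mul (𝓕 (baseSymbol η n k)) (k - 1) hw hint L ψ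
  rw [integral_integral_swap hI]
  refine integral_congr_ae (Eventually.of_forall fun z => ?_)
  simp only
  have e1 : ∀ y, ψ y * (kernelAt (𝓕 (baseSymbol η n k)) (k - 1) (L y) z * w z) =
      (ψ y * kernelAt (𝓕 (baseSymbol η n k)) (k - 1) (L y) z) * w z := fun y => by ring
  simp only [e1]
  rw [integral_mul_const]
  congr 1
  have hφ : Integrable fun ξ : Rn n => (dyadicSymbol η k ξ : ℂ) := by
    refine (SchwartzMap.integrable (μ := volume) (dyadicTest η k (0 : Rn n))).congr
      (Eventually.of_forall fun ξ => ?_)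
    simp only [dyadicTest_apply, planeWave_zero_right, one_mul]
  have hφψ : Integrable (fun q : Rn m × Rn n => ψ q.1 * (planeWave q.2 (-z) *
      (planeWave q.2 (L q.1) * (dyadicSymbol η k q.2 : ℂ)))) (volume.prod volume) := by
    refine (((ψ.integrable (μ := volume)).norm).mul_prod hφ.norm).mono' ?_
      (Eventually.of_forall fun q => ?_)
    · have c0 := (contDiff_dyadicSymbol η (n := n) k).continuous
      have c1 : Continuous fun q : Rn m × Rn n => planeWave q.2 (-z) :=
        continuous_snd.planeWave continuous_const
      have c2 : Continuous fun q : Rn m × Rn n => planeWave q.2 (L q.1) :=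
        continuous_snd.planeWave (L.continuous.comp continuous_fst)
      have c3 := ψ.continuous
      exact Continuous.aestronglyMeasurable (by fun_prop)
    · rw [norm_mul, norm_mul, norm_mul, norm_planeWave, norm_planeWave, one_mul, one_mul]
  -- A second use of Fubini, now with the kernel written as a Fourier integral of `φ_k`.
  calc ∫ y, ψ y * kernelAt (𝓕 (baseSymbol η n k)) (k - 1) (L y) z
      = ∫ y, ∫ ξ, ψ y * (planeWave ξ (-z) * (planeWave ξ (L y) * (dyadicSymbol η k ξ : ℂ))) := by
        refine integral_congr_ae (Eventually.of_forall fun y => ?_)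
        simp only
        simp only [← fourier_dyadicTest, SchwartzMap.fourier_apply_planeWave, integral_const_mul,
          dyadicTest_apply]
    _ = ∫ ξ, ∫ y, ψ y * (planeWave ξ (-z) * (planeWave ξ (L y) * (dyadicSymbol η k ξ : ℂ))) :=
        integral_integral_swap hφψ
    _ = (𝓕 S : 𝓢(Rn n, ℂ)) z := by
        rw [SchwartzMap.fourier_apply_planeWave]
        refine integral_congr_ae (Eventually.of_forall fun ξ => ?_)
        simp only
        rw [hS, ← integral_const_mul, ← integral_const_mul]
        refine integral_congr_ae (Eventually.of_forall fun y => ?_)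
        simp only
        ring

theorem continuous_dyadicBlock (η : DyadicBump) {n : ℕ} (k : ℕ) (f : 𝓢'(Rn n, ℂ)) :
    Continuous (dyadicBlock η k f) := by
  obtain ⟨w, N, hw, hint, hblock, -⟩ := dyadicBlock_repr η k f
  obtain ⟨C, hC0, hC⟩ := norm_kernelAt_le (𝓕 (baseSymbol η n k)) (k - 1) N
  have e : dyadicBlock η k f = fun x =>
      ∫ y, kernelAt (𝓕 (baseSymbol η n k)) (k - 1) x y * w y := funext hblock
  rw [e, continuous_iff_continuousAt]
  intro x₀
  refine continuousAt_of_dominated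
    (bound := fun y => C * (2 + ‖x₀‖) ^ N * (((1 + ‖y‖) ^ N)⁻¹ * ‖w y‖)) ?_ ?_
    (hint.const_mul _) ?_
  · exact Eventually.of_forall fun x =>
      (SchwartzMap.continuous _).aestronglyMeasurable.mul hw
  · filter_upwards [Metric.ball_mem_nhds x₀ one_pos] with x hx
    refine Eventually.of_forall fun y => ?_
    have h1 : ‖x‖ ≤ 1 + ‖x₀‖ := by
      have h2 : ‖x - x₀‖ < 1 := by rwa [← dist_eq_norm]
      have h3 := norm_le_norm_add_norm_sub' x x₀
      linarith
    rw [norm_mul]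
    calc ‖kernelAt (𝓕 (baseSymbol η n k)) (k - 1) x y‖ * ‖w y‖
        ≤ (C * (1 + ‖x‖) ^ N * ((1 + ‖y‖) ^ N)⁻¹) * ‖w y‖ := by gcongr; exact hC x y
      _ ≤ (C * (2 + ‖x₀‖) ^ N * ((1 + ‖y‖) ^ N)⁻¹) * ‖w y‖ := by
          have h4 : 1 + ‖x‖ ≤ 2 + ‖x₀‖ := by linarith
          gcongr
      _ = _ := by ring
  · refine Eventually.of_forall fun y => ?_
    have c : Continuous fun x => kernelAt (𝓕 (baseSymbol η n k)) (k - 1) x y :=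
      (continuous_kernelAt _ _).comp (continuous_id.prodMk continuous_const)
    exact (c.mul continuous_const).continuousAt

theorem hasPolyGrowth_dyadicBlock (η : DyadicBump) {n : ℕ} (k : ℕ) (f : 𝓢'(Rn n, ℂ)) :
    HasPolyGrowth (dyadicBlock η k f) := by
  obtain ⟨w, N, hw, hint, hblock, -⟩ := dyadicBlock_repr η k f
  obtain ⟨C, hC0, hC⟩ := norm_kernelAt_le (𝓕 (baseSymbol η n k)) (k - 1) N
  refine ⟨C * ∫ y, ((1 + ‖y‖) ^ N)⁻¹ * ‖w y‖, N, fun x => ?_⟩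
  have h1 : ‖dyadicBlock η k f x‖ ≤ ∫ y, C * (1 + ‖x‖) ^ N * (((1 + ‖y‖) ^ N)⁻¹ * ‖w y‖) := by
    rw [hblock]
    refine norm_integral_le_of_norm_le (hint.const_mul _) (Eventually.of_forall fun y => ?_)
    rw [norm_mul, ← mul_assoc]
    gcongr
    exact hC x y
  rw [integral_const_mul] at h1
  refine h1.trans (le_of_eq ?_)
  ring

/-- A plane wave of frequency `ξ`, restricted along `L`, is the plane wave whose frequency is the
adjoint of `L` applied to `ξ`. The adjoint has norm at most one, so the spectrum of the restriction
stays in a ball of the same radius. -/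
theorem isBandLimited_dyadicBlock_comp (η : DyadicBump) {m n : ℕ} (k : ℕ) (f : 𝓢'(Rn n, ℂ))
    (L : Rn m →ₗᵢ[ℝ] Rn n) :
    IsBandLimited (2 * 2 ^ k) fun x => dyadicBlock η k f (L x) where
  continuous := (continuous_dyadicBlock η k f).comp L.continuous
  growth := by
    obtain ⟨A, N, hA⟩ := hasPolyGrowth_dyadicBlock η k f
    exact ⟨A, N, fun x => by simpa using hA (L x)⟩
  eval := by
    intro ψ c x hψ
    have h := integral_mul_dyadicBlock η k f L ψ (c • dyadicTest η k (L x)) (by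
      intro ξ
      rw [smul_apply, dyadicTest_apply, smul_eq_mul]
      rcases le_total (2 * 2 ^ k) ‖ξ‖ with hξ | hξ
      · rw [dyadicSymbol_eq_zero η k ξ hξ]; simp
      · set A := ContinuousLinearMap.adjoint L.toContinuousLinearMap with hA
        have hin : ∀ y, planeWave (A ξ) y = planeWave ξ (L y) := by
          intro y
          rw [planeWave, planeWave, hA, ContinuousLinearMap.adjoint_inner_left]
          rfl
        have hAn : ‖A ξ‖ ≤ 2 * 2 ^ k := by
          have h1 : ‖A‖ ≤ 1 := by
            rw [hA, LinearIsometryEquiv.norm_map]; exact L.norm_toContinuousLinearMap_le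
          have := A.le_of_opNorm_le h1 ξ
          linarith
        have := hψ (A ξ) hAn
        simp only [hin] at this
        rw [this]; ring)
    rw [h, map_smul, smul_eq_mul]
    rfl

/-! ### Inequalities of Plancherel–Pólya–Nikol'skij type -/

theorem exists_modulation {n : ℕ} (κ : 𝓢(Rn n, ℂ)) (ζ : Rn n) :
    ∃ g : 𝓢(Rn n, ℂ), (∀ y, g y = planeWave ζ y * κ y) ∧
      ∀ ξ, (𝓕 g) ξ = (𝓕 κ) (ξ - ζ) := by
  refine ⟨𝓕⁻ (SchwartzMap.compSubConstCLM ℂ ζ (𝓕 κ)), fun y => ?_, fun ξ => ?_⟩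
  · rw [SchwartzMap.fourierInv_apply_planeWave, ← integral_add_right_eq_self _ ζ]
    have e : κ y = ∫ v, planeWave v y * (𝓕 κ) v := by
      rw [← SchwartzMap.fourierInv_apply_planeWave, FourierPair.fourierInv_fourier_eq]
    rw [e, ← integral_const_mul]
    refine integral_congr_ae (Eventually.of_forall fun v => ?_)
    simp only [SchwartzMap.compSubConstCLM_apply, add_sub_cancel_right, planeWave_add_left]
    ring
  · rw [FourierInvPair.fourier_fourierInv_eq, SchwartzMap.compSubConstCLM_apply]

theorem SchwartzMap.fourier_apply_eq_fourierInv_neg {n : ℕ} (κ : 𝓢(Rn n, ℂ)) (ξ : Rn n) :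
    (𝓕 κ) ξ = (𝓕⁻ κ) (-ξ) := by
  rw [SchwartzMap.fourier_apply_planeWave, SchwartzMap.fourierInv_apply_planeWave]

/-- The product `κ h` has its spectrum in the ball of radius `ρ + ρ₁`, where the low-pass symbol
equals one. By `eval` this has to be checked only with a plane wave in place of `h`, and then `κ`
times the wave is a Schwartz function with shifted Fourier transform. -/
theorem IsBandLimited.reproducing (η : DyadicBump) {n : ℕ} {ρ ρ₁ : ℝ} {h : Rn n → ℂ}
    (hh : IsBandLimited ρ h) (κ : 𝓢(Rn n, ℂ)) (hκ : ∀ ξ, ρ₁ ≤ ‖ξ‖ → (𝓕⁻ κ) ξ = 0) (K : ℕ)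
    (hK : ρ + ρ₁ ≤ 2 ^ K) (x : Rn n) :
    ∫ y, kernelAt (𝓕 (baseSymbol η n 0)) K x y * (κ y * h y) = κ x * h x := by
  have hκ' : ∀ y, SchwartzMap.smulLeftCLM ℂ κ (kernelAt (𝓕 (baseSymbol η n 0)) K x) y =
      κ y * kernelAt (𝓕 (baseSymbol η n 0)) K x y := fun y => by
    rw [SchwartzMap.smulLeftCLM_apply_apply κ.hasTemperateGrowth, smul_eq_mul]
  rw [← hh.eval (SchwartzMap.smulLeftCLM ℂ κ (kernelAt (𝓕 (baseSymbol η n 0)) K x)) (κ x) x ?_]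
  · refine integral_congr_ae (Eventually.of_forall fun y => ?_)
    simp only [hκ']; ring
  intro ζ hζ
  obtain ⟨g, hg, hgF⟩ := exists_modulation κ ζ
  have e0 : ∫ y, planeWave ζ y * SchwartzMap.smulLeftCLM ℂ κ (kernelAt (𝓕 (baseSymbol η n 0)) K x) y
      = ∫ y, (𝓕 (lowTest η K x) : 𝓢(Rn n, ℂ)) y * g y := by
    refine integral_congr_ae (Eventually.of_forall fun y => ?_)
    simp only [hκ', hg, lowTest, fourier_waveTest]; ring
  have e1 : ∫ ξ, lowTest η K x ξ * (𝓕 g) ξ = ∫ ξ, planeWave ξ x * (𝓕 g) ξ := by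
    refine integral_congr_ae (Eventually.of_forall fun ξ => ?_)
    simp only
    rcases le_total ρ₁ ‖ξ - ζ‖ with h1 | h1
    · have : (𝓕 g) ξ = 0 := by
        rw [hgF, SchwartzMap.fourier_apply_eq_fourierInv_neg, hκ _ (by rwa [norm_neg])]
      rw [this, mul_zero, mul_zero]
    · rw [lowTest_apply_of_le]
      have := norm_le_norm_add_norm_sub' ξ ζ
      linarith
  rw [e0, SchwartzMap.integral_fourier_mul_eq, e1, ← SchwartzMap.fourierInv_apply_planeWave,
    FourierPair.fourierInv_fourier_eq, hg, mul_comm]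

theorem IsBandLimited.eval_eq (η : DyadicBump) {n : ℕ} {ρ : ℝ} {h : Rn n → ℂ}
    (hh : IsBandLimited ρ h) (K : ℕ) (hK : ρ ≤ 2 ^ K) (x : Rn n) :
    ∫ y, kernelAt (𝓕 (baseSymbol η n 0)) K x y * h y = h x := by
  have := hh.eval (kernelAt (𝓕 (baseSymbol η n 0)) K x) 1 x (fun ζ hζ => by
    have e : (𝓕⁻ (kernelAt (𝓕 (baseSymbol η n 0)) K x) : 𝓢(Rn n, ℂ)) = lowTest η K x := by
      rw [← fourier_waveTest, FourierPair.fourierInv_fourier_eq, lowTest]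
    have e2 := SchwartzMap.fourierInv_apply_planeWave (kernelAt (𝓕 (baseSymbol η n 0)) K x) ζ
    rw [e, lowTest_apply_of_le η K x ζ (hζ.trans hK)] at e2
    rw [one_mul, e2]
    simp only [planeWave_comm])
  rwa [one_mul] at this

/-- Let `F = κ h`. The reproducing formula gives `sup |F| ≤ B ‖F‖₁`, and `‖F‖₁ ≤ (sup |F|)^{1-p} ∫
|F|^p`; dividing by `‖F‖₁^{1-p}` proves the claim. The factor `κ` makes `‖F‖₁` finite beforehand,
which the division requires. -/
theorem lintegral_mul_bandLimited_le (η : DyadicBump) (n : ℕ) :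
    ∃ A : ℝ≥0, ∀ {ρ ρ₁ : ℝ} {h : Rn n → ℂ}, IsBandLimited ρ h → ∀ κ : 𝓢(Rn n, ℂ),
      (∀ ξ, ρ₁ ≤ ‖ξ‖ → (𝓕⁻ κ) ξ = 0) → ∀ K : ℕ, ρ + ρ₁ ≤ 2 ^ K → ∀ p : ℝ, 0 < p → p ≤ 1 →
      ∫⁻ y, ‖κ y * h y‖ₑ ≤
        (A * (2 : ℝ≥0∞) ^ ((K : ℝ) * n)) ^ (1 / p - 1) * (∫⁻ y, ‖κ y * h y‖ₑ ^ p) ^ (1 / p) := by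
  obtain ⟨A, hA⟩ := enorm_kernelAt_le (𝓕 (baseSymbol η n 0))
  refine ⟨A, fun {ρ ρ₁ h} hh κ hκ K hK p hp0 hp1 => ?_⟩
  set B : ℝ≥0∞ := A * (2 : ℝ≥0∞) ^ ((K : ℝ) * n) with hB
  set I := ∫⁻ y, ‖κ y * h y‖ₑ with hI
  set J := ∫⁻ y, ‖κ y * h y‖ₑ ^ p with hJ
  have hmeas : AEMeasurable (fun y => ‖κ y * h y‖ₑ) volume :=
    (κ.continuous.mul hh.continuous).enorm.aemeasurable
  have hIfin : I ≠ ∞ := by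
    have := (hh.growth.integrable_mul hh.continuous.aestronglyMeasurable κ).2
    exact (hasFiniteIntegral_iff_enorm.1 this).ne
  rcases eq_or_ne I 0 with hI0 | hI0
  · rw [hI0]; exact zero_le
  have hsup : ∀ x, ‖κ x * h x‖ₑ ≤ B * I := by
    intro x
    rw [← hh.reproducing η κ hκ K hK x, hI, ← lintegral_const_mul'' _ hmeas]
    refine (enorm_integral_le_lintegral_enorm _).trans (lintegral_mono fun y => ?_)
    rw [enorm_mul]
    gcongr
    exact hA K x y
  have hI1 : I ≤ (B * I) ^ (1 - p) * J := by
    rw [hJ, ← lintegral_const_mul'' _ (hmeas.pow_const p)]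
    refine lintegral_mono fun y => ?_
    rcases eq_or_ne (‖κ y * h y‖ₑ) 0 with h0 | h0
    · rw [h0]; exact zero_le
    calc ‖κ y * h y‖ₑ = ‖κ y * h y‖ₑ ^ (1 - p) * ‖κ y * h y‖ₑ ^ p := by
          rw [← ENNReal.rpow_add _ _ h0 enorm_ne_top, sub_add_cancel, ENNReal.rpow_one]
      _ ≤ _ := mul_le_mul_left (ENNReal.rpow_le_rpow (hsup y) (by linarith)) _
  have hI2 : I ^ p ≤ B ^ (1 - p) * J := by
    have hs : I = I ^ (1 - p) * I ^ p := by
      rw [← ENNReal.rpow_add _ _ hI0 hIfin, sub_add_cancel, ENNReal.rpow_one]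
    have h1p : 0 ≤ 1 - p := by linarith
    have hpos : I ^ (1 - p) ≠ 0 := (ENNReal.rpow_pos (pos_iff_ne_zero.2 hI0) hIfin).ne'
    have hfin : I ^ (1 - p) ≠ ∞ := ENNReal.rpow_ne_top_of_nonneg h1p hIfin
    have : I ^ (1 - p) * I ^ p ≤ I ^ (1 - p) * (B ^ (1 - p) * J) := by
      rw [← hs]
      refine hI1.trans (le_of_eq ?_)
      rw [ENNReal.mul_rpow_of_nonneg _ _ h1p]; ring
    exact (ENNReal.mul_le_mul_iff_right hpos hfin).1 this
  calc I = (I ^ p) ^ (1 / p) := by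
        rw [← ENNReal.rpow_mul, mul_one_div_cancel hp0.ne', ENNReal.rpow_one]
    _ ≤ (B ^ (1 - p) * J) ^ (1 / p) := by gcongr
    _ = B ^ (1 / p - 1) * J ^ (1 / p) := by
        rw [ENNReal.mul_rpow_of_nonneg _ _ (by positivity), ← ENNReal.rpow_mul]
        congr 2; field_simp

theorem lintegral_kernelAt_eq {n : ℕ} (Ψ : 𝓢(Rn n, ℂ)) (j : ℕ) (x : Rn n) :
    ∫⁻ y, ‖kernelAt Ψ j x y‖ₑ = ∫⁻ y, ‖Ψ y‖ₑ := by
  have hΨ : Measurable fun y => ‖Ψ y‖ₑ := Ψ.continuous.enorm.measurable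
  have h := lintegral_comp_pow_smul_sub (fun y => ‖Ψ y‖ₑ) hΨ j x
  simp only [kernelAt_apply, enorm_mul]
  rw [lintegral_const_mul' _ _ enorm_ne_top, h, ← mul_assoc]
  have e : ‖((2 : ℂ) ^ j) ^ n‖ₑ = (2 : ℝ≥0∞) ^ ((j : ℝ) * n) := by
    rw [← pow_mul, ← Nat.cast_mul, ENNReal.rpow_natCast, enorm_pow]
    congr 1
    rw [← ofReal_norm]; simp
  rw [e, ← ENNReal.rpow_add _ _ (by norm_num) (by norm_num), add_neg_cancel, ENNReal.rpow_zero,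
    one_mul]

theorem SchwartzMap.lintegral_enorm_ne_top {n : ℕ} (Ψ : 𝓢(Rn n, ℂ)) : ∫⁻ y, ‖Ψ y‖ₑ ≠ ∞ :=
  (hasFiniteIntegral_iff_enorm.1 (Ψ.integrable (μ := volume)).2).ne

/-- Tonelli: integrating the pointwise bound over `x` leaves the integral of the kernel over the
plane, which is bounded uniformly in `y`. It is used with `σ = 1` if `p ≥ 1` and with `σ = p` if `p
≤ 1`. -/
theorem eLpNorm_le_of_kernel_rpow_le {m n : ℕ} (Ψ : 𝓢(Rn n, ℂ)) (L : Rn m →ₗᵢ[ℝ] Rn n) {σ : ℝ}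
    (hσ : 0 < σ) :
    ∃ C : ℝ≥0, ∀ (p : ℝ≥0∞), p ≠ 0 → p ≠ ∞ → ∀ (j : ℕ) (B : ℝ≥0∞) (h : Rn n → ℂ) (G : Rn m → ℂ),
      AEStronglyMeasurable h volume →
      (∀ x, ‖G x‖ₑ ^ p.toReal ≤
        B * ∫⁻ y, ‖kernelAt Ψ j (L x) y‖ₑ ^ σ * ‖h y‖ₑ ^ p.toReal) →
      eLpNorm G p volume ≤
        (B * (C * (2 : ℝ≥0∞) ^ ((j : ℝ) * (n * σ - m)))) ^ (1 / p.toReal) * eLpNorm h p volume := by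
  obtain ⟨C, hC⟩ := lintegral_kernelAt_rpow_le Ψ L hσ
  refine ⟨C, fun p hp0 hp j B h G hh hG => ?_⟩
  have hp' : 0 < p.toReal := ENNReal.toReal_pos hp0 hp
  rw [eLpNorm_eq_lintegral_rpow_enorm_toReal hp0 hp, eLpNorm_eq_lintegral_rpow_enorm_toReal hp0 hp,
    ← ENNReal.mul_rpow_of_nonneg _ _ (by positivity)]
  refine ENNReal.rpow_le_rpow ?_ (by positivity)
  have hc2 : Continuous fun z : Rn m × Rn n => kernelAt Ψ j (L z.1) z.2 :=
    (continuous_kernelAt Ψ j).comp ((L.continuous.comp continuous_fst).prodMk continuous_snd)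
  have hmeas : AEMeasurable (fun z : Rn m × Rn n =>
      ‖kernelAt Ψ j (L z.1) z.2‖ₑ ^ σ * ‖h z.2‖ₑ ^ p.toReal) (volume.prod volume) :=
    (hc2.enorm.aemeasurable.pow_const σ).mul (hh.comp_snd.enorm.pow_const _)
  calc ∫⁻ x, ‖G x‖ₑ ^ p.toReal
      ≤ ∫⁻ x, B * ∫⁻ y, ‖kernelAt Ψ j (L x) y‖ₑ ^ σ * ‖h y‖ₑ ^ p.toReal := lintegral_mono hG
    _ = B * ∫⁻ x, ∫⁻ y, ‖kernelAt Ψ j (L x) y‖ₑ ^ σ * ‖h y‖ₑ ^ p.toReal :=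
        lintegral_const_mul'' _ hmeas.lintegral_prod_right'
    _ = B * ∫⁻ y, ∫⁻ x, ‖kernelAt Ψ j (L x) y‖ₑ ^ σ * ‖h y‖ₑ ^ p.toReal := by
        rw [lintegral_lintegral_swap hmeas]
    _ ≤ B * ∫⁻ y, (C * (2 : ℝ≥0∞) ^ ((j : ℝ) * (n * σ - m))) * ‖h y‖ₑ ^ p.toReal := by
        gcongr with y
        have hc : Continuous fun x => kernelAt Ψ j (L x) y :=
          (continuous_kernelAt Ψ j).comp (L.continuous.prodMk continuous_const)
        rw [lintegral_mul_const'' _ (hc.enorm.aemeasurable.pow_const σ)]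
        gcongr
        exact hC j y
    _ = _ := by
        rw [lintegral_const_mul'' _ (hh.enorm.pow_const _), ← mul_assoc]

/-- The measure `|κ| dy`, `κ` the kernel, has a mass `I` independent of `j` and `x`. Hölder applied
to `|κ h| = |κ|^{1-1/p} (|κ| |h|^p)^{1/p}` gives the pointwise bound for the Tonelli argument. No
band limitation is needed in this range. -/
theorem eLpNorm_kernel_le_of_one_le {m n : ℕ} (Ψ : 𝓢(Rn n, ℂ)) (L : Rn m →ₗᵢ[ℝ] Rn n)
    (p : ℝ≥0∞) (hp : 1 ≤ p) :
    ∃ C : ℝ≥0∞, C ≠ ∞ ∧ ∀ (j : ℕ) (h : Rn n → ℂ) (G : Rn m → ℂ),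
      AEStronglyMeasurable h volume →
      (∀ x, ‖G x‖ₑ ≤ ∫⁻ y, ‖kernelAt Ψ j (L x) y * h y‖ₑ) →
      eLpNorm G p volume ≤
        C * (2 : ℝ≥0∞) ^ ((j : ℝ) * ((n - m) * p⁻¹.toReal)) * eLpNorm h p volume := by
  set I := ∫⁻ y, ‖Ψ y‖ₑ with hI
  have hIfin : I ≠ ∞ := Ψ.lintegral_enorm_ne_top
  rcases eq_or_ne p ∞ with rfl | hp'
  · refine ⟨I, hIfin, fun j h G hh hG => ?_⟩
    simp only [ENNReal.inv_top, ENNReal.toReal_zero, mul_zero, ENNReal.rpow_zero, mul_one]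
    refine (eLpNorm_exponent_top (f := G)).le.trans ?_
    refine essSup_le_of_ae_le _ (Eventually.of_forall fun x => (hG x).trans ?_)
    calc ∫⁻ y, ‖kernelAt Ψ j (L x) y * h y‖ₑ
        ≤ ∫⁻ y, ‖kernelAt Ψ j (L x) y‖ₑ * eLpNorm h ∞ volume := by
          refine lintegral_mono_ae ?_
          filter_upwards [enorm_ae_le_eLpNormEssSup h volume] with y hy
          rw [enorm_mul, eLpNorm_exponent_top]
          gcongr
      _ = I * eLpNorm h ∞ volume := by
          rw [lintegral_mul_const'' _ (SchwartzMap.continuous _).enorm.aemeasurable,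
            lintegral_kernelAt_eq]
  obtain ⟨C, hC⟩ := eLpNorm_le_of_kernel_rpow_le Ψ L one_pos
  have hp0 : p ≠ 0 := (zero_lt_one.trans_le hp).ne'
  have hr1 : 1 ≤ p.toReal := by
    rw [← ENNReal.toReal_one]; exact ENNReal.toReal_mono hp' hp
  have hr0 : 0 < p.toReal := by linarith
  refine ⟨(I ^ (p.toReal - 1) * C) ^ (1 / p.toReal), ?_, fun j h G hh hG => ?_⟩
  · exact ENNReal.rpow_ne_top_of_nonneg (by positivity) (ENNReal.mul_ne_top
      (ENNReal.rpow_ne_top_of_nonneg (by linarith) hIfin) ENNReal.coe_ne_top)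
  refine (hC p hp0 hp' j (I ^ (p.toReal - 1)) h G hh fun x => ?_).trans (le_of_eq ?_)
  · set κ : Rn n → ℝ≥0∞ := fun y => ‖kernelAt Ψ j (L x) y‖ₑ with hκ
    have hκm : AEMeasurable κ volume := (SchwartzMap.continuous _).enorm.aemeasurable
    have h1 := ENNReal.lintegral_mul_norm_pow_le (μ := volume) hκm
      (hκm.mul (hh.enorm.pow_const p.toReal)) (p := 1 - 1 / p.toReal) (q := 1 / p.toReal)
      (by rw [sub_nonneg, div_le_one hr0]; exact hr1) (by positivity) (by ring)
    have h2 : ‖G x‖ₑ ≤ I ^ (1 - 1 / p.toReal) *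
        (∫⁻ y, κ y * ‖h y‖ₑ ^ p.toReal) ^ (1 / p.toReal) := by
      refine (hG x).trans ((lintegral_mono fun y => ?_).trans (h1.trans (le_of_eq ?_)))
      · simp only [Pi.mul_apply]
        rw [enorm_mul, ENNReal.mul_rpow_of_nonneg _ _ (by positivity), ← mul_assoc,
          ← ENNReal.rpow_add_of_nonneg _ _ (by rw [sub_nonneg, div_le_one hr0]; exact hr1)
            (by positivity), ← ENNReal.rpow_mul, mul_one_div_cancel hr0.ne', sub_add_cancel,
          ENNReal.rpow_one, ENNReal.rpow_one]
      · simp only [hκ, lintegral_kernelAt_eq, Pi.mul_apply, hI]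
    calc ‖G x‖ₑ ^ p.toReal ≤ (I ^ (1 - 1 / p.toReal) *
        (∫⁻ y, κ y * ‖h y‖ₑ ^ p.toReal) ^ (1 / p.toReal)) ^ p.toReal := by gcongr
      _ = _ := by
        rw [ENNReal.mul_rpow_of_nonneg _ _ hr0.le, ← ENNReal.rpow_mul, ← ENNReal.rpow_mul,
          one_div_mul_cancel hr0.ne', ENNReal.rpow_one]
        simp only [ENNReal.rpow_one, hκ]
        congr 2; field_simp
  · rw [← mul_assoc, ENNReal.mul_rpow_of_nonneg _ _ (by positivity), ← ENNReal.rpow_mul,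
      ENNReal.toReal_inv]
    congr 3
    rw [mul_one, one_div, mul_assoc]

/-- Hölder is not available, but `κ h` is band limited, so its `L¹` norm is controlled by its `L^p`
quasi-norm at the cost of `2^{Kn(1/p-1)}`. Against the kernel factor `2^{j(np-m)/p}` this leaves the
natural power of `2^j` and a loss depending only on `K - j`. -/
theorem eLpNorm_kernel_le_of_le_one (η : DyadicBump) {m n : ℕ} (Φ : 𝓢(Rn n, ℂ))
    (hΦ : ∀ ξ, 4 ≤ ‖ξ‖ → Φ ξ = 0) (L : Rn m →ₗᵢ[ℝ] Rn n) (p : ℝ≥0∞) (hp0 : 0 < p) (hp : p ≤ 1) :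
    ∃ C : ℝ≥0∞, C ≠ ∞ ∧ ∀ (j K : ℕ), j ≤ K → ∀ (h : Rn n → ℂ) (G : Rn m → ℂ),
      IsBandLimited (2 ^ K) h →
      (∀ x, ‖G x‖ₑ ≤ ∫⁻ y, ‖kernelAt (𝓕 Φ) j (L x) y * h y‖ₑ) →
      eLpNorm G p volume ≤
        C * (2 : ℝ≥0∞) ^ ((j : ℝ) * ((n - m) * p⁻¹.toReal)) *
          (2 : ℝ≥0∞) ^ (((K : ℝ) - j) * (n * (p⁻¹.toReal - 1))) * eLpNorm h p volume := by
  have hpt : p ≠ ∞ := (hp.trans_lt ENNReal.one_lt_top).ne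
  have hr0 : 0 < p.toReal := ENNReal.toReal_pos hp0.ne' hpt
  have hr1 : p.toReal ≤ 1 := by
    rw [← ENNReal.toReal_one]; exact ENNReal.toReal_mono ENNReal.one_ne_top hp
  have hr1' : 0 ≤ 1 / p.toReal - 1 := by rw [sub_nonneg, one_le_div hr0]; exact hr1
  obtain ⟨A, hA⟩ := lintegral_mul_bandLimited_le η n
  obtain ⟨C, hC⟩ := eLpNorm_le_of_kernel_rpow_le (𝓕 Φ) L hr0
  refine ⟨(A * (2 : ℝ≥0∞) ^ ((3 : ℝ) * n)) ^ (1 / p.toReal - 1) * (C : ℝ≥0∞) ^ (1 / p.toReal), ?_,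
    fun j K hjK h G hh hG => ?_⟩
  · refine ENNReal.mul_ne_top (ENNReal.rpow_ne_top_of_nonneg hr1' (ENNReal.mul_ne_top
      ENNReal.coe_ne_top ?_)) (ENNReal.rpow_ne_top_of_nonneg (by positivity) ENNReal.coe_ne_top)
    exact ENNReal.rpow_ne_top_of_nonneg (by positivity) (by norm_num)
  set B : ℝ≥0∞ := (A * (2 : ℝ≥0∞) ^ (((K + 3 : ℕ) : ℝ) * n)) ^ (1 / p.toReal - 1) with hB
  refine (hC p hp0.ne' hpt j (B ^ p.toReal) h G hh.continuous.aestronglyMeasurable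
    fun x => ?_).trans (le_of_eq ?_)
  · have h1 := hA hh (kernelAt (𝓕 Φ) j (L x)) (ρ₁ := 4 * 2 ^ j) (fun ξ hξ => by
      rw [← fourier_waveTest, FourierPair.fourierInv_fourier_eq, waveTest_apply, hΦ, mul_zero]
      rw [norm_smul, norm_inv, Real.norm_of_nonneg (by positivity), ← div_eq_inv_mul,
        le_div_iff₀ (by positivity)]
      exact hξ) (K + 3) (by
        have : (2 : ℝ) ^ j ≤ 2 ^ K := pow_le_pow_right₀ (by norm_num) hjK
        have h0 : (0 : ℝ) < 2 ^ K := by positivity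
        rw [pow_add]; linarith) p.toReal hr0 hr1
    calc ‖G x‖ₑ ^ p.toReal ≤ (B * (∫⁻ y, ‖kernelAt (𝓕 Φ) j (L x) y * h y‖ₑ ^ p.toReal) ^
          (1 / p.toReal)) ^ p.toReal := ENNReal.rpow_le_rpow ((hG x).trans h1) hr0.le
      _ = _ := by
        rw [ENNReal.mul_rpow_of_nonneg _ _ hr0.le, ← ENNReal.rpow_mul (∫⁻ _, _ ∂_),
          one_div_mul_cancel hr0.ne', ENNReal.rpow_one]
        congr 1
        refine lintegral_congr fun y => ?_
        rw [enorm_mul, ENNReal.mul_rpow_of_nonneg _ _ hr0.le]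
  · rw [ENNReal.mul_rpow_of_nonneg _ _ (by positivity), ← ENNReal.rpow_mul B,
      mul_one_div_cancel hr0.ne', ENNReal.rpow_one, ENNReal.mul_rpow_of_nonneg _ _ (by positivity),
      hB]
    have e1 : (2 : ℝ≥0∞) ^ (((K + 3 : ℕ) : ℝ) * n) =
        (2 : ℝ≥0∞) ^ ((3 : ℝ) * n) * (2 : ℝ≥0∞) ^ ((K : ℝ) * n) := by
      rw [← ENNReal.rpow_add _ _ (by norm_num) (by norm_num)]; congr 1; push_cast; ring
    rw [e1, ← mul_assoc (A : ℝ≥0∞), ENNReal.mul_rpow_of_nonneg _ ((2 : ℝ≥0∞) ^ ((K : ℝ) * n)) hr1',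
      ← ENNReal.rpow_mul, ← ENNReal.rpow_mul, ENNReal.toReal_inv]
    have e2 : (2 : ℝ≥0∞) ^ ((K : ℝ) * n * (1 / p.toReal - 1)) *
        (2 : ℝ≥0∞) ^ ((j : ℝ) * (n * p.toReal - m) * (1 / p.toReal)) =
        (2 : ℝ≥0∞) ^ ((j : ℝ) * ((n - m) * p.toReal⁻¹)) *
        (2 : ℝ≥0∞) ^ (((K : ℝ) - j) * (n * (p.toReal⁻¹ - 1))) := by
      rw [← ENNReal.rpow_add _ _ (by norm_num) (by norm_num),
        ← ENNReal.rpow_add _ _ (by norm_num) (by norm_num)]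
      congr 1; field_simp; ring
    congr 1
    rw [mul_mul_mul_comm, e2, ← mul_assoc]

theorem two_rpow_add (a b : ℝ) : (2 : ℝ≥0∞) ^ (a + b) = 2 ^ a * 2 ^ b :=
  ENNReal.rpow_add _ _ (by norm_num) (by norm_num)

theorem two_rpow_ne_top (a : ℝ) : (2 : ℝ≥0∞) ^ a ≠ ∞ := by
  rw [Ne, ENNReal.rpow_eq_top_iff]; simp

theorem two_rpow_le {a b : ℝ} (h : a ≤ b) : (2 : ℝ≥0∞) ^ a ≤ 2 ^ b :=
  ENNReal.rpow_le_rpow_of_exponent_le (by norm_num) h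

theorem toReal_inv_min_one_sub_one_nonneg {p : ℝ≥0∞} (hp : 0 < p) :
    0 ≤ (min p 1)⁻¹.toReal - 1 := by
  have h1 : 1 ≤ (min p 1)⁻¹ := ENNReal.one_le_inv.2 (min_le_right _ _)
  have h2 : (min p 1)⁻¹ ≠ ∞ := ENNReal.inv_ne_top.2 (lt_min hp one_pos).ne'
  have := ENNReal.toReal_mono h2 h1
  rw [ENNReal.toReal_one] at this
  linarith

theorem eLpNorm_kernel_le (η : DyadicBump) {m n : ℕ} (Φ : 𝓢(Rn n, ℂ))
    (hΦ : ∀ ξ, 4 ≤ ‖ξ‖ → Φ ξ = 0) (L : Rn m →ₗᵢ[ℝ] Rn n) (p : ℝ≥0∞) (hp0 : 0 < p) :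
    ∃ C : ℝ≥0∞, C ≠ ∞ ∧ ∀ (j K : ℕ), j ≤ K → ∀ (h : Rn n → ℂ) (G : Rn m → ℂ),
      IsBandLimited (2 ^ K) h →
      (∀ x, ‖G x‖ₑ ≤ ∫⁻ y, ‖kernelAt (𝓕 Φ) j (L x) y * h y‖ₑ) →
      eLpNorm G p volume ≤
        C * (2 : ℝ≥0∞) ^ ((j : ℝ) * ((n - m) * p⁻¹.toReal)) *
          (2 : ℝ≥0∞) ^ (((K : ℝ) - j) * (n * ((min p 1)⁻¹.toReal - 1))) * eLpNorm h p volume := by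
  rcases le_total p 1 with hp | hp
  · rw [min_eq_left hp]
    exact eLpNorm_kernel_le_of_le_one η Φ hΦ L p hp0 hp
  · obtain ⟨C, hC, h⟩ := eLpNorm_kernel_le_of_one_le (𝓕 Φ) L p hp
    refine ⟨C, hC, fun j K _ f G hf hG => ?_⟩
    rw [min_eq_right hp, inv_one, ENNReal.toReal_one, sub_self, mul_zero, mul_zero,
      ENNReal.rpow_zero, mul_one]
    exact h j f G hf.continuous.aestronglyMeasurable hG

theorem baseSymbol_eq_zero (η : DyadicBump) {n : ℕ} (i : ℕ) (ξ : Rn n) (h : 4 ≤ ‖ξ‖) :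
    baseSymbol η n i ξ = 0 := by
  rw [baseSymbol_apply, dyadicSymbol_eq_zero, Complex.ofReal_zero]
  refine le_trans ?_ h
  have : (2 : ℝ) ^ (min i 1) ≤ 2 ^ 1 := pow_le_pow_right₀ (by norm_num) (min_le_right _ _)
  linarith

theorem baseSymbol_min (η : DyadicBump) (n i : ℕ) : baseSymbol η n (min i 1) = baseSymbol η n i := by
  rw [baseSymbol, baseSymbol, min_assoc, min_self]

theorem isBandLimited_dyadicBlock (η : DyadicBump) {n : ℕ} (k : ℕ) (f : 𝓢'(Rn n, ℂ)) :
    IsBandLimited (2 ^ (k + 1)) (dyadicBlock η k f) := by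
  have := isBandLimited_dyadicBlock_comp η k f (LinearIsometry.id (E := Rn n) (R := ℝ))
  rw [pow_succ, mul_comm]
  exact this

/-- The trace estimate for a single dyadic block. -/
theorem eLpNorm_dyadicBlock_comp_le (η : DyadicBump) {m n : ℕ} (L : Rn m →ₗᵢ[ℝ] Rn n)
    (p : ℝ≥0∞) (hp0 : 0 < p) :
    ∃ C : ℝ≥0∞, C ≠ ∞ ∧ ∀ (k : ℕ) (f : 𝓢'(Rn n, ℂ)),
      eLpNorm (fun x => dyadicBlock η k f (L x)) p volume ≤
        C * (2 : ℝ≥0∞) ^ ((k : ℝ) * ((n - m) * p⁻¹.toReal)) *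
          eLpNorm (dyadicBlock η k f) p volume := by
  obtain ⟨C, hC, h⟩ := eLpNorm_kernel_le η (baseSymbol η n 0) (baseSymbol_eq_zero η 0) L p hp0
  refine ⟨C * (2 : ℝ≥0∞) ^ ((n - m) * p⁻¹.toReal), ENNReal.mul_ne_top hC (two_rpow_ne_top _),
    fun k f => ?_⟩
  have hbl := isBandLimited_dyadicBlock η k f
  -- The block reproduces itself under the low-pass kernel of its own level. Taking `j = K` makes
  -- the loss in `K - j` disappear.
  refine (h (k + 1) (k + 1) le_rfl _ _ hbl fun x => ?_).trans (le_of_eq ?_)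
  · rw [← hbl.eval_eq η (k + 1) le_rfl (L x)]
    exact enorm_integral_le_lintegral_enorm _
  · rw [sub_self, zero_mul, ENNReal.rpow_zero, mul_one]
    push_cast
    rw [add_mul, one_mul, two_rpow_add]
    ring

/-- The dyadic block `Δ_i h` of a function `h`. -/
noncomputable def smoothBlock (η : DyadicBump) {n : ℕ} (i : ℕ) (h : Rn n → ℂ) (x : Rn n) : ℂ :=
  ∫ y, kernelAt (𝓕 (baseSymbol η n i)) (i - 1) x y * h y

/-- The kernel estimate without restriction to a plane, at `j = i - 1` and `K = k + 1`; the two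
shifts are absorbed by the factor `2^{2nσ}`. On `ℝⁿ⁻¹` the exponent of the loss is `s_p`. -/
theorem eLpNorm_smoothBlock_le (η : DyadicBump) {n : ℕ} (p : ℝ≥0∞) (hp0 : 0 < p) :
    ∃ C : ℝ≥0∞, C ≠ ∞ ∧ ∀ (i k : ℕ) (h : Rn n → ℂ), i ≤ k + 1 → IsBandLimited (2 * 2 ^ k) h →
      eLpNorm (smoothBlock η i h) p volume ≤
        C * (2 : ℝ≥0∞) ^ (((k : ℝ) - i) * (n * ((min p 1)⁻¹.toReal - 1))) *
          eLpNorm h p volume := by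
  have hσ := toReal_inv_min_one_sub_one_nonneg hp0
  set σ := (min p 1)⁻¹.toReal - 1 with hσd
  choose C hC h using fun i => eLpNorm_kernel_le η (baseSymbol η n i) (baseSymbol_eq_zero η i)
    (LinearIsometry.id (E := Rn n) (R := ℝ)) p hp0
  refine ⟨(C 0 + C 1) * (2 : ℝ≥0∞) ^ (2 * (n * σ)), ENNReal.mul_ne_top
    (ENNReal.add_ne_top.2 ⟨hC 0, hC 1⟩) (two_rpow_ne_top _), fun i k f hik hf => ?_⟩
  have hCi : C (min i 1) ≤ C 0 + C 1 := by
    rcases i with _ | i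
    · exact le_self_add
    · rw [show min (i + 1) 1 = 1 by omega]; exact le_add_self
  have hf' : IsBandLimited (2 ^ (k + 1)) f := by rwa [pow_succ, mul_comm]
  have h1 := h (min i 1) (i - 1) (k + 1) (by omega) f (smoothBlock η i f) hf' (fun x => by
    rw [baseSymbol_min]; exact enorm_integral_le_lintegral_enorm _)
  refine h1.trans ?_
  rw [sub_self, zero_mul, mul_zero, ENNReal.rpow_zero, mul_one, mul_assoc (C 0 + C 1),
    ← two_rpow_add]
  gcongr
  · norm_num
  rw [← add_mul]
  refine mul_le_mul_of_nonneg_right ?_ (by positivity)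
  rcases i with _ | i
  · push_cast; linarith
  · push_cast [Nat.add_sub_cancel]; linarith

theorem fourierInv_kernelAt_baseSymbol (η : DyadicBump) {n : ℕ} (i : ℕ) (x : Rn n) :
    (𝓕⁻ (kernelAt (𝓕 (baseSymbol η n i)) (i - 1) x) : 𝓢(Rn n, ℂ)) = dyadicTest η i x := by
  rw [← fourier_dyadicTest, FourierPair.fourierInv_fourier_eq]

/-- The symbol `φ_i` vanishes for `|ξ| ≤ 2^{i-1}`, a ball containing the spectrum of `h`. -/
theorem smoothBlock_eq_zero (η : DyadicBump) {n : ℕ} {i k : ℕ} {h : Rn n → ℂ} (hik : k + 2 ≤ i)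
    (hh : IsBandLimited (2 * 2 ^ k) h) : smoothBlock η i h = 0 := by
  funext x
  refine hh.integral_eq_zero _ fun ζ hζ => ?_
  rw [fourierInv_kernelAt_baseSymbol, dyadicTest_apply, dyadicSymbol_eq_zero_of_le η i (by omega),
    Complex.ofReal_zero, mul_zero]
  have : (2 : ℝ) ^ (k + 2) ≤ 2 ^ i := pow_le_pow_right₀ (by norm_num) hik
  rw [pow_add] at this
  linarith

/-- For `p < 1` the norm `‖h‖₁` may be infinite a priori, so no power of it can be divided out.
Instead `sup |h|` is estimated first, by applying the inequality for products to the reproducing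
kernel times `h`; then `|h| ≤ (sup |h|)^{1-p} |h|^p` is integrated. -/
theorem IsBandLimited.eLpNorm_max_one_le (η : DyadicBump) (n : ℕ) (p : ℝ≥0∞) (hp0 : 0 < p) :
    ∃ C : ℝ≥0∞, C ≠ ∞ ∧ ∀ (K : ℕ) (h : Rn n → ℂ), IsBandLimited (2 ^ K) h →
      eLpNorm h (max p 1) volume ≤
        C * (2 : ℝ≥0∞) ^ ((K : ℝ) * (n * ((min p 1)⁻¹.toReal - 1))) * eLpNorm h p volume := by
  rcases le_total 1 p with hp | hp
  · refine ⟨1, ENNReal.one_ne_top, fun K h _ => ?_⟩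
    rw [max_eq_left hp, min_eq_right hp]
    simp
  have hpt : p ≠ ∞ := (hp.trans_lt ENNReal.one_lt_top).ne
  have hr0 : 0 < p.toReal := ENNReal.toReal_pos hp0.ne' hpt
  have hr1 : p.toReal ≤ 1 := by
    rw [← ENNReal.toReal_one]; exact ENNReal.toReal_mono ENNReal.one_ne_top hp
  have hr1' : 0 ≤ 1 / p.toReal - 1 := by rw [sub_nonneg, one_le_div hr0]; exact hr1
  obtain ⟨A, hA⟩ := lintegral_mul_bandLimited_le η n
  obtain ⟨A', hA'⟩ := enorm_kernelAt_le (𝓕 (baseSymbol η n 0))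
  set c : ℝ≥0∞ := (A * (2 : ℝ≥0∞) ^ ((3 : ℝ) * n)) ^ (1 / p.toReal - 1) * A' with hc
  have hcfin : c ≠ ∞ := ENNReal.mul_ne_top (ENNReal.rpow_ne_top_of_nonneg hr1'
    (ENNReal.mul_ne_top ENNReal.coe_ne_top (two_rpow_ne_top _))) ENNReal.coe_ne_top
  refine ⟨c ^ (1 - p.toReal), ENNReal.rpow_ne_top_of_nonneg (by linarith) hcfin,
    fun K h hh => ?_⟩
  have hmeas : AEMeasurable (fun y => ‖h y‖ₑ) volume := hh.continuous.enorm.aemeasurable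
  have hnorm := eLpNorm_eq_lintegral_rpow_enorm_toReal (f := h) (μ := volume) hp0.ne' hpt
  have hsup : ∀ x, ‖h x‖ₑ ≤ c * (2 : ℝ≥0∞) ^ ((K : ℝ) * n * (1 / p.toReal)) * eLpNorm h p volume := by
    intro x
    have h1 := hA hh (kernelAt (𝓕 (baseSymbol η n 0)) K x) (ρ₁ := 4 * 2 ^ K) (fun ξ hξ => by
      rw [← fourier_waveTest, FourierPair.fourierInv_fourier_eq]
      refine lowTest_apply_eq_zero η K x ξ (le_trans ?_ hξ)
      have : (0 : ℝ) < 2 ^ K := by positivity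
      linarith) (K + 3) (by
        have h0 : (0 : ℝ) < 2 ^ K := by positivity
        rw [pow_add]; linarith) p.toReal hr0 hr1
    have h2 : ‖h x‖ₑ ≤ ∫⁻ y, ‖kernelAt (𝓕 (baseSymbol η n 0)) K x y * h y‖ₑ := by
      rw [← hh.eval_eq η K le_rfl x]
      exact enorm_integral_le_lintegral_enorm _
    have h3 : (∫⁻ y, ‖kernelAt (𝓕 (baseSymbol η n 0)) K x y * h y‖ₑ ^ p.toReal) ^ (1 / p.toReal) ≤
        (A' * (2 : ℝ≥0∞) ^ ((K : ℝ) * n)) * eLpNorm h p volume := by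
      rw [hnorm]
      calc (∫⁻ y, ‖kernelAt (𝓕 (baseSymbol η n 0)) K x y * h y‖ₑ ^ p.toReal) ^ (1 / p.toReal)
          ≤ (∫⁻ y, (A' * (2 : ℝ≥0∞) ^ ((K : ℝ) * n)) ^ p.toReal * ‖h y‖ₑ ^ p.toReal) ^
            (1 / p.toReal) := by
            gcongr with y
            rw [enorm_mul, ENNReal.mul_rpow_of_nonneg _ _ hr0.le]
            gcongr
            exact hA' K x y
        _ = _ := by
            rw [lintegral_const_mul'' _ (hmeas.pow_const _),
              ENNReal.mul_rpow_of_nonneg _ _ (by positivity), ← ENNReal.rpow_mul,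
              mul_one_div_cancel hr0.ne', ENNReal.rpow_one]
    refine (h2.trans (h1.trans (mul_le_mul_right h3 _))).trans (le_of_eq ?_)
    have e1 : (2 : ℝ≥0∞) ^ (((K + 3 : ℕ) : ℝ) * n) =
        (2 : ℝ≥0∞) ^ ((3 : ℝ) * n) * (2 : ℝ≥0∞) ^ ((K : ℝ) * n) := by
      rw [← two_rpow_add]; congr 1; push_cast; ring
    have e2 : (2 : ℝ≥0∞) ^ ((K : ℝ) * n * (1 / p.toReal)) =
        (2 : ℝ≥0∞) ^ ((K : ℝ) * n * (1 / p.toReal - 1)) * (2 : ℝ≥0∞) ^ ((K : ℝ) * n) := by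
      rw [← two_rpow_add]; congr 1; ring
    rw [e1, ← mul_assoc (A : ℝ≥0∞), ENNReal.mul_rpow_of_nonneg _ _ hr1', ← ENNReal.rpow_mul, e2, hc]
    ring
  set M := c * (2 : ℝ≥0∞) ^ ((K : ℝ) * n * (1 / p.toReal)) with hM
  have h1p : 0 ≤ 1 - p.toReal := by linarith
  rw [max_eq_right hp, min_eq_left hp, eLpNorm_one_eq_lintegral_enorm]
  calc ∫⁻ y, ‖h y‖ₑ ≤ ∫⁻ y, (M * eLpNorm h p volume) ^ (1 - p.toReal) * ‖h y‖ₑ ^ p.toReal := by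
        refine lintegral_mono fun y => ?_
        calc ‖h y‖ₑ = ‖h y‖ₑ ^ (1 - p.toReal) * ‖h y‖ₑ ^ p.toReal := by
              rw [← ENNReal.rpow_add_of_nonneg _ _ h1p hr0.le, sub_add_cancel, ENNReal.rpow_one]
          _ ≤ _ := mul_le_mul_left (ENNReal.rpow_le_rpow (hsup y) h1p) _
    _ = (M * eLpNorm h p volume) ^ (1 - p.toReal) * eLpNorm h p volume ^ p.toReal := by
        rw [lintegral_const_mul'' _ (hmeas.pow_const _), hnorm, ← ENNReal.rpow_mul (∫⁻ _, _ ∂_) _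
          p.toReal, one_div_mul_cancel hr0.ne', ENNReal.rpow_one]
    _ = M ^ (1 - p.toReal) * eLpNorm h p volume := by
        rw [ENNReal.mul_rpow_of_nonneg _ _ h1p, mul_assoc,
          ← ENNReal.rpow_add_of_nonneg _ _ h1p hr0.le, sub_add_cancel, ENNReal.rpow_one]
    _ = _ := by
        rw [hM, ENNReal.mul_rpow_of_nonneg _ _ h1p, ← ENNReal.rpow_mul, ENNReal.toReal_inv]
        congr 3; field_simp

/-! ### Sums of quasi-norms -/

/-- For `p ≥ 1` this is Minkowski followed by subadditivity of `t^r`; for `p ≤ 1` subadditivity of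
`t^p` under the integral followed by that of `t^{r/p}`. -/
theorem eLpNorm_add_rpow_le {n : ℕ} {p : ℝ≥0∞} {r : ℝ} (hr0 : 0 < r) (hr1 : r ≤ 1)
    (hrp : ENNReal.ofReal r ≤ p) {F G : Rn n → ℂ} (hF : AEStronglyMeasurable F volume)
    (hG : AEStronglyMeasurable G volume) :
    eLpNorm (F + G) p volume ^ r ≤ eLpNorm F p volume ^ r + eLpNorm G p volume ^ r := by
  rcases le_total 1 p with hp | hp
  · exact (ENNReal.rpow_le_rpow (eLpNorm_add_le hF hG hp) hr0.le).trans
      (ENNReal.rpow_add_le_add_rpow _ _ hr0.le hr1)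
  have hpt : p ≠ ∞ := (hp.trans_lt ENNReal.one_lt_top).ne
  have hp0 : p ≠ 0 := fun h0 => by
    rw [h0, nonpos_iff_eq_zero, ENNReal.ofReal_eq_zero] at hrp; linarith
  have hq0 : 0 < p.toReal := ENNReal.toReal_pos hp0 hpt
  have hq1 : p.toReal ≤ 1 := by
    rw [← ENNReal.toReal_one]; exact ENNReal.toReal_mono ENNReal.one_ne_top hp
  have hrq : r ≤ p.toReal := (ENNReal.ofReal_le_iff_le_toReal hpt).1 hrp
  have e : ∀ H : Rn n → ℂ, eLpNorm H p volume ^ r =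
      (∫⁻ x, ‖H x‖ₑ ^ p.toReal) ^ (r / p.toReal) := fun H => by
    rw [eLpNorm_eq_lintegral_rpow_enorm_toReal hp0 hpt, ← ENNReal.rpow_mul]
    congr 1; ring
  rw [e, e, e]
  refine le_trans (ENNReal.rpow_le_rpow ?_ (by positivity))
    (ENNReal.rpow_add_le_add_rpow _ _ (by positivity) ((div_le_one hq0).2 hrq))
  rw [← lintegral_add_left' (hF.enorm.pow_const _)]
  refine lintegral_mono fun x => ?_
  exact (ENNReal.rpow_le_rpow (enorm_add_le _ _) hq0.le).trans
    (ENNReal.rpow_add_le_add_rpow _ _ hq0.le hq1)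

theorem eLpNorm_sum_rpow_le {n : ℕ} {p : ℝ≥0∞} {r : ℝ} (hr0 : 0 < r) (hr1 : r ≤ 1)
    (hrp : ENNReal.ofReal r ≤ p) {ι : Type*} (s : Finset ι) (F : ι → Rn n → ℂ)
    (hF : ∀ i ∈ s, AEStronglyMeasurable (F i) volume) :
    eLpNorm (fun x => ∑ i ∈ s, F i x) p volume ^ r ≤ ∑ i ∈ s, eLpNorm (F i) p volume ^ r := by
  classical
  induction s using Finset.induction_on with
  | empty => simp [eLpNorm_zero', ENNReal.zero_rpow_of_pos hr0]
  | insert a s ha ih =>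
    simp only [Finset.sum_insert ha]
    have hs : ∀ i ∈ s, AEStronglyMeasurable (F i) volume :=
      fun i hi => hF i (Finset.mem_insert_of_mem hi)
    have hm : AEStronglyMeasurable (fun x => ∑ i ∈ s, F i x) volume :=
      Finset.aestronglyMeasurable_fun_sum s hs
    exact (eLpNorm_add_rpow_le hr0 hr1 hrp (hF a (Finset.mem_insert_self a s)) hm).trans
      (add_le_add_right (ih hs) _)

theorem ENNReal.tsum_rpow_le_rpow_tsum {ι : Type*} (b : ι → ℝ≥0∞) {t : ℝ} (ht : 1 ≤ t) :
    ∑' k, b k ^ t ≤ (∑' k, b k) ^ t := by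
  have h0 : 0 ≤ t - 1 := by linarith
  have e : ∀ x : ℝ≥0∞, x ^ t = x ^ (t - 1) * x := fun x => by
    conv_rhs => rw [← ENNReal.rpow_one x, ← ENNReal.rpow_mul, one_mul,
      ← ENNReal.rpow_add_of_nonneg _ _ h0 zero_le_one, sub_add_cancel]
  rw [e, ← ENNReal.tsum_mul_left]
  refine ENNReal.tsum_le_tsum fun k => ?_
  rw [e]
  exact mul_le_mul_left (ENNReal.rpow_le_rpow (ENNReal.le_tsum k) h0) _

theorem ellNorm_le_of_le {q : ℝ≥0∞} {r : ℝ} (hr0 : 0 < r) (hrq : ENNReal.ofReal r ≤ q)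
    (a : ℕ → ℝ≥0∞) : ellNorm q a ≤ (∑' k, a k ^ r) ^ (1 / r) := by
  unfold ellNorm
  split_ifs with hq
  · refine iSup_le fun k => ?_
    calc a k = (a k ^ r) ^ (1 / r) := by
          rw [← ENNReal.rpow_mul, mul_one_div_cancel hr0.ne', ENNReal.rpow_one]
      _ ≤ _ := ENNReal.rpow_le_rpow (ENNReal.le_tsum k) (by positivity)
  · have hrq' : r ≤ q.toReal := (ENNReal.ofReal_le_iff_le_toReal hq).1 hrq
    have hq0 : 0 < q.toReal := hr0.trans_le hrq'
    have h1 := ENNReal.tsum_rpow_le_rpow_tsum (fun k => a k ^ r) ((one_le_div hr0).2 hrq')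
    have e : ∀ k, (a k ^ r) ^ (q.toReal / r) = a k ^ q.toReal := fun k => by
      rw [← ENNReal.rpow_mul]; congr 1; field_simp
    simp only [e] at h1
    refine (ENNReal.rpow_le_rpow h1 (by positivity)).trans (le_of_eq ?_)
    rw [← ENNReal.rpow_mul]; congr 1; field_simp

/-! ### Convergence of series of tempered distributions -/

/-- A continuous gauge on the Schwartz space, a substitute for a continuous seminorm. -/
structure IsSchwartzGauge {n : ℕ} (q : 𝓢(Rn n, ℂ) → ℝ) : Prop where
  continuous : Continuous q
  map_zero : q 0 = 0
  nonneg : ∀ ψ, 0 ≤ q ψ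

theorem isSchwartzGauge_toLp {n : ℕ} (p : ℝ≥0∞) [Fact (1 ≤ p)] (c : ℝ) (hc : 0 ≤ c)
    (T : 𝓢(Rn n, ℂ) →L[ℂ] 𝓢(Rn n, ℂ)) :
    IsSchwartzGauge fun ψ : 𝓢(Rn n, ℂ) => c * ‖(T ψ).toLp p volume‖ where
  continuous := (SchwartzMap.continuous_toLp.comp T.continuous).norm.const_mul c
  map_zero := by
    have h0 : (0 : 𝓢(Rn n, ℂ)).toLp p volume = 0 :=
      map_zero (SchwartzMap.toLpCLM ℂ ℂ p (volume : Measure (Rn n)))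
    rw [map_zero, h0, norm_zero, mul_zero]
  nonneg _ := mul_nonneg hc (norm_nonneg _)

theorem lintegral_mul_le_eLpNorm {n : ℕ} {P : ℝ≥0∞} (hP : 1 ≤ P) (ψ : 𝓢(Rn n, ℂ))
    {h : Rn n → ℂ} (hh : AEStronglyMeasurable h volume) :
    ∫⁻ y, ‖ψ y * h y‖ₑ ≤ eLpNorm h P volume * eLpNorm ψ (1 - P⁻¹)⁻¹ volume := by
  have := ENNReal.HolderConjugate.inv_one_sub_inv' hP
  have : ENNReal.HolderTriple (1 - P⁻¹)⁻¹ P 1 := (inferInstance : ENNReal.HolderConjugate P _).symm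
  have h1 : eLpNorm ((ψ : Rn n → ℂ) • h) 1 volume ≤
      eLpNorm ψ (1 - P⁻¹)⁻¹ volume * eLpNorm h P volume :=
    eLpNorm_smul_le_mul_eLpNorm hh ψ.continuous.aestronglyMeasurable
  rw [eLpNorm_one_eq_lintegral_enorm] at h1
  rw [mul_comm]
  exact h1

theorem SchwartzMap.ofReal_norm_toLp {n : ℕ} (p : ℝ≥0∞) [Fact (1 ≤ p)] (ψ : 𝓢(Rn n, ℂ)) :
    ENNReal.ofReal ‖ψ.toLp p volume‖ = eLpNorm ψ p volume := by
  rw [SchwartzMap.norm_toLp]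
  exact ENNReal.ofReal_toReal (ψ.memLp p volume).2.ne

theorem exists_gauge_pairing {n : ℕ} (P : ℝ≥0∞) (hP : 1 ≤ P) :
    ∃ q : 𝓢(Rn n, ℂ) → ℝ, IsSchwartzGauge q ∧ ∀ (ψ : 𝓢(Rn n, ℂ)) (h : Rn n → ℂ),
      AEStronglyMeasurable h volume →
      ∫⁻ y, ‖ψ y * h y‖ₑ ≤ eLpNorm h P volume * ENNReal.ofReal (q ψ) := by
  have : Fact (1 ≤ (1 - P⁻¹)⁻¹) := by simp [fact_iff]
  refine ⟨_, isSchwartzGauge_toLp (1 - P⁻¹)⁻¹ 1 zero_le_one (ContinuousLinearMap.id ℂ _),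
    fun ψ h hh => ?_⟩
  rw [one_mul, ContinuousLinearMap.id_apply, SchwartzMap.ofReal_norm_toLp]
  exact lintegral_mul_le_eLpNorm hP ψ hh

/-- The sum is a linear functional bounded by a constant times the gauge, hence continuous at the
origin, where the gauge is zero. -/
theorem exists_tendsto_sum {n : ℕ} (q : 𝓢(Rn n, ℂ) → ℝ) (hq : IsSchwartzGauge q)
    (Λ : ℕ → 𝓢(Rn n, ℂ) →ₗ[ℂ] ℂ) (a : ℕ → ℝ≥0∞) (ha : ∑' k, a k ≠ ∞)
    (hΛ : ∀ k ψ, ‖Λ k ψ‖ₑ ≤ a k * ENNReal.ofReal (q ψ)) :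
    ∃ g : 𝓢'(Rn n, ℂ), ∀ ψ, Tendsto (fun N => ∑ k ∈ Finset.range N, Λ k ψ) atTop (𝓝 (g ψ)) := by
  have hak : ∀ k, a k ≠ ∞ := fun k => ENNReal.ne_top_of_tsum_ne_top ha k
  have has : Summable fun k => (a k).toReal := ENNReal.summable_toReal ha
  have hb : ∀ k ψ, ‖Λ k ψ‖ ≤ (a k).toReal * q ψ := fun k ψ => by
    have h1 := ENNReal.toReal_mono (ENNReal.mul_ne_top (hak k) ENNReal.ofReal_ne_top) (hΛ k ψ)
    rwa [toReal_enorm, ENNReal.toReal_mul, ENNReal.toReal_ofReal (hq.nonneg ψ)] at h1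
  have hs : ∀ ψ, Summable fun k => Λ k ψ := fun ψ =>
    Summable.of_norm_bounded (has.mul_right (q ψ)) fun k => hb k ψ
  let T : 𝓢(Rn n, ℂ) →ₗ[ℂ] ℂ :=
    { toFun := fun ψ => ∑' k, Λ k ψ
      map_add' := fun ψ φ => by simp only [map_add]; exact (hs ψ).tsum_add (hs φ)
      map_smul' := fun c ψ => by
        simp only [map_smul, RingHom.id_apply, smul_eq_mul]; exact tsum_mul_left }
  have hT : ∀ ψ, ‖T ψ‖ ≤ (∑' k, (a k).toReal) * q ψ := fun ψ => by
    rw [← tsum_mul_right]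
    exact tsum_of_norm_bounded (has.mul_right (q ψ)).hasSum fun k => hb k ψ
  have hTc : Continuous T := by
    refine continuous_of_continuousAt_zero T ?_
    rw [ContinuousAt, map_zero]
    refine squeeze_zero_norm hT ?_
    have : Tendsto (fun ψ => (∑' k, (a k).toReal) * q ψ) (𝓝 0)
        (𝓝 ((∑' k, (a k).toReal) * q 0)) := (continuous_const.mul hq.continuous).tendsto 0
    rwa [hq.map_zero, mul_zero] at this
  exact ⟨ContinuousLinearMap.toPointwiseConvergenceCLM _ _ _ _ ⟨T, hTc⟩, fun ψ =>
    (hs ψ).hasSum.tendsto_sum_nat⟩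

/-- Integration against a function of at most polynomial growth. -/
noncomputable def HasPolyGrowth.pairing {n : ℕ} {h : Rn n → ℂ} (hh : HasPolyGrowth h)
    (hm : AEStronglyMeasurable h volume) : 𝓢(Rn n, ℂ) →ₗ[ℂ] ℂ where
  toFun ψ := ∫ y, ψ y * h y
  map_add' ψ φ := by
    simp only [add_apply, add_mul]
    exact integral_add (hh.integrable_mul hm ψ) (hh.integrable_mul hm φ)
  map_smul' c ψ := by
    simp only [smul_apply, smul_eq_mul, mul_assoc, RingHom.id_apply]
    exact integral_const_mul _ _

theorem polyWeight_ne_zero {n : ℕ} (K : ℕ) (x : Rn n) : polyWeight K x ≠ 0 := by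
  rw [← norm_ne_zero_iff, norm_polyWeight]
  positivity

theorem MeasureTheory.MemLp.exists_distribution {n : ℕ} {p : ℝ≥0∞} (hp : 1 ≤ p) {h : Rn n → ℂ}
    (hh : MemLp h p volume) : ∃ g : 𝓢'(Rn n, ℂ), ∀ ψ, g ψ = ∫ y, ψ y * h y := by
  have : Fact (1 ≤ p) := ⟨hp⟩
  refine ⟨MeasureTheory.Lp.toTemperedDistribution (hh.toLp h), fun ψ => ?_⟩
  rw [MeasureTheory.Lp.toTemperedDistribution_apply]
  refine integral_congr_ae ?_
  filter_upwards [hh.coeFn_toLp] with y hy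
  rw [hy, smul_eq_mul]

/-- Divided by a polynomial weight, `h` lies in `L^∞`; the distribution so obtained is multiplied by
the weight again. -/
theorem HasPolyGrowth.exists_distribution {n : ℕ} {h : Rn n → ℂ} (hh : HasPolyGrowth h)
    (hm : AEStronglyMeasurable h volume) : ∃ g : 𝓢'(Rn n, ℂ), ∀ ψ, g ψ = ∫ y, ψ y * h y := by
  obtain ⟨A, m, hA0, hA⟩ := hh.exists_nonneg
  have hgr := hasTemperateGrowth_polyWeight (n := n) m
  have hH : MemLp (fun y => (polyWeight m y)⁻¹ * h y) ∞ volume := by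
    refine memLp_top_of_bound ((Continuous.inv₀ hgr.1.continuous
      (polyWeight_ne_zero m)).aestronglyMeasurable.mul hm) (A * 2 ^ m)
      (Eventually.of_forall fun y => ?_)
    rw [norm_mul, norm_inv, norm_polyWeight, inv_mul_le_iff₀ (by positivity)]
    refine (hA y).trans ?_
    rw [mul_left_comm, mul_comm (_ ^ m), ← mul_pow]
    gcongr
    nlinarith [sq_nonneg (‖y‖ - 1)]
  obtain ⟨g, hg⟩ := hH.exists_distribution le_top
  refine ⟨TemperedDistribution.smulLeftCLM ℂ (polyWeight m) g, fun ψ => ?_⟩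
  rw [TemperedDistribution.smulLeftCLM_apply_apply, hg]
  refine integral_congr_ae (Eventually.of_forall fun y => ?_)
  simp only
  rw [SchwartzMap.smulLeftCLM_apply_apply hgr, smul_eq_mul]
  field_simp [polyWeight_ne_zero m y]

/-! ### Besov norms of series -/

/-- The value `Δ_i g (x)` is a pairing with a Schwartz kernel, so weak convergence of the series
gives pointwise convergence of the blocks. Fatou bounds their `L^p` quasi-norms by those of the
partial sums, to which the `r`-triangle inequality applies. -/
theorem besovNorm_le_of_tendsto (η : DyadicBump) {n : ℕ} (s : ℝ) {p q : ℝ≥0∞} {r : ℝ}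
    (hr0 : 0 < r) (hr1 : r ≤ 1) (hrp : ENNReal.ofReal r ≤ p) (hrq : ENNReal.ofReal r ≤ q)
    (g : 𝓢'(Rn n, ℂ)) (G : ℕ → Rn n → ℂ)
    (hm : ∀ i k, AEStronglyMeasurable (smoothBlock η i (G k)) volume)
    (hg : ∀ ψ : 𝓢(Rn n, ℂ), Tendsto (fun N => ∑ k ∈ Finset.range N, ∫ y, ψ y * G k y) atTop
      (𝓝 (g ψ))) :
    besovNorm η s p q g ≤
      (∑' (i : ℕ) (k : ℕ), ((2 : ℝ≥0∞) ^ (s * i) * eLpNorm (smoothBlock η i (G k)) p volume) ^ r) ^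
        (1 / r) := by
  refine (ellNorm_le_of_le hr0 hrq _).trans (ENNReal.rpow_le_rpow ?_ (by positivity))
  refine ENNReal.tsum_le_tsum fun i => ?_
  simp only [ENNReal.mul_rpow_of_nonneg _ _ hr0.le]
  rw [ENNReal.tsum_mul_left]
  gcongr
  have h1 : eLpNorm (dyadicBlock η i g) p volume ≤
      liminf (fun N => eLpNorm (fun x => ∑ k ∈ Finset.range N, smoothBlock η i (G k) x) p volume)
        atTop := by
    refine Lp.eLpNorm_lim_le_liminf_eLpNorm (fun N => ?_) _ (Eventually.of_forall fun x => ?_)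
    · exact Finset.aestronglyMeasurable_fun_sum _ fun k _ => hm i k
    · rw [dyadicBlock_eq]
      exact hg _
  have h2 : ∀ N, eLpNorm (fun x => ∑ k ∈ Finset.range N, smoothBlock η i (G k) x) p volume ≤
      (∑' k, eLpNorm (smoothBlock η i (G k)) p volume ^ r) ^ (1 / r) := fun N => by
    have h3 := (eLpNorm_sum_rpow_le hr0 hr1 hrp (Finset.range N)
      (fun k => smoothBlock η i (G k)) fun k _ => hm i k).trans (ENNReal.sum_le_tsum _)
    have h4 := ENNReal.rpow_le_rpow h3 (z := 1 / r) (by positivity)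
    rwa [← ENNReal.rpow_mul, mul_one_div_cancel hr0.ne', ENNReal.rpow_one] at h4
  have h5 : eLpNorm (dyadicBlock η i g) p volume ≤
      (∑' k, eLpNorm (smoothBlock η i (G k)) p volume ^ r) ^ (1 / r) := by
    refine h1.trans (liminf_le_of_frequently_le' (Frequently.of_forall h2))
  have h6 := ENNReal.rpow_le_rpow h5 hr0.le
  rwa [← ENNReal.rpow_mul, one_div_mul_cancel hr0.ne', ENNReal.rpow_one] at h6

/-! ### The hyperplane -/

/-- The isometric embedding `x̄ ↦ (x̄, 0)`. -/
noncomputable def hyperplaneEmbedding (n : ℕ) : Rn (n - 1) →ₗᵢ[ℝ] Rn n where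
  toFun := hyperplanePoint
  map_add' x y := by
    ext i
    simp only [hyperplanePoint, PiLp.add_apply]
    split_ifs <;> simp
  map_smul' c x := by
    ext i
    simp only [hyperplanePoint, PiLp.smul_apply, RingHom.id_apply]
    split_ifs <;> simp
  norm_map' x := by
    change ‖hyperplanePoint x‖ = ‖x‖
    rcases n with _ | n
    · simp only [EuclideanSpace.norm_eq]
      congr 1
    · rw [EuclideanSpace.norm_eq, EuclideanSpace.norm_eq, Fin.sum_univ_castSucc]
      have hl : (hyperplanePoint x : Rn (n + 1)) (Fin.last n) = 0 := by
        simp [hyperplanePoint]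
      have hc : ∀ i : Fin n, (hyperplanePoint x : Rn (n + 1)) i.castSucc = x i := by
        intro i
        have : ((i.castSucc : Fin (n + 1)) : ℕ) < n + 1 - 1 := by simp
        simp only [hyperplanePoint, this, dif_pos]
        rfl
      rw [hl]
      simp only [hc, norm_zero]
      congr 1
      simp

theorem hyperplaneEmbedding_apply {n : ℕ} (x : Rn (n - 1)) :
    hyperplaneEmbedding n x = hyperplanePoint x := rfl

/-! ### Traces of series -/

theorem continuous_smoothBlock (η : DyadicBump) {n : ℕ} (i : ℕ) {h : Rn n → ℂ}
    (hh : HasPolyGrowth h) (hm : AEStronglyMeasurable h volume) :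
    Continuous (smoothBlock η i h) := by
  obtain ⟨g, hg⟩ := hh.exists_distribution hm
  have : smoothBlock η i h = dyadicBlock η i g := by
    funext x
    rw [dyadicBlock_eq, hg, smoothBlock]
  rw [this]
  exact continuous_dyadicBlock η i g

theorem isBandLimited_trace (η : DyadicBump) {n : ℕ} (k : ℕ) (f : 𝓢'(Rn n, ℂ)) :
    IsBandLimited (2 * 2 ^ k) fun x : Rn (n - 1) => dyadicBlock η k f (hyperplanePoint x) :=
  isBandLimited_dyadicBlock_comp η k f (hyperplaneEmbedding n)

theorem IsBandLimited.aestronglyMeasurable {n : ℕ} {ρ : ℝ} {h : Rn n → ℂ}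
    (hh : IsBandLimited ρ h) : AEStronglyMeasurable h volume :=
  hh.continuous.aestronglyMeasurable

/-- If the series of the traces of the dyadic blocks is dominated by a convergent series, the trace
exists and its Besov norm is estimated block by block. -/
theorem exists_hasTrace (η : DyadicBump) {n : ℕ} (f : 𝓢'(Rn n, ℂ))
    (γ : 𝓢(Rn (n - 1), ℂ) → ℝ) (hγ : IsSchwartzGauge γ) (a : ℕ → ℝ≥0∞) (ha : ∑' k, a k ≠ ∞)
    (hb : ∀ k (ψ : 𝓢(Rn (n - 1), ℂ)),
      ‖∫ x, ψ x * dyadicBlock η k f (hyperplanePoint x)‖ₑ ≤ a k * ENNReal.ofReal (γ ψ)) :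
    ∃ g, HasTrace η f g ∧ ∀ (s : ℝ) {p q : ℝ≥0∞} {r : ℝ}, 0 < r → r ≤ 1 →
      ENNReal.ofReal r ≤ p → ENNReal.ofReal r ≤ q → besovNorm η s p q g ≤
      (∑' (k : ℕ) (i : ℕ), ((2 : ℝ≥0∞) ^ (s * i) * eLpNorm (smoothBlock η i
        fun x : Rn (n - 1) => dyadicBlock η k f (hyperplanePoint x)) p volume) ^ r) ^ (1 / r) := by
  have hB := fun k => isBandLimited_trace η k f
  obtain ⟨g, hg⟩ := exists_tendsto_sum γ hγ
    (fun k => (hB k).growth.pairing (hB k).aestronglyMeasurable) a ha hb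
  refine ⟨g, hg, fun s p q r hr0 hr1 hrp hrq => ?_⟩
  rw [ENNReal.tsum_comm]
  exact besovNorm_le_of_tendsto η s hr0 hr1 hrp hrq g _ (fun i k => (continuous_smoothBlock η i
    (hB k).growth (hB k).aestronglyMeasurable).aestronglyMeasurable) hg

theorem ENNReal.tsum_le_tsum_rpow {ι : Type*} (a : ι → ℝ≥0∞) {r : ℝ} (hr0 : 0 < r) (hr1 : r ≤ 1) :
    ∑' k, a k ≤ (∑' k, a k ^ r) ^ (1 / r) := by
  refine le_trans (le_of_eq ?_)
    (ENNReal.tsum_rpow_le_rpow_tsum (fun k => a k ^ r) ((one_le_div hr0).2 hr1))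
  refine tsum_congr fun k => ?_
  rw [← ENNReal.rpow_mul, mul_one_div_cancel hr0.ne', ENNReal.rpow_one]

theorem traceIndex_eq {n : ℕ} (hn : 2 ≤ n) (p : ℝ≥0∞) :
    traceIndex n p = ((n - 1 : ℕ) : ℝ) * ((min p 1)⁻¹.toReal - 1) := by
  rw [traceIndex, Nat.cast_sub (by omega), Nat.cast_one]

/-- Both isotropic assertions are instances. The weight `W k` has to pay for the frequencies `i ≤ k
+ 1` present in the trace of the `k`-th block, and `hs` states that it does. -/
theorem traceMaps_weighted (η : DyadicBump) {n : ℕ} (hn : 2 ≤ n) {p q : ℝ≥0∞} (hp : 0 < p)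
    {r : ℝ} (hr0 : 0 < r) (hr1 : r ≤ 1) (hrp : ENNReal.ofReal r ≤ p)
    (hrq : ENNReal.ofReal r ≤ q) (s : ℝ) (W : ℕ → ℝ≥0∞) (W₀ : ℝ≥0∞) (hW₀ : W₀ ≠ ∞)
    (hW : ∀ k, 1 ≤ W k)
    (hs : ∀ k, ∑ i ∈ Finset.range (k + 2), (2 : ℝ≥0∞) ^ ((s - traceIndex n p) * i * r) ≤
      W₀ * W k) :
    TraceMaps η (n := n)
      (fun f => (∑' k : ℕ, W k * ((2 : ℝ≥0∞) ^ ((traceIndex n p + p⁻¹.toReal) * k) *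
        eLpNorm (dyadicBlock η k f) p volume) ^ r) ^ (1 / r))
      (besovNorm η s p q) := by
  obtain ⟨C₁, hC₁, h₁⟩ := eLpNorm_dyadicBlock_comp_le η (hyperplaneEmbedding n) p hp
  obtain ⟨C₂, hC₂, h₂⟩ := eLpNorm_smoothBlock_le η (n := n - 1) p hp
  obtain ⟨C₃, hC₃, h₃⟩ := IsBandLimited.eLpNorm_max_one_le η (n - 1) p hp
  obtain ⟨γ, hγ, h₄⟩ := exists_gauge_pairing (n := n - 1) (max p 1) (le_max_right _ _)
  have hcast : (n : ℝ) - ((n - 1 : ℕ) : ℝ) = 1 := by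
    rw [Nat.cast_sub (by omega), Nat.cast_one]; ring
  set σ := traceIndex n p with hσ
  rw [← traceIndex_eq hn p, ← hσ] at h₂ h₃
  have hC : C₂ * C₁ * W₀ ^ (1 / r) ≠ ∞ := ENNReal.mul_ne_top (ENNReal.mul_ne_top hC₂ hC₁)
    (ENNReal.rpow_ne_top_of_nonneg (by positivity) hW₀)
  refine ⟨(C₂ * C₁ * W₀ ^ (1 / r)).toNNReal, fun f hf => ?_⟩
  rw [ENNReal.coe_toNNReal hC]
  set a : ℕ → ℝ≥0∞ := fun k => (2 : ℝ≥0∞) ^ ((σ + p⁻¹.toReal) * k) *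
    eLpNorm (dyadicBlock η k f) p volume with ha
  have hB := fun k => isBandLimited_trace η k f
  set G : ℕ → Rn (n - 1) → ℂ := fun k x => dyadicBlock η k f (hyperplanePoint x) with hG
  have hGa : ∀ k : ℕ, (2 : ℝ≥0∞) ^ (σ * k) * eLpNorm (G k) p volume ≤ C₁ * a k := fun k => by
    have := h₁ k f
    rw [hcast, one_mul] at this
    calc (2 : ℝ≥0∞) ^ (σ * k) * eLpNorm (G k) p volume
        ≤ 2 ^ (σ * k) * (C₁ * 2 ^ (k * p⁻¹.toReal) * eLpNorm (dyadicBlock η k f) p volume) := by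
          gcongr; exact this
      _ = C₁ * a k := by
          rw [ha]
          simp only
          rw [show (σ + p⁻¹.toReal) * (k : ℝ) = σ * k + k * p⁻¹.toReal by ring, two_rpow_add]
          ring
  have hsum : ∑' k, a k ≠ ∞ := by
    refine ne_top_of_le_ne_top hf.ne ((ENNReal.tsum_le_tsum_rpow a hr0 hr1).trans ?_)
    refine ENNReal.rpow_le_rpow (ENNReal.tsum_le_tsum fun k => ?_) (by positivity)
    exact le_mul_of_one_le_left zero_le (hW k)
  -- Test functions are paired with `h_k` in `L^{max(p,1)}`. The passage from `L^p` costs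
  -- `2^{(k+1)σ}`, which up to the constant `2^σ` is the weight contained in `a k`.
  obtain ⟨g, hg, hgn⟩ := exists_hasTrace η f γ hγ (fun k => C₃ * 2 ^ σ * C₁ * a k)
    (by
      rw [ENNReal.tsum_mul_left]
      exact ENNReal.mul_ne_top (ENNReal.mul_ne_top (ENNReal.mul_ne_top hC₃ (two_rpow_ne_top _)) hC₁)
        hsum)
    (fun k ψ => by
      refine (enorm_integral_le_lintegral_enorm _).trans
        ((h₄ ψ (G k) (hB k).aestronglyMeasurable).trans ?_)
      gcongr
      refine (h₃ (k + 1) (G k) (by rw [pow_succ, mul_comm]; exact hB k)).trans ?_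
      calc C₃ * (2 : ℝ≥0∞) ^ (((k + 1 : ℕ) : ℝ) * σ) * eLpNorm (G k) p volume
          = C₃ * 2 ^ σ * (2 ^ (σ * k) * eLpNorm (G k) p volume) := by
            rw [show ((k + 1 : ℕ) : ℝ) * σ = σ + σ * k by push_cast; ring, two_rpow_add]; ring
        _ ≤ C₃ * 2 ^ σ * (C₁ * a k) := mul_le_mul' le_rfl (hGa k)
        _ = C₃ * 2 ^ σ * C₁ * a k := by ring)
  refine ⟨g, hg, (hgn s hr0 hr1 hrp hrq).trans ?_⟩
  have hk : ∀ k, ∑' i : ℕ, ((2 : ℝ≥0∞) ^ (s * i) * eLpNorm (smoothBlock η i (G k)) p volume) ^ r ≤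
      (C₂ * C₁) ^ r * W₀ * (W k * a k ^ r) := fun k => by
    -- The spectrum of `h_k` leaves only the frequencies `i ≤ k + 1`.
    rw [tsum_eq_sum (s := Finset.range (k + 2)) (fun i hi => by
      rw [smoothBlock_eq_zero η (by simpa using hi) (hB k), eLpNorm_zero, mul_zero,
        ENNReal.zero_rpow_of_pos hr0])]
    have hi : ∀ i ∈ Finset.range (k + 2),
        ((2 : ℝ≥0∞) ^ (s * i) * eLpNorm (smoothBlock η i (G k)) p volume) ^ r ≤
        (C₂ * C₁) ^ r * a k ^ r * 2 ^ ((s - σ) * i * r) := fun i hi => by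
      have h5 := h₂ i k (G k) (by have := Finset.mem_range.1 hi; omega) (hB k)
      have h6 : (2 : ℝ≥0∞) ^ (s * i) * eLpNorm (smoothBlock η i (G k)) p volume ≤
          C₂ * C₁ * a k * 2 ^ ((s - σ) * i) := by
        calc (2 : ℝ≥0∞) ^ (s * i) * eLpNorm (smoothBlock η i (G k)) p volume
            ≤ 2 ^ (s * i) * (C₂ * 2 ^ (((k : ℝ) - i) * σ) * eLpNorm (G k) p volume) := by gcongr
          _ = C₂ * 2 ^ ((s - σ) * i) * (2 ^ (σ * k) * eLpNorm (G k) p volume) := by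
              have : (2 : ℝ≥0∞) ^ (s * i) * 2 ^ (((k : ℝ) - i) * σ) =
                  2 ^ ((s - σ) * i) * 2 ^ (σ * k) := by
                rw [← two_rpow_add, ← two_rpow_add]; congr 1; ring
              calc _ = C₂ * (2 ^ (s * i) * 2 ^ (((k : ℝ) - i) * σ)) * eLpNorm (G k) p volume := by
                    ring
                _ = _ := by rw [this]; ring
          _ ≤ C₂ * 2 ^ ((s - σ) * i) * (C₁ * a k) := mul_le_mul' le_rfl (hGa k)
          _ = _ := by ring
      refine (ENNReal.rpow_le_rpow h6 hr0.le).trans (le_of_eq ?_)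
      rw [ENNReal.mul_rpow_of_nonneg _ _ hr0.le, ENNReal.mul_rpow_of_nonneg _ _ hr0.le,
        ← ENNReal.rpow_mul]
    refine (Finset.sum_le_sum hi).trans ?_
    rw [← Finset.mul_sum]
    calc _ ≤ (C₂ * C₁) ^ r * a k ^ r * (W₀ * W k) := by gcongr; exact hs k
      _ = _ := by ring
  refine (ENNReal.rpow_le_rpow (ENNReal.tsum_le_tsum hk) (by positivity)).trans (le_of_eq ?_)
  rw [ENNReal.tsum_mul_left, ENNReal.mul_rpow_of_nonneg _ _ (by positivity),
    ENNReal.mul_rpow_of_nonneg _ _ (by positivity), ← ENNReal.rpow_mul,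
    mul_one_div_cancel hr0.ne', ENNReal.rpow_one]

theorem sum_geometric_rpow_le {c : ℝ} (hc : c < 0) :
    ∃ W₀ : ℝ≥0∞, W₀ ≠ ∞ ∧ ∀ s : Finset ℕ, ∑ i ∈ s, (2 : ℝ≥0∞) ^ (c * i) ≤ W₀ := by
  refine ⟨(1 - (2 : ℝ≥0∞) ^ c)⁻¹, ?_, fun s => ?_⟩
  · rw [ENNReal.inv_ne_top, Ne, tsub_eq_zero_iff_le, not_le]
    exact ENNReal.rpow_lt_one_of_one_lt_of_neg (by norm_num) hc
  · rw [← ENNReal.tsum_geometric]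
    refine le_trans (le_of_eq (Finset.sum_congr rfl fun i _ => ?_)) (ENNReal.sum_le_tsum s)
    rw [ENNReal.rpow_mul, ENNReal.rpow_natCast]

/-! ### The two isotropic trace theorems -/

theorem traceMaps_logBesovNorm (η : DyadicBump) {n : ℕ} (hn : 2 ≤ n) {p q : ℝ≥0∞} (hp : 0 < p)
    (hq : 0 < q) :
    TraceMaps η (n := n)
      (logBesovNorm η (traceIndex n p + p⁻¹.toReal) p (min p (min q 1)).toReal)
      (besovNorm η (traceIndex n p) p q) := by
  have hm0 : 0 < min p (min q 1) := lt_min hp (lt_min hq one_pos)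
  have hm1 : min p (min q 1) ≤ 1 := (min_le_right _ _).trans (min_le_right _ _)
  have hmt : min p (min q 1) ≠ ∞ := ne_top_of_le_ne_top ENNReal.one_ne_top hm1
  have hr : ENNReal.ofReal (min p (min q 1)).toReal = min p (min q 1) := ENNReal.ofReal_toReal hmt
  -- At the critical smoothness the `k + 2` frequencies contribute equally; `k + 2 ≤ 3 max(k,1)`
  -- gives the constant `3`.
  refine traceMaps_weighted η hn hp (ENNReal.toReal_pos hm0.ne' hmt) ?_ ?_ ?_ _
    (fun k => ((max k 1 : ℕ) : ℝ≥0∞)) 3 (by norm_num) (fun k => ?_) fun k => ?_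
  · simpa using ENNReal.toReal_mono ENNReal.one_ne_top hm1
  · rw [hr]; exact min_le_left _ _
  · rw [hr]; exact (min_le_right _ _).trans (min_le_left _ _)
  · exact_mod_cast le_max_right k 1
  · simp only [sub_self, zero_mul, ENNReal.rpow_zero, Finset.sum_const, Finset.card_range,
      nsmul_eq_mul, mul_one]
    have : k + 2 ≤ 3 * max k 1 := by omega
    exact_mod_cast this

theorem traceMaps_besovNorm (η : DyadicBump) {n : ℕ} (hn : 2 ≤ n) {p q : ℝ≥0∞} (hp : 0 < p)
    (hq : 0 < q) {s : ℝ} (hs : s < traceIndex n p) :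
    TraceMaps η (n := n)
      (besovNorm η (traceIndex n p + p⁻¹.toReal) p (min p (min q 1)))
      (besovNorm η s p q) := by
  have hm0 : 0 < min p (min q 1) := lt_min hp (lt_min hq one_pos)
  have hm1 : min p (min q 1) ≤ 1 := (min_le_right _ _).trans (min_le_right _ _)
  have hmt : min p (min q 1) ≠ ∞ := ne_top_of_le_ne_top ENNReal.one_ne_top hm1
  have hr : ENNReal.ofReal (min p (min q 1)).toReal = min p (min q 1) := ENNReal.ofReal_toReal hmt
  have hr0 := ENNReal.toReal_pos hm0.ne' hmt
  obtain ⟨W₀, hW₀, hW⟩ := sum_geometric_rpow_le (mul_neg_of_neg_of_pos (sub_neg.2 hs) hr0)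
  -- Below the critical smoothness the sum over the frequencies is geometric and needs no weight.
  have := traceMaps_weighted η hn hp hr0 (q := q) ?_ ?_ ?_ s
    (fun _ => 1) W₀ hW₀ (fun _ => le_rfl) fun k => ?_
  · simp only [one_mul] at this
    unfold besovNorm at this ⊢
    rw [show (ellNorm (min p (min q 1))) = fun a => (∑' k, a k ^ (min p (min q 1)).toReal) ^
      (1 / (min p (min q 1)).toReal) from funext fun a => by rw [ellNorm, if_neg hmt]]
    exact this
  · simpa using ENNReal.toReal_mono ENNReal.one_ne_top hm1
  · rw [hr]; exact min_le_left _ _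
  · rw [hr]; exact (min_le_right _ _).trans (min_le_left _ _)
  · rw [mul_one]
    refine le_trans (le_of_eq (Finset.sum_congr rfl fun i _ => ?_)) (hW (Finset.range (k + 2)))
    congr 1
    ring

/-! ### The trace of a continuous function -/

theorem integral_kernelAt_mul {n : ℕ} (Ψ : 𝓢(Rn n, ℂ)) (k : ℕ) (x : Rn n) (F : Rn n → ℂ) :
    ∫ y, kernelAt Ψ k x y * F y = ∫ z, Ψ z * F (x + ((2 : ℝ) ^ k)⁻¹ • z) := by
  have h2 : (2 : ℝ) ^ k ≠ 0 := by positivity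
  have h := Measure.integral_comp_smul volume
    (fun z => Ψ z * F (x + ((2 : ℝ) ^ k)⁻¹ • z)) ((2 : ℝ) ^ k)
  rw [← integral_add_right_eq_self _ x]
  have e : ∀ y, kernelAt Ψ k x (y + x) * F (y + x) = ((2 : ℂ) ^ k) ^ n *
      (Ψ ((2 : ℝ) ^ k • y) * F (x + ((2 : ℝ) ^ k)⁻¹ • ((2 : ℝ) ^ k • y))) := fun y => by
    rw [kernelAt_apply, add_sub_cancel_right, smul_smul, inv_mul_cancel₀ h2, one_smul, add_comm x,
      mul_assoc]
  simp only [e]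
  rw [integral_const_mul, h, finrank_euclideanSpace_fin, abs_of_pos (by positivity),
    Complex.real_smul, ← mul_assoc]
  push_cast
  rw [mul_inv_cancel₀ (pow_ne_zero _ (pow_ne_zero _ two_ne_zero)), one_mul]

theorem integral_fourier_baseSymbol (η : DyadicBump) (n : ℕ) :
    ∫ z, (𝓕 (baseSymbol η n 0)) z = 1 := by
  have h := SchwartzMap.fourierInv_apply_planeWave (𝓕 (baseSymbol η n 0)) 0
  rw [FourierPair.fourierInv_fourier_eq, baseSymbol_apply] at h
  have e : ∀ ξ : Rn n, planeWave ξ 0 = 1 := planeWave_zero_right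
  simp only [e, one_mul] at h
  rw [← h]
  simp [dyadicSymbol, η.eq_one]

theorem sum_dyadicBlock (η : DyadicBump) {n : ℕ} (f : 𝓢'(Rn n, ℂ)) (N : ℕ) (x : Rn n) :
    ∑ k ∈ Finset.range (N + 1), dyadicBlock η k f x = f (kernelAt (𝓕 (baseSymbol η n 0)) N x) := by
  simp only [dyadicBlock]
  rw [← map_sum, ← lowTest_eq_sum, TemperedDistribution.fourier_apply, lowTest, fourier_waveTest]

/-- The partial sums of the blocks telescope to convolutions with an approximate identity of
integral `η(0) = 1`. They converge to `F` pointwise, in particular on the hyperplane, with a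
polynomial bound independent of their number; dominated convergence then applies to the pairing with
`ψ`. -/
theorem exists_hasTrace_of_continuous (η : DyadicBump) {n : ℕ} (f : 𝓢'(Rn n, ℂ)) (F : Rn n → ℂ)
    (hF : Continuous F) (hgr : HasPolyGrowth F) (hf : ∀ ψ : 𝓢(Rn n, ℂ), f ψ = ∫ x, ψ x * F x) :
    ∃ g : 𝓢'(Rn (n - 1), ℂ), HasTrace η f g ∧
      ∀ ψ : 𝓢(Rn (n - 1), ℂ), g ψ = ∫ x, ψ x * F (hyperplanePoint x) := by
  obtain ⟨A, m, hA0, hA⟩ := hgr.exists_nonneg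
  have hL : ∀ x : Rn (n - 1), ‖(hyperplanePoint x : Rn n)‖ = ‖x‖ :=
    (hyperplaneEmbedding n).norm_map
  have hLc : Continuous (hyperplanePoint : Rn (n - 1) → Rn n) := (hyperplaneEmbedding n).continuous
  set Ψ : 𝓢(Rn n, ℂ) := 𝓕 (baseSymbol η n 0) with hΨ
  have hblock : ∀ N x, ∑ k ∈ Finset.range (N + 1), dyadicBlock η k f x =
      ∫ z, Ψ z * F (x + ((2 : ℝ) ^ N)⁻¹ • z) := fun N x => by
    rw [sum_dyadicBlock, hf, integral_kernelAt_mul]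
  have hint := Ψ.integrable_one_add_norm_pow_mul m
  have hpt : ∀ (N : ℕ) (x z : Rn n), ‖Ψ z * F (x + ((2 : ℝ) ^ N)⁻¹ • z)‖ ≤
      A * (1 + ‖x‖) ^ m * ((1 + ‖z‖) ^ m * ‖Ψ z‖) := fun N x z => by
    have h1 : ‖x + ((2 : ℝ) ^ N)⁻¹ • z‖ ≤ ‖x‖ + ‖z‖ := by
      refine (norm_add_le _ _).trans ?_
      rw [norm_smul, Real.norm_of_nonneg (by positivity)]
      have : ((2 : ℝ) ^ N)⁻¹ ≤ 1 := inv_le_one_of_one_le₀ (one_le_pow₀ (by norm_num))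
      nlinarith [norm_nonneg z]
    have h2 : 1 + ‖x + ((2 : ℝ) ^ N)⁻¹ • z‖ ≤ (1 + ‖x‖) * (1 + ‖z‖) := by
      nlinarith [mul_nonneg (norm_nonneg x) (norm_nonneg z)]
    calc ‖Ψ z * F (x + ((2 : ℝ) ^ N)⁻¹ • z)‖
        ≤ ‖Ψ z‖ * (A * ((1 + ‖x‖) * (1 + ‖z‖)) ^ m) := by
          rw [norm_mul]
          gcongr
          exact (hA _).trans (by gcongr)
      _ = _ := by rw [mul_pow]; ring
  have hbound : ∀ (N : ℕ) (x : Rn n), ‖∑ k ∈ Finset.range (N + 1), dyadicBlock η k f x‖ ≤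
      A * (∫ z, (1 + ‖z‖) ^ m * ‖Ψ z‖) * (1 + ‖x‖) ^ m := fun N x => by
    rw [hblock]
    refine (norm_integral_le_of_norm_le (hint.const_mul _)
      (Eventually.of_forall (hpt N x))).trans (le_of_eq ?_)
    rw [integral_const_mul]; ring
  have hlim : ∀ x, Tendsto (fun N => ∑ k ∈ Finset.range (N + 1), dyadicBlock η k f x) atTop
      (𝓝 (F x)) := fun x => by
    simp only [hblock]
    have e : F x = ∫ z, Ψ z * F x := by
      rw [integral_mul_const, hΨ, integral_fourier_baseSymbol, one_mul]
    rw [e]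
    refine tendsto_integral_of_dominated_convergence _ (fun N => ?_)
      (hint.const_mul (A * (1 + ‖x‖) ^ m)) (fun N => Eventually.of_forall (hpt N x))
      (Eventually.of_forall fun z => ?_)
    · have := Ψ.continuous
      exact (by fun_prop : Continuous fun z => Ψ z * F (x + ((2 : ℝ) ^ N)⁻¹ • z)).aestronglyMeasurable
    · refine Tendsto.const_mul _ ((hF.tendsto' _ _ rfl).comp ?_)
      have h3 : Tendsto (fun N : ℕ => ((2 : ℝ) ^ N)⁻¹) atTop (𝓝 0) :=
        tendsto_inv_atTop_zero.comp (tendsto_pow_atTop_atTop_of_one_lt (by norm_num))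
      have h4 := (h3.smul_const z).const_add x
      rwa [zero_smul, add_zero] at h4
  have hFL : HasPolyGrowth fun x : Rn (n - 1) => F (hyperplanePoint x) :=
    ⟨A, m, fun x => by simpa only [hL] using hA (hyperplanePoint x)⟩
  obtain ⟨g, hg⟩ := hFL.exists_distribution (hF.comp hLc).aestronglyMeasurable
  refine ⟨g, fun ψ => ?_, hg⟩
  -- The telescoping formula concerns the blocks `0, …, N`, hence the shift by one.
  rw [hg, ← tendsto_add_atTop_iff_nat 1]
  have hB := fun k => isBandLimited_trace η k f
  have e : ∀ N, ∑ k ∈ Finset.range (N + 1), ∫ x, ψ x * dyadicBlock η k f (hyperplanePoint x) =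
      ∫ x, ψ x * ∑ k ∈ Finset.range (N + 1), dyadicBlock η k f (hyperplanePoint x) := fun N => by
    rw [← integral_finsetSum _ fun k _ => (hB k).growth.integrable_mul (hB k).aestronglyMeasurable ψ]
    simp only [Finset.mul_sum]
  simp only [e]
  refine tendsto_integral_of_dominated_convergence _ (fun N => ?_)
    ((ψ.integrable_one_add_norm_pow_mul m).const_mul (A * ∫ z, (1 + ‖z‖) ^ m * ‖Ψ z‖))
    (fun N => Eventually.of_forall fun x => ?_)
    (Eventually.of_forall fun x => (hlim (hyperplanePoint x)).const_mul _)
  · exact (ψ.continuous.mul (continuous_finsetSum _ fun k _ => (hB k).continuous)).aestronglyMeasurable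
  · rw [norm_mul]
    refine (mul_le_mul_of_nonneg_left (hbound N _) (norm_nonneg _)).trans (le_of_eq ?_)
    rw [hL]; ring

/-! ### High-pass filters -/

/-- The symbol `ζ ↦ |ζ|^{-2M}` cut off to an annulus that contains `1/2 ≤ |ζ| ≤ 2^c`. -/
theorem exists_annulus_symbol (η : DyadicBump) (n M c : ℕ) :
    ∃ b : 𝓢(Rn n, ℂ), ∀ ζ : Rn n, 1 ≤ 2 * ‖ζ‖ → ‖ζ‖ ≤ 2 ^ c →
      b ζ * ((‖ζ‖ ^ 2) ^ M : ℝ) = 1 := by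
  set b₀ : Rn n → ℝ := fun ζ => (1 - η.toFun (4 * ‖ζ‖)) * η.toFun ((2 : ℝ)⁻¹ ^ c * ‖ζ‖) *
    ((‖ζ‖ ^ 2) ^ M)⁻¹ with hb₀
  have hsupp : HasCompactSupport fun ζ => ((b₀ ζ : ℝ) : ℂ) := by
    refine HasCompactSupport.intro (isCompact_closedBall (0 : Rn n) (2 * 2 ^ c)) fun ζ hζ => ?_
    rw [Metric.mem_closedBall, dist_zero_right, not_le] at hζ
    rw [hb₀]
    simp only
    rw [η.eq_zero ((2 : ℝ)⁻¹ ^ c * ‖ζ‖), mul_zero, zero_mul, Complex.ofReal_zero]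
    rw [abs_of_nonneg (by positivity), inv_pow, ← div_eq_inv_mul, le_div_iff₀ (by positivity)]
    exact hζ.le
  have hsmooth : ContDiff ℝ (⊤ : ℕ∞) b₀ := by
    rw [contDiff_iff_contDiffAt]
    intro ζ
    by_cases hζ : ζ = 0
    · have hc : Continuous fun ξ : Rn n => |4 * ‖ξ‖| := by fun_prop
      have hev : ∀ᶠ ξ in 𝓝 ζ, |4 * ‖ξ‖| < 1 :=
        hc.continuousAt.eventually_lt continuousAt_const (by simp [hζ])
      have he : b₀ =ᶠ[𝓝 ζ] fun _ => (0 : ℝ) := by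
        filter_upwards [hev] with ξ hξ
        rw [hb₀]
        simp only
        rw [η.eq_one _ hξ.le, sub_self, zero_mul, zero_mul]
      exact contDiffAt_const.congr_of_eventuallyEq he
    · refine ((contDiffAt_const.sub (η.contDiff_norm 4).contDiffAt).mul
        (η.contDiff_norm _).contDiffAt).mul (ContDiffAt.inv ?_ ?_)
      · exact ((contDiff_norm_sq ℝ).pow M).contDiffAt
      · exact pow_ne_zero _ (pow_ne_zero _ (norm_ne_zero_iff.2 hζ))
  refine ⟨hsupp.toSchwartzMap (Complex.ofRealCLM.contDiff.comp hsmooth), fun ζ h1 h2 => ?_⟩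
  have hz : (0 : ℝ) < ‖ζ‖ := by linarith
  change ((b₀ ζ : ℝ) : ℂ) * _ = 1
  rw [hb₀, ← Complex.ofReal_mul]
  simp only
  rw [η.eq_zero (4 * ‖ζ‖), η.eq_one, sub_zero, one_mul, one_mul,
    inv_mul_cancel₀ (by positivity), Complex.ofReal_one]
  · rw [abs_of_nonneg (by positivity), inv_pow, inv_mul_le_iff₀ (by positivity), mul_one]
    exact h2
  · rw [abs_of_nonneg (by positivity)]; linarith

theorem waveTest_zero_apply {n : ℕ} (Φ : 𝓢(Rn n, ℂ)) (k : ℕ) (ξ : Rn n) :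
    waveTest Φ k 0 ξ = Φ (((2 : ℝ) ^ k)⁻¹ • ξ) := by
  rw [waveTest_apply, planeWave_zero_right, one_mul]

theorem SchwartzMap.integral_fourier_mul {n : ℕ} (ψ φ : 𝓢(Rn n, ℂ)) :
    ∫ x, (𝓕 ψ) x * φ x = ∫ x, ψ x * (𝓕 φ) x := by
  have := SchwartzMap.integral_fourier_smul_eq ψ φ
  simpa only [smul_eq_mul] using this

theorem SchwartzMap.fourierMultiplierCLM_waveTest_apply {n : ℕ} (Φ ψ : 𝓢(Rn n, ℂ)) (k : ℕ)
    (x : Rn n) :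
    SchwartzMap.fourierMultiplierCLM ℂ (waveTest Φ k 0) ψ x =
      ∫ y, kernelAt (𝓕 Φ) k x y * ψ y := by
  rw [SchwartzMap.fourierMultiplierCLM_apply, SchwartzMap.fourierInv_apply_planeWave,
    ← fourier_waveTest, SchwartzMap.integral_fourier_mul]
  refine integral_congr_ae (Eventually.of_forall fun ξ => ?_)
  simp only
  rw [SchwartzMap.smulLeftCLM_apply_apply (SchwartzMap.hasTemperateGrowth _), smul_eq_mul,
    waveTest_zero_apply, waveTest_apply, mul_assoc]

theorem SchwartzMap.fourier_fourierMultiplierCLM_apply {n : ℕ} {g : Rn n → ℂ}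
    (hg : g.HasTemperateGrowth) (ψ : 𝓢(Rn n, ℂ)) (ξ : Rn n) :
    (𝓕 (SchwartzMap.fourierMultiplierCLM ℂ g ψ)) ξ = g ξ * (𝓕 ψ) ξ := by
  rw [SchwartzMap.fourierMultiplierCLM_apply, FourierInvPair.fourier_fourierInv_eq,
    SchwartzMap.smulLeftCLM_apply_apply hg, smul_eq_mul]

/-- Frequencies of size about `2^k` are tested at the cost of a factor `2^{-2Mk}`. -/
theorem exists_gauge_highPass (η : DyadicBump) (n M c : ℕ) {p : ℝ≥0∞} (hp : 1 ≤ p) :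
    ∃ γ : 𝓢(Rn n, ℂ) → ℝ, IsSchwartzGauge γ ∧ ∀ (k : ℕ) (ψ : 𝓢(Rn n, ℂ)), ∃ φ : 𝓢(Rn n, ℂ),
      (∀ ζ, 2 ^ k ≤ 2 * ‖ζ‖ → ‖ζ‖ ≤ 2 ^ (k + c) → (𝓕⁻ φ) ζ = (𝓕⁻ ψ) ζ) ∧
      ∀ h : Rn n → ℂ, AEStronglyMeasurable h volume →
        ∫⁻ y, ‖φ y * h y‖ₑ ≤
          (2 : ℝ≥0∞) ^ (-(2 * M : ℝ) * k) * eLpNorm h p volume * ENNReal.ofReal (γ ψ) := by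
  have hp' : 1 ≤ (1 - p⁻¹)⁻¹ := by simp
  have : Fact (1 ≤ (1 - p⁻¹)⁻¹) := ⟨hp'⟩
  obtain ⟨b, hb⟩ := exists_annulus_symbol η n M c
  obtain ⟨C, hC, hCle⟩ := eLpNorm_kernel_le_of_one_le (𝓕 b)
    (LinearIsometry.id (E := Rn n) (R := ℝ)) (1 - p⁻¹)⁻¹ hp'
  set N : Rn n → ℂ := fun ξ => (((‖ξ‖ ^ 2) ^ M : ℝ) : ℂ) with hN
  have hNg : N.HasTemperateGrowth := by rw [hN]; fun_prop
  refine ⟨_, isSchwartzGauge_toLp (1 - p⁻¹)⁻¹ C.toReal ENNReal.toReal_nonneg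
    (SchwartzMap.fourierMultiplierCLM ℂ N), fun k ψ => ?_⟩
  -- The test function is `φ = 2^{-2Mk} b(2^{-k}D) |D|^{2M} ψ`. On the annulus the multipliers
  -- cancel since `b(ζ)|ζ|^{2M} = 1`; elsewhere `φ` is irrelevant. The operator `b(2^{-k}D)` is
  -- bounded uniformly in `k`, and `|D|^{2M} ψ` is a fixed Schwartz function that defines the gauge.
  set ψM := SchwartzMap.fourierMultiplierCLM ℂ N ψ with hψM
  set φ₁ := SchwartzMap.fourierMultiplierCLM ℂ (waveTest b k 0) ψM with hφ₁
  have h2k : (0 : ℝ) < 2 ^ k := by positivity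
  refine ⟨((((2 : ℝ) ^ k)⁻¹ ^ 2) ^ M : ℝ) • φ₁, fun ζ h1 h2 => ?_, fun h hh => ?_⟩
  · have e : ∀ χ : 𝓢(Rn n, ℂ), (𝓕⁻ χ) ζ = (𝓕 χ) (-ζ) := fun χ => by
      rw [SchwartzMap.fourier_apply_eq_fourierInv_neg, neg_neg]
    have hbz := hb (((2 : ℝ) ^ k)⁻¹ • -ζ) (by
        rw [norm_smul, norm_neg, Real.norm_of_nonneg (by positivity), mul_left_comm,
          ← div_eq_inv_mul, le_div_iff₀ h2k, one_mul]
        exact h1) (by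
        rw [norm_smul, norm_neg, Real.norm_of_nonneg (by positivity), inv_mul_le_iff₀ h2k,
          ← pow_add]
        exact h2)
    rw [e, e, FourierTransform.fourier_smul, smul_apply, hφ₁,
      SchwartzMap.fourier_fourierMultiplierCLM_apply (SchwartzMap.hasTemperateGrowth _), hψM,
      SchwartzMap.fourier_fourierMultiplierCLM_apply hNg, waveTest_zero_apply, hN,
      Complex.real_smul, ← mul_assoc, ← mul_assoc]
    convert one_mul _
    rw [← hbz, norm_smul, Real.norm_of_nonneg (by positivity), mul_pow, mul_pow]
    push_cast
    ring
  · have h3 : eLpNorm φ₁ (1 - p⁻¹)⁻¹ volume ≤ C * eLpNorm ψM (1 - p⁻¹)⁻¹ volume := by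
      have := hCle k ψM φ₁ ψM.continuous.aestronglyMeasurable fun x => by
        rw [hφ₁, SchwartzMap.fourierMultiplierCLM_waveTest_apply]
        exact enorm_integral_le_lintegral_enorm _
      simpa using this
    have h4 : ∀ y, ‖(((((2 : ℝ) ^ k)⁻¹ ^ 2) ^ M : ℝ) • φ₁) y * h y‖ₑ =
        (2 : ℝ≥0∞) ^ (-(2 * M : ℝ) * k) * ‖φ₁ y * h y‖ₑ := fun y => by
      rw [smul_apply, smul_mul_assoc, enorm_smul]
      congr 1
      rw [Real.enorm_of_nonneg (by positivity), ← ENNReal.ofReal_ofNat,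
        ENNReal.ofReal_rpow_of_pos (by norm_num)]
      congr 1
      rw [← pow_mul, inv_pow, ← pow_mul, neg_mul, Real.rpow_neg (by norm_num), ← Real.rpow_natCast]
      push_cast
      congr 2
      ring
    simp only [h4]
    rw [lintegral_const_mul' _ _ (two_rpow_ne_top _), mul_assoc]
    refine mul_le_mul' le_rfl ((lintegral_mul_le_eLpNorm hp φ₁ hh).trans ?_)
    rw [ENNReal.ofReal_mul ENNReal.toReal_nonneg, ENNReal.ofReal_toReal hC,
      SchwartzMap.ofReal_norm_toLp]
    exact mul_le_mul' le_rfl h3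

/-! ### Spectra in Lizorkin cubes -/

/-- The adjoint `ℝⁿ → ℝⁿ⁻¹` of the embedding of the hyperplane. -/
noncomputable def hyperplaneProj (n : ℕ) : Rn n →L[ℝ] Rn (n - 1) :=
  ContinuousLinearMap.adjoint (hyperplaneEmbedding n).toContinuousLinearMap

theorem inner_hyperplaneProj {n : ℕ} (ξ : Rn n) (x : Rn (n - 1)) :
    inner ℝ (hyperplaneProj n ξ) x = inner ℝ ξ (hyperplanePoint x) := by
  rw [hyperplaneProj, ContinuousLinearMap.adjoint_inner_left]
  rfl

theorem planeWave_hyperplanePoint {n : ℕ} (ξ : Rn n) (x : Rn (n - 1)) :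
    planeWave ξ (hyperplanePoint x) = planeWave (hyperplaneProj n ξ) x := by
  rw [planeWave, planeWave, inner_hyperplaneProj]

theorem norm_hyperplaneProj_le {n : ℕ} (ξ : Rn n) : ‖hyperplaneProj n ξ‖ ≤ ‖ξ‖ := by
  have h1 : ‖hyperplaneProj n‖ ≤ 1 := by
    rw [hyperplaneProj, LinearIsometryEquiv.norm_map]
    exact (hyperplaneEmbedding n).norm_toContinuousLinearMap_le
  have := (hyperplaneProj n).le_of_opNorm_le h1 ξ
  linarith

theorem hyperplaneProj_apply {n : ℕ} (ξ : Rn n) (i : Fin n) (hi : (i : ℕ) < n - 1) :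
    hyperplaneProj n ξ ⟨i, hi⟩ = ξ i := by
  have h := inner_hyperplaneProj ξ (EuclideanSpace.single ⟨i, hi⟩ 1)
  have e : (hyperplanePoint (EuclideanSpace.single ⟨i, hi⟩ (1 : ℝ)) : Rn n) =
      EuclideanSpace.single i 1 := by
    ext j
    simp only [hyperplanePoint, PiLp.single_apply, Fin.ext_iff]
    split_ifs <;> first | rfl | omega
  rw [e, EuclideanSpace.inner_single_right, EuclideanSpace.inner_single_right] at h
  simpa using h

theorem abs_apply_le_norm_hyperplaneProj {n : ℕ} (ξ : Rn n) (i : Fin n) (hi : (i : ℕ) < n - 1) :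
    |ξ i| ≤ ‖hyperplaneProj n ξ‖ := by
  rw [← hyperplaneProj_apply ξ i hi]
  exact PiLp.norm_apply_le (hyperplaneProj n ξ) ⟨i, hi⟩

theorem le_abs_of_mem_closure_lizorkinCube {n : ℕ} {k : ℕ} {t : LizorkinIndex n} {i : Fin n}
    (hi : (t.1 i).1 = true) {ξ : Rn n} (hξ : ξ ∈ closure (lizorkinCube (k + 1) t)) :
    2 ^ k ≤ |ξ i| := by
  have hc : IsClosed {ξ : Rn n | (2 : ℝ) ^ k ≤ |ξ i|} := isClosed_le (by fun_prop) (by fun_prop)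
  refine closure_minimal (fun ζ hζ => ?_) hc hξ
  have h := hζ i
  rw [hi, if_pos rfl] at h
  split_ifs at h
  · exact h.1.le.trans (le_abs_self _)
  · exact h.1.le.trans (neg_le_abs _)

theorem abs_le_of_mem_closure_lizorkinCube {n : ℕ} {k : ℕ} {t : LizorkinIndex n} (i : Fin n)
    {ξ : Rn n} (hξ : ξ ∈ closure (lizorkinCube k t)) : |ξ i| ≤ 2 ^ k := by
  have hc : IsClosed {ξ : Rn n | |ξ i| ≤ (2 : ℝ) ^ k} := isClosed_le (by fun_prop) (by fun_prop)
  refine closure_minimal (fun ζ hζ => ?_) hc hξ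
  rcases k with _ | k
  · simpa using hζ i
  · have h := hζ i
    have h2 : (0 : ℝ) < 2 ^ k := by positivity
    have h3 : (2 : ℝ) ^ (k + 1) = 2 * 2 ^ k := by ring
    have : |if (t.1 i).2 then ζ i else -ζ i| = |ζ i| := by split_ifs <;> simp
    rw [Set.mem_ofPred_eq, ← this]
    split_ifs at h ⊢ <;> rw [abs_of_pos (by linarith [h.1])] <;> linarith [h.2]

theorem norm_le_of_mem_closure_lizorkinCube {n : ℕ} {k : ℕ} {t : LizorkinIndex n} {ξ : Rn n}
    (hξ : ξ ∈ closure (lizorkinCube k t)) : ‖ξ‖ ≤ n * 2 ^ k := by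
  have h1 : ‖ξ‖ ≤ ∑ i, |ξ i| := by
    rw [EuclideanSpace.norm_eq]
    refine Real.sqrt_le_iff.2 ⟨Finset.sum_nonneg fun i _ => abs_nonneg _, ?_⟩
    simp only [Real.norm_eq_abs]
    exact Finset.sum_sq_le_sq_sum_of_nonneg fun i _ => abs_nonneg _
  refine h1.trans ((Finset.sum_le_sum fun i _ => abs_le_of_mem_closure_lizorkinCube i hξ).trans ?_)
  simp

/-- The spectrum of `V` is contained in the closure of the cube `P_{k,t}`. -/
def HasSpectrumIn {n : ℕ} (V : 𝓢'(Rn n, ℂ)) (k : ℕ) (t : LizorkinIndex n) : Prop :=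
  ∀ ψ : 𝓢(Rn n, ℂ), tsupport ψ ⊆ (closure (lizorkinCube k t))ᶜ → (𝓕 V) ψ = 0

/-- The symbol `φ_j` lives on `2^{j-1} ≤ |ξ| ≤ 2^{j+1}`, and a cube of level `k ≥ 1` on `2^{k-1} ≤
|ξ| ≤ n 2^k`, where `n < 2^n`; for level `0` only the upper bound is used. The gaps are strict, so
that the closed support of the test function misses the closed cube. -/
theorem HasSpectrumIn.dyadicBlock_eq_zero (η : DyadicBump) {n : ℕ} {V : 𝓢'(Rn n, ℂ)} {k : ℕ}
    {t : LizorkinIndex n} (hV : HasSpectrumIn V k t) {j : ℕ} (hj : j + 3 ≤ k ∨ k + n + 1 ≤ j) :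
    dyadicBlock η j V = 0 := by
  funext x
  refine hV _ fun ξ hξ hcl => ?_
  rcases hj with hj | hj
  · have hc : IsClosed {ξ : Rn n | ‖ξ‖ ≤ (2 : ℝ) * 2 ^ j} := isClosed_le (by fun_prop) (by fun_prop)
    have h1 : ‖ξ‖ ≤ 2 * 2 ^ j := by
      refine closure_minimal (fun ζ hζ => ?_) hc hξ
      by_contra hlt
      rw [Set.mem_ofPred_eq, not_le] at hlt
      exact hζ (by
        rw [dyadicTest_apply, dyadicSymbol_eq_zero η j ζ hlt.le, Complex.ofReal_zero, mul_zero])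
    obtain ⟨k, rfl⟩ : ∃ k', k = k' + 1 := ⟨k - 1, by omega⟩
    obtain ⟨i, hi⟩ := t.2
    have h2 := le_abs_of_mem_closure_lizorkinCube hi hcl
    have h3 : |ξ i| ≤ ‖ξ‖ := PiLp.norm_apply_le ξ i
    have h4 : (2 : ℝ) ^ (j + 2) ≤ 2 ^ k := pow_le_pow_right₀ (by norm_num) (by omega)
    have h5 : (2 : ℝ) ^ (j + 2) = 4 * 2 ^ j := by ring
    have h6 : (0 : ℝ) < 2 ^ j := by positivity
    linarith
  · have hc : IsClosed {ξ : Rn n | (2 : ℝ) ^ j ≤ 2 * ‖ξ‖} := isClosed_le (by fun_prop) (by fun_prop)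
    have h1 : 2 ^ j ≤ 2 * ‖ξ‖ := by
      refine closure_minimal (fun ζ hζ => ?_) hc hξ
      by_contra hlt
      rw [Set.mem_ofPred_eq, not_le] at hlt
      exact hζ (by
        rw [dyadicTest_apply, dyadicSymbol_eq_zero_of_le η j (by omega) ζ hlt.le,
          Complex.ofReal_zero, mul_zero])
    have h2 := norm_le_of_mem_closure_lizorkinCube hcl
    have h3 : (n : ℝ) < 2 ^ n := by exact_mod_cast Nat.lt_two_pow_self
    have h4 : (2 : ℝ) ^ (k + n + 1) ≤ 2 ^ j := pow_le_pow_right₀ (by norm_num) hj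
    have h5 : (2 : ℝ) ^ (k + n + 1) = 2 * (2 ^ n * 2 ^ k) := by ring
    have h6 : (n : ℝ) * 2 ^ k < 2 ^ n * 2 ^ k := by gcongr
    linarith

/-- Away from the `n`-th axis, the traces of the blocks have no low frequencies. -/
theorem HasSpectrumIn.integral_mul_trace_eq_zero (η : DyadicBump) {n : ℕ} {V : 𝓢'(Rn n, ℂ)} {k : ℕ}
    {t : LizorkinIndex n} (hV : HasSpectrumIn V (k + 1) t) (ht : ¬ IsNearAxis t) (j : ℕ)
    (ψ : 𝓢(Rn (n - 1), ℂ))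
    (hψ : ∀ ζ, 2 ^ k ≤ 2 * ‖ζ‖ → ‖ζ‖ ≤ 2 * 2 ^ j → (𝓕⁻ ψ) ζ = 0) :
    ∫ x, ψ x * dyadicBlock η j V (hyperplanePoint x) = 0 := by
  have hg : (fun ξ : Rn n => (𝓕⁻ ψ) (hyperplaneProj n ξ)).HasTemperateGrowth :=
    (SchwartzMap.hasTemperateGrowth _).comp (hyperplaneProj n).hasTemperateGrowth
  set S : 𝓢(Rn n, ℂ) := SchwartzMap.smulLeftCLM ℂ
    (fun ξ : Rn n => (𝓕⁻ ψ) (hyperplaneProj n ξ)) (dyadicTest η j 0) with hSd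
  have hS : ∀ ξ, S ξ = (dyadicSymbol η j ξ : ℂ) * (𝓕⁻ ψ) (hyperplaneProj n ξ) := fun ξ => by
    rw [hSd, SchwartzMap.smulLeftCLM_apply_apply hg, dyadicTest_apply, planeWave_zero_right,
      one_mul, smul_eq_mul, mul_comm]
  have h := integral_mul_dyadicBlock η j V (hyperplaneEmbedding n) ψ S fun ξ => by
    rw [hS, SchwartzMap.fourierInv_apply_planeWave]
    congr 1
    refine integral_congr_ae (Eventually.of_forall fun y => ?_)
    simp only [hyperplaneEmbedding_apply]
    rw [planeWave_hyperplanePoint, planeWave_comm]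
  refine h.trans (hV S fun ξ hξ hcl => ?_)
  have hc : IsClosed {ξ : Rn n | 2 * ‖hyperplaneProj n ξ‖ ≤ (2 : ℝ) ^ k} :=
    isClosed_le (by fun_prop) (by fun_prop)
  have h1 : 2 * ‖hyperplaneProj n ξ‖ ≤ 2 ^ k := by
    refine closure_minimal (fun ζ hζ => ?_) hc hξ
    by_contra hlt
    rw [Set.mem_ofPred_eq, not_le] at hlt
    refine hζ ?_
    rw [hS]
    rcases le_total (2 * 2 ^ j) ‖ζ‖ with hz | hz
    · rw [dyadicSymbol_eq_zero η j ζ hz, Complex.ofReal_zero, zero_mul]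
    · rw [hψ _ hlt.le ((norm_hyperplaneProj_le ζ).trans hz), mul_zero]
  -- Off the axis one of the first `n - 1` coordinates is outer, which forces `|ξ̄| ≥ 2^k` on the
  -- closed cube, whereas `2|ξ̄| ≤ 2^k` on the support of `S`.
  rw [IsNearAxis] at ht
  push Not at ht
  obtain ⟨i, hi, hti⟩ := ht
  have h2 := le_abs_of_mem_closure_lizorkinCube (by simpa using hti) hcl
  have h3 := abs_apply_le_norm_hyperplaneProj ξ i hi
  have h4 : (0 : ℝ) < 2 ^ k := by positivity
  linarith

theorem HasSpectrumIn.smoothBlock_trace_eq_zero (η : DyadicBump) {n : ℕ} {V : 𝓢'(Rn n, ℂ)} {k : ℕ}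
    {t : LizorkinIndex n} (hV : HasSpectrumIn V k t) (ht : ¬ IsNearAxis t) {i : ℕ} (j : ℕ)
    (hi : i + 3 ≤ k) :
    smoothBlock η i (fun x : Rn (n - 1) => dyadicBlock η j V (hyperplanePoint x)) = 0 := by
  obtain ⟨k, rfl⟩ : ∃ k', k = k' + 1 := ⟨k - 1, by omega⟩
  funext x
  refine hV.integral_mul_trace_eq_zero η ht j _ fun ζ h1 _ => ?_
  rw [fourierInv_kernelAt_baseSymbol, dyadicTest_apply, dyadicSymbol_eq_zero, Complex.ofReal_zero,
    mul_zero]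
  have h4 : (2 : ℝ) ^ (i + 2) ≤ 2 ^ k := pow_le_pow_right₀ (by norm_num) (by omega)
  have h5 : (2 : ℝ) ^ (i + 2) = 4 * 2 ^ i := by ring
  linarith

/-- As `p ≥ 1`, the kernel estimate applies to `w` itself. The pieces with sharply cut spectrum
therefore enter directly, and no multiplier theorem for cubes is needed. -/
theorem eLpNorm_trace_le (η : DyadicBump) {n : ℕ} (hn : 2 ≤ n) {p : ℝ≥0∞} (hp : 1 ≤ p) :
    ∃ C : ℝ≥0∞, C ≠ ∞ ∧ ∀ (j : ℕ) (V : 𝓢'(Rn n, ℂ)) (w : Rn n → ℂ),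
      AEStronglyMeasurable w volume → (∀ ψ : 𝓢(Rn n, ℂ), V ψ = ∫ y, ψ y * w y) →
      eLpNorm (fun x : Rn (n - 1) => dyadicBlock η j V (hyperplanePoint x)) p volume ≤
        C * (2 : ℝ≥0∞) ^ (p⁻¹.toReal * j) * eLpNorm w p volume := by
  choose C hC h using fun i => eLpNorm_kernel_le_of_one_le (𝓕 (baseSymbol η n i))
    (hyperplaneEmbedding n) p hp
  refine ⟨C 0 + C 1, ENNReal.add_ne_top.2 ⟨hC 0, hC 1⟩, fun j V w hw hV => ?_⟩
  have hcast : (n : ℝ) - ((n - 1 : ℕ) : ℝ) = 1 := by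
    rw [Nat.cast_sub (by omega), Nat.cast_one]; ring
  have hCi : C (min j 1) ≤ C 0 + C 1 := by
    rcases j with _ | j
    · exact le_self_add
    · rw [show min (j + 1) 1 = 1 by omega]; exact le_add_self
  refine (h (min j 1) (j - 1) w _ hw fun x => ?_).trans ?_
  · rw [baseSymbol_min, dyadicBlock_eq, hV]
    exact enorm_integral_le_lintegral_enorm _
  · rw [hcast, one_mul, mul_comm _ p⁻¹.toReal]
    have h1 : ((j - 1 : ℕ) : ℝ) ≤ j := by exact_mod_cast Nat.sub_le j 1
    gcongr
    norm_num

/-! ### Lizorkin series -/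

/-- `f = ∑ V_{k,t}` where `V_{k,t}` is given by a function `w_{k,t}` with spectrum in `P_{k,t}`, and
there is no piece of level `0` near the axis. -/
structure IsLizorkinSeries {n : ℕ} (f : 𝓢'(Rn n, ℂ)) (w : ℕ × LizorkinIndex n → Rn n → ℂ)
    (V : ℕ × LizorkinIndex n → 𝓢'(Rn n, ℂ)) : Prop where
  aestronglyMeasurable : ∀ z, AEStronglyMeasurable (w z) volume
  eval : ∀ z (ψ : 𝓢(Rn n, ℂ)), V z ψ = ∫ y, ψ y * w z y
  spectrum : ∀ z, HasSpectrumIn (V z) z.1 z.2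
  eq_zero : ∀ t, IsNearAxis t → w (0, t) = 0
  sum : ∀ ψ : 𝓢(Rn n, ℂ), Tendsto
    (fun N : ℕ => ∑ z ∈ Finset.range N ×ˢ Finset.univ, V z ψ) atTop (𝓝 (f ψ))

theorem exists_not_isNearAxis {n : ℕ} (hn : 2 ≤ n) : ∃ t : LizorkinIndex n, ¬ IsNearAxis t := by
  refine ⟨⟨fun _ => (true, true), ⟨⟨0, by omega⟩, rfl⟩⟩, fun h => ?_⟩
  simpa using h ⟨0, by omega⟩ (by simp; omega)

/-- All labels of level `0` denote the same function, which must be counted once. It is kept at a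
label `t₀` off the axis, because the factor `k` erases the level `0` terms near the axis from the
logarithmic norm. -/
theorem IsLizorkinDecomposition.exists_series {n : ℕ} (hn : 2 ≤ n) {p : ℝ≥0∞} (hp : 1 ≤ p)
    {f : 𝓢'(Rn n, ℂ)} {u : LizorkinFamily n} (hu : IsLizorkinDecomposition p f u) :
    ∃ w V, IsLizorkinSeries f w V ∧ ∀ z, eLpNorm (w z) p volume ≤
      eLpNorm (u.piece z.1 z.2) p volume := by
  classical
  obtain ⟨t₀, ht₀⟩ := exists_not_isNearAxis hn
  set w : ℕ × LizorkinIndex n → Rn n → ℂ := fun z =>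
    if z.1 = 0 ∧ z.2 ≠ t₀ then 0 else u.piece z.1 z.2 with hw
  have hwL : ∀ z, MemLp (w z) p volume := fun z => by
    rw [hw]
    simp only
    split_ifs
    · exact MemLp.zero
    · exact hu.memLp _ _
  choose V hV using fun z => (hwL z).exists_distribution hp
  refine ⟨w, V, ⟨fun z => (hwL z).1, hV, fun z ψ hψ => ?_, fun t ht => ?_, fun ψ => ?_⟩,
    fun z => ?_⟩
  · rw [TemperedDistribution.fourier_apply, hV, hw]
    simp only
    split_ifs
    · simp
    · exact hu.outside z.1 z.2 ψ hψ
  · exact if_pos ⟨rfl, fun h => ht₀ (h ▸ ht)⟩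
  · rw [← tendsto_add_atTop_iff_nat 1]
    refine (hu.sum ψ).congr fun N => ?_
    rw [Finset.sum_product, Finset.sum_range_succ', add_comm]
    congr 1
    · refine Finset.sum_congr rfl fun k _ => Finset.sum_congr rfl fun t _ => ?_
      rw [hV, hw]
      simp [LizorkinFamily.piece]
    · rw [Finset.sum_eq_single t₀ (fun t _ ht => by rw [hV, hw]; simp [ht]) (by simp), hV, hw]
      simp [LizorkinFamily.piece]
  · rw [hw]
    simp only
    split_ifs
    · simp
    · exact le_rfl

/-- The labels of the cubes that meet the support of `φ_j`. -/
def lizorkinNeighbours (n j : ℕ) : Finset (ℕ × LizorkinIndex n) :=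
  Finset.Ico (j - n) (j + 3) ×ˢ Finset.univ

theorem mem_lizorkinNeighbours {n j : ℕ} {z : ℕ × LizorkinIndex n} :
    z ∈ lizorkinNeighbours n j ↔ j ≤ z.1 + n ∧ z.1 < j + 3 := by
  rw [lizorkinNeighbours, Finset.mem_product, Finset.mem_Ico]
  simp only [Finset.mem_univ, and_true]
  omega

/-- A cube of level `k` is a neighbour only of blocks `j` with `k - 2 ≤ j ≤ k + n`, of which there
are at most `n + 3`. -/
theorem tsum_sum_lizorkinNeighbours_le {n : ℕ} (F : ℕ × LizorkinIndex n → ℝ≥0∞) :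
    ∑' j, ∑ z ∈ lizorkinNeighbours n j, F z ≤ ((n + 3 : ℕ) : ℝ≥0∞) * ∑' z, F z := by
  classical
  have e : ∀ j, ∑ z ∈ lizorkinNeighbours n j, F z =
      ∑' z, if z ∈ lizorkinNeighbours n j then F z else 0 := fun j => by
    rw [tsum_eq_sum (s := lizorkinNeighbours n j) fun z hz => if_neg hz]
    exact Finset.sum_congr rfl fun z hz => (if_pos hz).symm
  simp only [e]
  rw [ENNReal.tsum_comm, ← ENNReal.tsum_mul_left]
  refine ENNReal.tsum_le_tsum fun z => ?_
  rw [tsum_eq_sum (s := Finset.Ico (z.1 - 2) (z.1 + n + 1)) fun j hj => if_neg fun hz => hj (by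
    rw [mem_lizorkinNeighbours] at hz
    rw [Finset.mem_Ico]
    omega)]
  calc ∑ j ∈ Finset.Ico (z.1 - 2) (z.1 + n + 1), (if z ∈ lizorkinNeighbours n j then F z else 0)
      ≤ ∑ j ∈ Finset.Ico (z.1 - 2) (z.1 + n + 1), F z := by
        refine Finset.sum_le_sum fun j _ => ?_
        split_ifs
        · exact le_rfl
        · exact zero_le
    _ ≤ ((n + 3 : ℕ) : ℝ≥0∞) * F z := by
        rw [Finset.sum_const, Nat.card_Ico, nsmul_eq_mul]
        gcongr
        omega

theorem IsLizorkinSeries.dyadicBlock_eq (η : DyadicBump) {n : ℕ} {f : 𝓢'(Rn n, ℂ)}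
    {w : ℕ × LizorkinIndex n → Rn n → ℂ} {V : ℕ × LizorkinIndex n → 𝓢'(Rn n, ℂ)}
    (hV : IsLizorkinSeries f w V) (j : ℕ) (x : Rn n) :
    dyadicBlock η j f x = ∑ z ∈ lizorkinNeighbours n j, dyadicBlock η j (V z) x := by
  have h := hV.sum (kernelAt (𝓕 (baseSymbol η n j)) (j - 1) x)
  simp only [← _root_.dyadicBlock_eq] at h
  refine tendsto_nhds_unique h (tendsto_const_nhds.congr' ?_)
  filter_upwards [eventually_ge_atTop (j + 3)] with N hN
  refine Finset.sum_subset (fun z hz => ?_) fun z _ hz => ?_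
  · rw [mem_lizorkinNeighbours] at hz
    simp only [Finset.mem_product, Finset.mem_range, Finset.mem_univ, and_true]
    omega
  · rw [mem_lizorkinNeighbours] at hz
    rw [(hV.spectrum z).dyadicBlock_eq_zero η (by omega)]
    rfl

theorem smoothBlock_sum (η : DyadicBump) {n : ℕ} (i : ℕ) {ι : Type*} (s : Finset ι)
    (g : ι → Rn n → ℂ) (hg : ∀ z ∈ s, HasPolyGrowth (g z))
    (hm : ∀ z ∈ s, AEStronglyMeasurable (g z) volume) :
    (smoothBlock η i fun x => ∑ z ∈ s, g z x) = fun x => ∑ z ∈ s, smoothBlock η i (g z) x := by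
  funext x
  simp only [smoothBlock, Finset.mul_sum]
  exact integral_finsetSum _ fun z hz => (hg z hz).integrable_mul (hm z hz) _

theorem IsSchwartzGauge.add {n : ℕ} {q₁ q₂ : 𝓢(Rn n, ℂ) → ℝ} (h₁ : IsSchwartzGauge q₁)
    (h₂ : IsSchwartzGauge q₂) : IsSchwartzGauge fun ψ => q₁ ψ + q₂ ψ where
  continuous := h₁.continuous.add h₂.continuous
  map_zero := by simp only [h₁.map_zero, h₂.map_zero, add_zero]
  nonneg ψ := add_nonneg (h₁.nonneg ψ) (h₂.nonneg ψ)

/-! ### The trace of a Lizorkin series -/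

open Classical in
/-- The weighted norm of the piece `w_{k,t}`. -/
noncomputable def pieceNorm {n : ℕ} (s : ℝ) (p : ℝ≥0∞) (w : ℕ × LizorkinIndex n → Rn n → ℂ)
    (z : ℕ × LizorkinIndex n) : ℝ≥0∞ :=
  if IsNearAxis z.2 then (2 : ℝ≥0∞) ^ (p⁻¹.toReal * z.1) * eLpNorm (w z) p volume
  else (2 : ℝ≥0∞) ^ ((s + p⁻¹.toReal) * z.1) * eLpNorm (w z) p volume

theorem eLpNorm_trace_piece_le (η : DyadicBump) {n : ℕ} (hn : 2 ≤ n) {p : ℝ≥0∞} (hp : 1 ≤ p) :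
    ∃ A : ℝ≥0∞, A ≠ ∞ ∧ ∀ (f : 𝓢'(Rn n, ℂ)) (w : ℕ × LizorkinIndex n → Rn n → ℂ)
      (V : ℕ × LizorkinIndex n → 𝓢'(Rn n, ℂ)), IsLizorkinSeries f w V →
      ∀ j, ∀ z ∈ lizorkinNeighbours n j,
        eLpNorm (fun x : Rn (n - 1) => dyadicBlock η j (V z) (hyperplanePoint x)) p volume ≤
          A * (2 ^ (p⁻¹.toReal * z.1) * eLpNorm (w z) p volume) := by
  obtain ⟨C, hC, h⟩ := eLpNorm_trace_le η hn hp
  refine ⟨C * 2 ^ (p⁻¹.toReal * n), ENNReal.mul_ne_top hC (two_rpow_ne_top _),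
    fun f w V hV j z hz => ?_⟩
  refine (h j (V z) (w z) (hV.aestronglyMeasurable z) (hV.eval z)).trans ?_
  have h1 : (j : ℝ) ≤ n + z.1 := by
    have := (mem_lizorkinNeighbours.1 hz).1
    rw [add_comm]
    exact_mod_cast this
  have h2 : (2 : ℝ≥0∞) ^ (p⁻¹.toReal * j) ≤ 2 ^ (p⁻¹.toReal * n) * 2 ^ (p⁻¹.toReal * z.1) := by
    rw [← two_rpow_add, ← mul_add]
    exact two_rpow_le (mul_le_mul_of_nonneg_left h1 ENNReal.toReal_nonneg)
  calc C * (2 : ℝ≥0∞) ^ (p⁻¹.toReal * j) * eLpNorm (w z) p volume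
      ≤ C * (2 ^ (p⁻¹.toReal * n) * 2 ^ (p⁻¹.toReal * z.1)) * eLpNorm (w z) p volume := by gcongr
    _ = _ := by ring

/-- Near the axis Hölder suffices. Off the axis the weight of the piece is smaller by `2^{sk}`; that
factor is recovered by replacing `ψ` with a test function that agrees with it on the high
frequencies seen by the trace. -/
theorem exists_gauge_trace_piece (η : DyadicBump) {n : ℕ} (hn : 2 ≤ n) {p : ℝ≥0∞} (hp : 1 ≤ p)
    {s : ℝ} (hs : s ≤ 0) :
    ∃ (A : ℝ≥0∞) (γ : 𝓢(Rn (n - 1), ℂ) → ℝ), A ≠ ∞ ∧ IsSchwartzGauge γ ∧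
      ∀ (f : 𝓢'(Rn n, ℂ)) (w : ℕ × LizorkinIndex n → Rn n → ℂ)
      (V : ℕ × LizorkinIndex n → 𝓢'(Rn n, ℂ)), IsLizorkinSeries f w V →
      ∀ j, ∀ z ∈ lizorkinNeighbours n j, ∀ ψ : 𝓢(Rn (n - 1), ℂ),
        ‖∫ x, ψ x * dyadicBlock η j (V z) (hyperplanePoint x)‖ₑ ≤
          A * pieceNorm s p w z * ENNReal.ofReal (γ ψ) := by
  obtain ⟨A, hA, hg⟩ := eLpNorm_trace_piece_le η hn hp
  -- The gain `2^{-2Mk}` must beat `2^{sk}`, so `2M ≥ -s`. The width `n + 2` of the annulus is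
  -- dictated by `2·2^j ≤ 2^{k+n+2}` for neighbours `j` of level `k + 1`.
  obtain ⟨M, hM⟩ := exists_nat_ge (-s / 2)
  obtain ⟨γ₀, hγ₀, h₀⟩ := exists_gauge_pairing (n := n - 1) p hp
  obtain ⟨γ₁, hγ₁, h₁⟩ := exists_gauge_highPass η (n - 1) M (n + 2) hp
  refine ⟨A * 2 ^ (-s), _, ENNReal.mul_ne_top hA (two_rpow_ne_top _), hγ₀.add hγ₁,
    fun f w V hV j z hz ψ => ?_⟩
  have hone : (1 : ℝ≥0∞) ≤ 2 ^ (-s) := by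
    rw [← ENNReal.rpow_zero (x := 2)]
    exact two_rpow_le (by linarith)
  have hgz := hg f w V hV j z hz
  have hB := isBandLimited_trace η j (V z)
  set G : Rn (n - 1) → ℂ := fun x => dyadicBlock η j (V z) (hyperplanePoint x) with hG
  have hle₀ : ENNReal.ofReal (γ₀ ψ) ≤ ENNReal.ofReal (γ₀ ψ + γ₁ ψ) :=
    ENNReal.ofReal_le_ofReal (le_add_of_nonneg_right (hγ₁.nonneg ψ))
  have hle₁ : ENNReal.ofReal (γ₁ ψ) ≤ ENNReal.ofReal (γ₀ ψ + γ₁ ψ) :=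
    ENNReal.ofReal_le_ofReal (le_add_of_nonneg_left (hγ₀.nonneg ψ))
  have hplain : pieceNorm s p w z = 2 ^ (p⁻¹.toReal * z.1) * eLpNorm (w z) p volume →
      ‖∫ x, ψ x * G x‖ₑ ≤
        A * 2 ^ (-s) * pieceNorm s p w z * ENNReal.ofReal (γ₀ ψ + γ₁ ψ) := fun hpn => by
    rw [hpn]
    calc ‖∫ x, ψ x * G x‖ₑ ≤ eLpNorm G p volume * ENNReal.ofReal (γ₀ ψ) :=
          (enorm_integral_le_lintegral_enorm _).trans (h₀ ψ G hB.aestronglyMeasurable)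
      _ ≤ A * (2 ^ (p⁻¹.toReal * z.1) * eLpNorm (w z) p volume) *
          ENNReal.ofReal (γ₀ ψ + γ₁ ψ) := mul_le_mul' hgz hle₀
      _ ≤ _ := by
          gcongr
          exact le_mul_of_one_le_right zero_le hone
  by_cases hnear : IsNearAxis z.2
  · exact hplain (if_pos hnear)
  -- At level `0` all weights equal one and nothing has to be gained.
  obtain ⟨_ | k, t⟩ := z
  · refine hplain ?_
    rw [pieceNorm, if_neg hnear]
    simp
  · obtain ⟨φ, hφ, hφb⟩ := h₁ k ψ
    have hjk := (mem_lizorkinNeighbours.1 hz).1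
    simp only at hjk hnear
    have h2j : (2 : ℝ) * 2 ^ j ≤ 2 ^ (k + (n + 2)) := by
      rw [mul_comm, ← pow_succ]
      exact pow_le_pow_right₀ (by norm_num) (by omega)
    have hz0 := (hV.spectrum (k + 1, t)).integral_mul_trace_eq_zero η hnear j (ψ - φ)
      fun ζ h2 h3 => by
        rw [SchwartzMap.fourierInv_apply_planeWave]
        simp only [sub_apply, mul_sub]
        rw [integral_sub, ← SchwartzMap.fourierInv_apply_planeWave,
          ← SchwartzMap.fourierInv_apply_planeWave, hφ ζ h2 (h3.trans h2j), sub_self]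
        · exact ψ.integrable.mono ((continuous_id.planeWave continuous_const).mul
            ψ.continuous).aestronglyMeasurable (Eventually.of_forall fun x => by
              rw [norm_mul, norm_planeWave, one_mul])
        · exact φ.integrable.mono ((continuous_id.planeWave continuous_const).mul
            φ.continuous).aestronglyMeasurable (Eventually.of_forall fun x => by
              rw [norm_mul, norm_planeWave, one_mul])
    have hψφ : ∫ x, ψ x * G x = ∫ x, φ x * G x := by
      simp only [sub_apply, sub_mul] at hz0
      rw [integral_sub (hB.growth.integrable_mul hB.aestronglyMeasurable ψ)
        (hB.growth.integrable_mul hB.aestronglyMeasurable φ), sub_eq_zero] at hz0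
      exact hz0
    rw [hψφ]
    have hk : (2 : ℝ≥0∞) ^ (-(2 * M : ℝ) * k) ≤ 2 ^ (-s) * 2 ^ (s * ((k + 1 : ℕ) : ℝ)) := by
      rw [← two_rpow_add]
      refine two_rpow_le ?_
      push_cast
      have : (0 : ℝ) ≤ k := by positivity
      nlinarith
    rw [pieceNorm, if_neg hnear]
    calc ‖∫ x, φ x * G x‖ₑ
        ≤ 2 ^ (-(2 * M : ℝ) * k) * eLpNorm G p volume * ENNReal.ofReal (γ₁ ψ) :=
          (enorm_integral_le_lintegral_enorm _).trans (hφb G hB.aestronglyMeasurable)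
      _ ≤ 2 ^ (-s) * 2 ^ (s * ((k + 1 : ℕ) : ℝ)) * (A * (2 ^ (p⁻¹.toReal * ((k + 1 : ℕ) : ℝ)) *
          eLpNorm (w (k + 1, t)) p volume)) * ENNReal.ofReal (γ₀ ψ + γ₁ ψ) := by
          gcongr
      _ = _ := by
          simp only
          rw [add_mul, two_rpow_add]
          ring

open Classical in
-- The trace of a near-axis piece of level `k` may contain all frequencies up to `k + n + 1`, and `W
-- k` pays for their sum. Off the axis only the at most `n + 4` frequencies from `k - 2` to `k + n +
-- 1` survive, so no weight is needed. Each piece meets boundedly many blocks `j`, so summation over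
-- `j` costs a constant.
theorem exists_hasTrace_lizorkinSeries (η : DyadicBump) {n : ℕ} (hn : 2 ≤ n) {p q : ℝ≥0∞}
    (hp : 1 < p) {r : ℝ} (hr0 : 0 < r) (hr1 : r ≤ 1) (hrq : ENNReal.ofReal r ≤ q) {s : ℝ}
    (hs : s ≤ 0) (W : ℕ → ℝ≥0∞) (hW : ∀ k, 1 ≤ k → 1 ≤ W k) (W₀ : ℝ≥0∞) (hW₀ : W₀ ≠ ∞)
    (hsW : ∀ k, 1 ≤ k →
      ∑ i ∈ Finset.range (k + n + 2), (2 : ℝ≥0∞) ^ (s * i * r) ≤ W₀ * W k) :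
    ∃ C : ℝ≥0∞, C ≠ ∞ ∧ ∀ (f : 𝓢'(Rn n, ℂ)) (w : ℕ × LizorkinIndex n → Rn n → ℂ)
      (V : ℕ × LizorkinIndex n → 𝓢'(Rn n, ℂ)), IsLizorkinSeries f w V →
      ∑' z, (if IsNearAxis z.2 then W z.1 else 1) * pieceNorm s p w z ^ r ≠ ∞ →
      ∃ g, HasTrace η f g ∧ besovNorm η s p q g ≤ C *
        (∑' z, (if IsNearAxis z.2 then W z.1 else 1) * pieceNorm s p w z ^ r) ^ (1 / r) := by
  obtain ⟨A, hA, hgA⟩ := eLpNorm_trace_piece_le η hn hp.le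
  obtain ⟨A', γ, hA', hγ, hgγ⟩ := exists_gauge_trace_piece η hn hp.le hs
  obtain ⟨C₂, hC₂, h₂⟩ := eLpNorm_smoothBlock_le η (n := n - 1) p (zero_lt_one.trans hp)
  rw [min_eq_right hp.le] at h₂
  simp only [inv_one, ENNReal.toReal_one, sub_self, mul_zero, ENNReal.rpow_zero, mul_one] at h₂
  -- Here `W₀` serves the pieces near the axis and `n + 4` counts the frequencies off the axis;
  -- `2^{-2s}` comes from `2^{si} ≤ 2^{-2s} 2^{sk}` for `i ≥ k - 2`.
  set B : ℝ≥0∞ := (C₂ * A * 2 ^ (-2 * s)) ^ r * (W₀ + (n + 4 : ℕ)) with hBd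
  have hB : B ≠ ∞ := ENNReal.mul_ne_top (ENNReal.rpow_ne_top_of_nonneg hr0.le
    (ENNReal.mul_ne_top (ENNReal.mul_ne_top hC₂ hA) (two_rpow_ne_top _)))
    (ENNReal.add_ne_top.2 ⟨hW₀, ENNReal.natCast_ne_top _⟩)
  refine ⟨(((n + 3 : ℕ) : ℝ≥0∞) * B) ^ (1 / r), ENNReal.rpow_ne_top_of_nonneg (by positivity)
    (ENNReal.mul_ne_top (ENNReal.natCast_ne_top _) hB), fun f w V hV hfin => ?_⟩
  set E : ℕ × LizorkinIndex n → ℝ≥0∞ := fun z =>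
    (if IsNearAxis z.2 then W z.1 else 1) * pieceNorm s p w z ^ r with hE
  have hnear0 : ∀ t, IsNearAxis t → pieceNorm s p w (0, t) = 0 := fun t ht => by
    rw [pieceNorm, if_pos ht, hV.eq_zero t ht]
    simp
  have hEle : ∀ z, pieceNorm s p w z ^ r ≤ E z := fun z => by
    rw [hE]
    simp only
    split_ifs with h
    · obtain ⟨_ | k, t⟩ := z
      · rw [hnear0 t h, ENNReal.zero_rpow_of_pos hr0]; exact zero_le
      · exact le_mul_of_one_le_left zero_le (hW _ (by simp))
    · rw [one_mul]
  have hsum : ∑' z, pieceNorm s p w z ≠ ∞ := by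
    refine ne_top_of_le_ne_top (ENNReal.rpow_ne_top_of_nonneg (y := 1 / r) (by positivity) hfin)
      ((ENNReal.tsum_le_tsum_rpow _ hr0 hr1).trans ?_)
    exact ENNReal.rpow_le_rpow (ENNReal.tsum_le_tsum hEle) (by positivity)
  have hBL := fun j z => isBandLimited_trace η j (V z)
  set G : ℕ → ℕ × LizorkinIndex n → Rn (n - 1) → ℂ :=
    fun j z x => dyadicBlock η j (V z) (hyperplanePoint x) with hG
  have hfG : ∀ j, (fun x : Rn (n - 1) => dyadicBlock η j f (hyperplanePoint x)) =
      fun x => ∑ z ∈ lizorkinNeighbours n j, G j z x := fun j => by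
    funext x
    rw [hV.dyadicBlock_eq η j]
  obtain ⟨g, hg, hgn⟩ := exists_hasTrace η f γ hγ
    (fun j => ∑ z ∈ lizorkinNeighbours n j, A' * pieceNorm s p w z)
    (ne_top_of_le_ne_top (by
      rw [ENNReal.tsum_mul_left]
      exact ENNReal.mul_ne_top (ENNReal.natCast_ne_top _) (ENNReal.mul_ne_top hA' hsum))
      (tsum_sum_lizorkinNeighbours_le _))
    (fun j ψ => by
      have e : ∫ x, ψ x * dyadicBlock η j f (hyperplanePoint x) =
          ∑ z ∈ lizorkinNeighbours n j, ∫ x, ψ x * G j z x := by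
        rw [← integral_finsetSum _ fun z _ =>
          (hBL j z).growth.integrable_mul (hBL j z).aestronglyMeasurable ψ]
        refine integral_congr_ae (Eventually.of_forall fun x => ?_)
        simp only
        rw [← Finset.mul_sum, ← congrFun (hfG j) x]
      rw [e, Finset.sum_mul]
      exact (enorm_sum_le _ _).trans (Finset.sum_le_sum fun z hz => hgγ f w V hV j z hz ψ))
  refine ⟨g, hg, (hgn s hr0 hr1 ?_ hrq).trans ?_⟩
  · exact (ENNReal.ofReal_le_one.2 hr1).trans hp.le
  have hrp : ENNReal.ofReal r ≤ p := (ENNReal.ofReal_le_one.2 hr1).trans hp.le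
  have hpiece : ∀ j, ∀ z ∈ lizorkinNeighbours n j,
      ∑' i : ℕ, ((2 : ℝ≥0∞) ^ (s * i) * eLpNorm (smoothBlock η i (G j z)) p volume) ^ r ≤
        B * E z := fun j z hz => by
    set X : ℝ≥0∞ := 2 ^ (p⁻¹.toReal * z.1) * eLpNorm (w z) p volume with hX
    obtain ⟨hjz, hzj⟩ := mem_lizorkinNeighbours.1 hz
    have h3 : ∀ i ≤ j + 1, eLpNorm (smoothBlock η i (G j z)) p volume ≤ C₂ * A * X := fun i hi =>
      (h₂ i j (G j z) hi (hBL j z)).trans (by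
        rw [mul_assoc]
        exact mul_le_mul' le_rfl (hgA f w V hV j z hz))
    have hone : (1 : ℝ≥0∞) ≤ 2 ^ (-2 * s) := by
      rw [← ENNReal.rpow_zero (x := 2)]
      exact two_rpow_le (by linarith)
    by_cases hnear : IsNearAxis z.2
    · have hXE : pieceNorm s p w z = X := if_pos hnear
      have hEz : E z = W z.1 * X ^ r := by rw [hE]; simp only; rw [if_pos hnear, hXE]
      rw [tsum_eq_sum (s := Finset.range (z.1 + n + 2)) fun i hi => by
        rw [smoothBlock_eq_zero η (by rw [Finset.mem_range] at hi; omega) (hBL j z), eLpNorm_zero,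
          mul_zero, ENNReal.zero_rpow_of_pos hr0]]
      have h4 : ∀ i ∈ Finset.range (z.1 + n + 2),
          ((2 : ℝ≥0∞) ^ (s * i) * eLpNorm (smoothBlock η i (G j z)) p volume) ^ r ≤
          (C₂ * A * X) ^ r * 2 ^ (s * i * r) := fun i _ => by
        rw [ENNReal.mul_rpow_of_nonneg _ _ hr0.le, ← ENNReal.rpow_mul, mul_comm]
        gcongr
        rcases le_or_gt i (j + 1) with hi | hi
        · exact h3 i hi
        · rw [smoothBlock_eq_zero η (by omega) (hBL j z), eLpNorm_zero]
          exact zero_le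
      refine (Finset.sum_le_sum h4).trans ?_
      rw [← Finset.mul_sum, hEz]
      -- `W 0` is not bounded below and vanishes in the logarithmic case, but there is no piece of
      -- level `0` near the axis.
      rcases Nat.eq_zero_or_pos z.1 with h0 | h0
      · have hX0 : X = 0 := by
          rw [← hXE]
          obtain ⟨k, t⟩ := z
          simp only at h0
          subst h0
          exact hnear0 t hnear
        rw [hX0, mul_zero, ENNReal.zero_rpow_of_pos hr0, zero_mul]
        exact zero_le
      · calc (C₂ * A * X) ^ r * ∑ i ∈ Finset.range (z.1 + n + 2), (2 : ℝ≥0∞) ^ (s * i * r)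
            ≤ (C₂ * A * 2 ^ (-2 * s) * X) ^ r * ((W₀ + (n + 4 : ℕ)) * W z.1) := by
              gcongr ?_ ^ r * ?_
              · exact mul_le_mul' (le_mul_of_one_le_right zero_le hone) le_rfl
              · exact (hsW _ h0).trans (mul_le_mul' le_self_add le_rfl)
          _ = B * (W z.1 * X ^ r) := by
              rw [ENNReal.mul_rpow_of_nonneg _ _ hr0.le, hBd]; ring
    · have hXE : pieceNorm s p w z = 2 ^ (s * z.1) * X := by
        rw [pieceNorm, if_neg hnear, add_mul, two_rpow_add, mul_assoc]
      have hEz : E z = (2 ^ (s * z.1) * X) ^ r := by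
        rw [hE]; simp only; rw [if_neg hnear, hXE, one_mul]
      rw [tsum_eq_sum (s := Finset.Ico (z.1 - 2) (z.1 + n + 2)) fun i hi => by
        rw [Finset.mem_Ico, not_and_or] at hi
        have : smoothBlock η i (G j z) = 0 := by
          rcases hi with hi | hi
          · exact (hV.spectrum z).smoothBlock_trace_eq_zero η hnear j (by omega)
          · exact smoothBlock_eq_zero η (by omega) (hBL j z)
        rw [this, eLpNorm_zero, mul_zero, ENNReal.zero_rpow_of_pos hr0]]
      have h4 : ∀ i ∈ Finset.Ico (z.1 - 2) (z.1 + n + 2),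
          ((2 : ℝ≥0∞) ^ (s * i) * eLpNorm (smoothBlock η i (G j z)) p volume) ^ r ≤
          (C₂ * A * 2 ^ (-2 * s)) ^ r * E z := fun i hi => by
        rw [hEz, ← ENNReal.mul_rpow_of_nonneg _ _ hr0.le]
        refine ENNReal.rpow_le_rpow ?_ hr0.le
        have hsi : (2 : ℝ≥0∞) ^ (s * i) ≤ 2 ^ (-2 * s) * 2 ^ (s * z.1) := by
          rw [← two_rpow_add]
          refine two_rpow_le ?_
          have h5 : z.1 ≤ i + 2 := by have := (Finset.mem_Ico.1 hi).1; omega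
          have h6 : (z.1 : ℝ) ≤ i + 2 := by exact_mod_cast h5
          nlinarith
        have hle : eLpNorm (smoothBlock η i (G j z)) p volume ≤ C₂ * A * X := by
          rcases le_or_gt i (j + 1) with hi | hi
          · exact h3 i hi
          · rw [smoothBlock_eq_zero η (by omega) (hBL j z), eLpNorm_zero]
            exact zero_le
        calc (2 : ℝ≥0∞) ^ (s * i) * eLpNorm (smoothBlock η i (G j z)) p volume
            ≤ 2 ^ (-2 * s) * 2 ^ (s * z.1) * (C₂ * A * X) := mul_le_mul' hsi hle
          _ = _ := by ring
      refine (Finset.sum_le_sum h4).trans ?_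
      rw [Finset.sum_const, Nat.card_Ico, nsmul_eq_mul, hBd]
      calc ((z.1 + n + 2 - (z.1 - 2) : ℕ) : ℝ≥0∞) * ((C₂ * A * 2 ^ (-2 * s)) ^ r * E z)
          ≤ (W₀ + (n + 4 : ℕ)) * ((C₂ * A * 2 ^ (-2 * s)) ^ r * E z) := by
            refine mul_le_mul' (le_trans ?_ le_add_self) le_rfl
            exact_mod_cast (by omega : z.1 + n + 2 - (z.1 - 2) ≤ n + 4)
        _ = _ := by ring
  have hblock : ∀ j, ∑' i : ℕ, ((2 : ℝ≥0∞) ^ (s * i) * eLpNorm (smoothBlock η i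
      fun x : Rn (n - 1) => dyadicBlock η j f (hyperplanePoint x)) p volume) ^ r ≤
      ∑ z ∈ lizorkinNeighbours n j, B * E z := fun j => by
    refine le_trans ?_ (Finset.sum_le_sum fun z hz => hpiece j z hz)
    rw [← Summable.tsum_finsetSum fun _ _ => ENNReal.summable]
    refine ENNReal.tsum_le_tsum fun i => ?_
    rw [hfG, smoothBlock_sum η i _ _ (fun z _ => (hBL j z).growth)
      fun z _ => (hBL j z).aestronglyMeasurable]
    simp only [ENNReal.mul_rpow_of_nonneg _ _ hr0.le]
    rw [← Finset.mul_sum]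
    gcongr
    exact eLpNorm_sum_rpow_le hr0 hr1 hrp _ _ fun z _ => (continuous_smoothBlock η i
      (hBL j z).growth (hBL j z).aestronglyMeasurable).aestronglyMeasurable
  rw [← ENNReal.mul_rpow_of_nonneg _ _ (by positivity), mul_assoc, ← ENNReal.tsum_mul_left]
  exact ENNReal.rpow_le_rpow ((ENNReal.tsum_le_tsum hblock).trans
    (tsum_sum_lizorkinNeighbours_le _)) (by positivity)

theorem HasTrace.unique {η : DyadicBump} {n : ℕ} {f : 𝓢'(Rn n, ℂ)} {g g' : 𝓢'(Rn (n - 1), ℂ)}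
    (h : HasTrace η f g) (h' : HasTrace η f g') : g = g' := by
  ext ψ
  exact tendsto_nhds_unique (h ψ) (h' ψ)

open Classical in
theorem traceMaps_lizorkin (η : DyadicBump) {n : ℕ} (hn : 2 ≤ n) {p q : ℝ≥0∞}
    (hp : 1 < p) {r : ℝ} (hr0 : 0 < r) (hr1 : r ≤ 1) (hrq : ENNReal.ofReal r ≤ q) {s : ℝ}
    (hs : s ≤ 0) (W : ℕ → ℝ≥0∞) (hW : ∀ k, 1 ≤ k → 1 ≤ W k) (W₀ : ℝ≥0∞) (hW₀ : W₀ ≠ ∞)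
    (hsW : ∀ k, 1 ≤ k →
      ∑ i ∈ Finset.range (k + n + 2), (2 : ℝ≥0∞) ^ (s * i * r) ≤ W₀ * W k) :
    TraceMaps η (n := n)
      (fun f => ⨅ (u : LizorkinFamily n) (_ : IsLizorkinDecomposition p f u),
        (∑' k : ℕ, ∑ t : LizorkinIndex n, if IsNearAxis t then
            W k * ((2 : ℝ≥0∞) ^ (p⁻¹.toReal * k) * eLpNorm (u.piece k t) p volume) ^ r
          else ((2 : ℝ≥0∞) ^ ((s + p⁻¹.toReal) * k) * eLpNorm (u.piece k t) p volume) ^ r) ^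
          (1 / r))
      (besovNorm η s p q) := by
  obtain ⟨C, hC, h⟩ := exists_hasTrace_lizorkinSeries η hn hp hr0 hr1 hrq hs W hW W₀ hW₀ hsW
  -- A nonzero constant is required: the right-hand side must be infinite for decompositions of
  -- infinite norm.
  have hC1 : C + 1 ≠ ∞ := ENNReal.add_ne_top.2 ⟨hC, ENNReal.one_ne_top⟩
  have key : ∀ (f : 𝓢'(Rn n, ℂ)) (u : LizorkinFamily n), IsLizorkinDecomposition p f u →
      (∑' k : ℕ, ∑ t : LizorkinIndex n, if IsNearAxis t then
            W k * ((2 : ℝ≥0∞) ^ (p⁻¹.toReal * k) * eLpNorm (u.piece k t) p volume) ^ r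
          else ((2 : ℝ≥0∞) ^ ((s + p⁻¹.toReal) * k) * eLpNorm (u.piece k t) p volume) ^ r) ^
          (1 / r) ≠ ∞ →
      ∃ g, HasTrace η f g ∧ besovNorm η s p q g ≤ (C + 1) *
        (∑' k : ℕ, ∑ t : LizorkinIndex n, if IsNearAxis t then
            W k * ((2 : ℝ≥0∞) ^ (p⁻¹.toReal * k) * eLpNorm (u.piece k t) p volume) ^ r
          else ((2 : ℝ≥0∞) ^ ((s + p⁻¹.toReal) * k) * eLpNorm (u.piece k t) p volume) ^ r) ^
          (1 / r) := fun f u hu hfin => by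
    obtain ⟨w, V, hV, hwu⟩ := hu.exists_series hn hp.le
    have hle : ∑' z, (if IsNearAxis z.2 then W z.1 else 1) * pieceNorm s p w z ^ r ≤
        ∑' k : ℕ, ∑ t : LizorkinIndex n, if IsNearAxis t then
            W k * ((2 : ℝ≥0∞) ^ (p⁻¹.toReal * k) * eLpNorm (u.piece k t) p volume) ^ r
          else ((2 : ℝ≥0∞) ^ ((s + p⁻¹.toReal) * k) * eLpNorm (u.piece k t) p volume) ^ r := by
      rw [ENNReal.tsum_prod']
      refine ENNReal.tsum_le_tsum fun k => ?_
      rw [tsum_fintype]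
      refine Finset.sum_le_sum fun t _ => ?_
      have := hwu (k, t)
      rw [pieceNorm]
      simp only at this ⊢
      split_ifs
      · gcongr
      · rw [one_mul]
        gcongr
    have hle' := ENNReal.rpow_le_rpow hle (z := 1 / r) (by positivity)
    obtain ⟨g, hg, hgn⟩ := h f w V hV fun htop => by
      rw [htop, ENNReal.top_rpow_of_pos (by positivity), top_le_iff] at hle'
      exact hfin hle'
    exact ⟨g, hg, hgn.trans (mul_le_mul' le_self_add hle')⟩
  refine ⟨(C + 1).toNNReal, fun f hf => ?_⟩
  rw [ENNReal.coe_toNNReal hC1]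
  obtain ⟨u, hu, hfu⟩ : ∃ u, ∃ _ : IsLizorkinDecomposition p f u,
      (∑' k : ℕ, ∑ t : LizorkinIndex n, if IsNearAxis t then
            W k * ((2 : ℝ≥0∞) ^ (p⁻¹.toReal * k) * eLpNorm (u.piece k t) p volume) ^ r
          else ((2 : ℝ≥0∞) ^ ((s + p⁻¹.toReal) * k) * eLpNorm (u.piece k t) p volume) ^ r) ^
          (1 / r) < ∞ := by
    simpa only [iInf_lt_iff] using hf
  obtain ⟨g, hg, -⟩ := key f u hu hfu.ne
  refine ⟨g, hg, ?_⟩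
  simp only
  -- The trace does not depend on the decomposition that produced it, so the estimate holds for
  -- every decomposition and passes to the infimum.
  rw [ENNReal.mul_iInf_of_ne (by simp) hC1]
  refine le_iInf fun u' => ?_
  rw [ENNReal.mul_iInf_of_ne (by simp) hC1]
  refine le_iInf fun hu' => ?_
  by_cases hfin : (∑' k : ℕ, ∑ t : LizorkinIndex n, if IsNearAxis t then
            W k * ((2 : ℝ≥0∞) ^ (p⁻¹.toReal * k) * eLpNorm (u'.piece k t) p volume) ^ r
          else ((2 : ℝ≥0∞) ^ ((s + p⁻¹.toReal) * k) * eLpNorm (u'.piece k t) p volume) ^ r) ^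
          (1 / r) = ∞
  · rw [hfin, ENNReal.mul_top (by simp)]
    exact le_top
  · obtain ⟨g', hg', hgn⟩ := key f u' hu' hfin
    rwa [hg.unique hg']

theorem traceMaps_logAnisoBesovNorm (η : DyadicBump) {n : ℕ} (hn : 2 ≤ n) {p q : ℝ≥0∞}
    (hp : 1 < p) (hq : 0 < q) :
    TraceMaps η (n := n) (logAnisoBesovNorm p⁻¹.toReal p⁻¹.toReal p (min q 1).toReal)
      (besovNorm η 0 p q) := by
  have hm1 : min q 1 ≤ 1 := min_le_right _ _
  have hmt : min q 1 ≠ ∞ := ne_top_of_le_ne_top ENNReal.one_ne_top hm1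
  -- For `s = 0` all frequencies count equally; `k + n + 2 ≤ (n + 3) k` for `k ≥ 1` explains the
  -- constant and why the weight `k` suffices.
  have := traceMaps_lizorkin η hn (q := q) hp
    (ENNReal.toReal_pos (lt_min hq one_pos).ne' hmt)
    (by simpa using ENNReal.toReal_mono ENNReal.one_ne_top hm1)
    (by rw [ENNReal.ofReal_toReal hmt]; exact min_le_left _ _) (s := 0) le_rfl
    (fun k => (k : ℝ≥0∞)) (fun k hk => by exact_mod_cast hk) ((n + 3 : ℕ) : ℝ≥0∞)
    (ENNReal.natCast_ne_top _) fun k hk => by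
      simp only [zero_mul, ENNReal.rpow_zero, Finset.sum_const, Finset.card_range, nsmul_eq_mul,
        mul_one]
      have : k + n + 2 ≤ (n + 3) * k := by nlinarith
      exact_mod_cast this
  simp only [zero_add] at this
  exact this

theorem traceMaps_anisoBesovNorm (η : DyadicBump) {n : ℕ} (hn : 2 ≤ n) {p q : ℝ≥0∞}
    (hp : 1 < p) (hq : 0 < q) {s : ℝ} (hs : s < 0) :
    TraceMaps η (n := n) (anisoBesovNorm p⁻¹.toReal (s + p⁻¹.toReal) p (min q 1).toReal)
      (besovNorm η s p q) := by
  have hm1 : min q 1 ≤ 1 := min_le_right _ _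
  have hmt : min q 1 ≠ ∞ := ne_top_of_le_ne_top ENNReal.one_ne_top hm1
  have hr0 := ENNReal.toReal_pos (lt_min hq one_pos).ne' hmt
  obtain ⟨W₀, hW₀, hW⟩ := sum_geometric_rpow_le (mul_neg_of_neg_of_pos hs hr0)
  -- For `s < 0` the sum over the frequencies is geometric, so the pieces near the axis need no
  -- weight either.
  have := traceMaps_lizorkin η hn (q := q) hp hr0
    (by simpa using ENNReal.toReal_mono ENNReal.one_ne_top hm1)
    (by rw [ENNReal.ofReal_toReal hmt]; exact min_le_left _ _) hs.le
    (fun _ => 1) (fun _ _ => le_rfl) W₀ hW₀ fun k _ => by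
      rw [mul_one]
      refine le_trans (le_of_eq (Finset.sum_congr rfl fun i _ => ?_))
        (hW (Finset.range (k + n + 2)))
      congr 1
      ring
  simp only [one_mul] at this
  exact this
theorem mainTheorem6 (n : ℕ) (hn : 2 ≤ n) (η : DyadicBump) :
    -- the trace of a continuous function of at most polynomial growth is its restriction
    (∀ (f : 𝓢'(Rn n, ℂ)) (F : Rn n → ℂ), Continuous F →
      (∃ (A : ℝ) (m : ℕ), ∀ x, ‖F x‖ ≤ A * (1 + ‖x‖) ^ m) →
      (∀ ψ : 𝓢(Rn n, ℂ), f ψ = ∫ x, ψ x * F x) →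
      ∃ g : 𝓢'(Rn (n - 1), ℂ), HasTrace η f g ∧
        ∀ ψ : 𝓢(Rn (n - 1), ℂ), g ψ = ∫ x, ψ x * F (hyperplanePoint x)) ∧
    (∀ p q : ℝ≥0∞, 0 < p → 0 < q →
      TraceMaps η (n := n)
        (logBesovNorm η (traceIndex n p + p⁻¹.toReal) p (min p (min q 1)).toReal)
        (besovNorm η (traceIndex n p) p q) ∧
      (∀ s : ℝ, s < traceIndex n p →
        TraceMaps η (n := n)
          (besovNorm η (traceIndex n p + p⁻¹.toReal) p (min p (min q 1)))
          (besovNorm η s p q)) ∧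
      (1 < p → p < ∞ →
        TraceMaps η (n := n)
          (logAnisoBesovNorm p⁻¹.toReal p⁻¹.toReal p (min q 1).toReal)
          (besovNorm η 0 p q) ∧
        ∀ s : ℝ, s < 0 →
          TraceMaps η (n := n)
            (anisoBesovNorm p⁻¹.toReal (s + p⁻¹.toReal) p (min q 1).toReal)
            (besovNorm η s p q))) :=
  ⟨fun f F hF hgr hf => exists_hasTrace_of_continuous η f F hF hgr hf, fun _p _q hp hq =>
    ⟨traceMaps_logBesovNorm η hn hp hq, fun _s hs => traceMaps_besovNorm η hn hp hq hs, fun hp1 _ =>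
      ⟨traceMaps_logAnisoBesovNorm η hn hp1 hq,
        fun _s hs => traceMaps_anisoBesovNorm η hn hp1 hq hs⟩⟩⟩
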